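/- Let $G$ be a discrete group, and let $X$ be a cocompact model for the classifying space for proper actions $\underline{E}G$; that is, $X$ is a $G$-CW-complex with finite point stabilizers and compact orbit space $G\backslash X$ such that the fixed point complex $X^H$ is contractible for every finite subgroup $H$ of $G$. Let $\mathcal F$ be the family of finite subgroups of $G$. The Bredon cohomological dimension $\underline{\mathrm{cd}}(G)$ is the smallest possible length of a projective resolution of the constant functor $\underline{\mathbb Z}$ in the category of contravariant functors from the orbit category $\mathcal O_{\mathcal F}G$ (objects $G/H$ with $H\in\mathcal F$, morphisms the $G$-maps) to $\mathbb Z$-modules. For $K\in\mathcal F$ put $$X^K_{\mathrm{sing}}=\bigcup_{K\subsetneq L\in\mathcal F}X^L\subseteq X^K .$$ For a CW-complex $Y$ with a subcomplex $A$, let $\mathrm{Hom}_c(C_n(Y),\mathbb Z)$ be the group of integral cellular $n$-cochains that vanish on all but finitely many $n$-cells, let $C^n_c(Y,A)$ be the kernel of the restriction $\mathrm{Hom}_c(C_n(Y),\mathbb Z)\to\mathrm{Hom}_c(C_n(A),\mathbb Z)$, and let $\mathrm H^n_c(Y,A)$ be the $n$-th cohomology of $C^*_c(Y,A)$. (The complexes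 $X^K$ are locally finite, so the coboundary operator preserves compact supports.) Then $\underline{\mathrm{cd}}(G)$ is finite, the set on the right-hand side below is non-empty and has a largest element, and $$\underline{\mathrm{cd}}(G)=\max\{\,n\in\mathbb N \mid \mathrm H^n_c(X^K,X^K_{\mathrm{sing}})\neq 0\ \text{for some}\ K\in\mathcal F\,\}.$$ -/

import Mathlib

open CategoryTheory Topology

universe u v

set_option linter.unusedSectionVars false

noncomputable section

namespace BredonCW

/-! ### The orbit category and the Bredon cohomological dimension -/

/-- An object of the orbit category of `G` with respect to the family of finite subgroups:
a finite subgroup `H`, standing for the `G`-set `G ⧸ H`. -/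
structure OrbitCat (G : Type v) [Group G] where
  /-- the finite subgroup -/
  sub : Subgroup G
  finite : Finite sub

/-- Morphisms of the orbit category are the `G`-maps `G ⧸ H → G ⧸ L`. -/
instance (G : Type v) [Group G] : Category.{v} (OrbitCat G) where
  Hom A B := (G ⧸ A.sub) →[G] (G ⧸ B.sub)
  id A := MulActionHom.id G
  comp f g := g.comp f

/-- Right modules over the orbit category: contravariant functors to `ℤ`-modules. -/
abbrev OrbitModule (G : Type v) [Group G] : Type _ :=
  (OrbitCat G)ᵒᵖ ⥤ ModuleCat.{v} ℤ

/-- The constant functor with value `ℤ` (lifted to the universe of `G`). -/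
def trivialModule (G : Type v) [Group G] : OrbitModule G :=
  (Functor.const _).obj (ModuleCat.of ℤ (ULift.{v} ℤ))

/-- The trivial module has a projective resolution `0 → P_n → ⋯ → P_0 → ℤ → 0`. -/
def HasResolutionOfLength (G : Type v) [Group G] (n : ℕ) : Prop :=
  ∃ P : ProjectiveResolution (trivialModule G), ∀ i, n < i → Limits.IsZero (P.complex.X i)

/-- The Bredon cohomological dimension (for proper actions) of `G`: the smallest possible length
of a projective resolution of the trivial module, and `⊤` if there is none of finite length. -/
def bredonCd (G : Type v) [Group G] : ℕ∞ :=
  ⨅ n ∈ {n : ℕ | HasResolutionOfLength G n}, (n : ℕ∞)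

/-! ### Relative singular homology and the cellular chain complex -/

/-- The integral singular chain complex, as a functor. -/
abbrev singularFunctor : TopCat.{u} ⥤ ChainComplex AddCommGrpCat.{u} ℕ :=
  (AlgebraicTopology.singularChainComplexFunctor AddCommGrpCat.{u}).obj
    (AddCommGrpCat.of (ULift.{u} ℤ))

/-- The group of integral singular `n`-chains of `X`. -/
abbrev SingularChains (X : Type u) [TopologicalSpace X] (n : ℕ) : Type u :=
  (singularFunctor.obj (TopCat.of X)).X n

/-- The map on singular `n`-chains induced by a continuous map. -/
def singularMap {Y X : Type u} [TopologicalSpace Y] [TopologicalSpace X] (f : C(Y, X)) (n : ℕ) :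
    SingularChains Y n →+ SingularChains X n :=
  ((singularFunctor.map (TopCat.ofHom f)).f n).hom

/-- The boundary operator from degree `i` to degree `j` (zero unless `i = j + 1`). -/
def boundary (X : Type u) [TopologicalSpace X] (i j : ℕ) :
    SingularChains X i →+ SingularChains X j :=
  ((singularFunctor.obj (TopCat.of X)).d i j).hom

theorem boundary_boundary (X : Type u) [TopologicalSpace X] (i j k : ℕ)
    (c : SingularChains X i) : boundary X j k (boundary X i j c) = 0 :=
  DFunLike.congr_fun (congrArg AddCommGrpCat.Hom.hom
    ((singularFunctor.obj (TopCat.of X)).d_comp_d i j k)) c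

variable {X : Type u} [TopologicalSpace X]

/-- The singular chains of the subspace `A`, as a subgroup of the singular chains of `X`. -/
def chainsIn (A : Set X) (n : ℕ) : AddSubgroup (SingularChains X n) :=
  (singularMap (⟨Subtype.val, continuous_subtype_val⟩ : C(A, X)) n).range

/-- Relative cycles of the pair `(A, B)`: chains in `A` with boundary in `B`. -/
def relCycles (A B : Set X) (n : ℕ) : AddSubgroup (SingularChains X n) :=
  chainsIn A n ⊓ (chainsIn B (n - 1)).comap (boundary X n (n - 1))

/-- Relative boundaries of the pair `(A, B)`: chains in `B` plus boundaries of chains in `A`. -/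
def relBoundaries (A B : Set X) (n : ℕ) : AddSubgroup (SingularChains X n) :=
  chainsIn B n ⊔ (chainsIn A (n + 1)).map (boundary X (n + 1) n)

/-- Relative singular homology `H_n(A, B)`, for subspaces `B ⊆ A` of `X`. -/
abbrev RelHomology (A B : Set X) (n : ℕ) : Type u :=
  relCycles A B n ⧸ (relBoundaries A B n).addSubgroupOf (relCycles A B n)

/-- The class of a relative cycle. -/
abbrev relClass (A B : Set X) (n : ℕ) : relCycles A B n →+ RelHomology A B n :=
  QuotientAddGroup.mk' _

/-- The boundary operator from relative cycles of `(A, B)` to relative cycles of `(B, B')`. -/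
def relCyclesBoundary (A B B' : Set X) (n : ℕ) :
    relCycles A B (n + 1) →+ relCycles B B' n :=
  ((boundary X (n + 1) n).comp (relCycles A B (n + 1)).subtype).codRestrict (relCycles B B' n) (fun c => by
    refine AddSubgroup.mem_inf.2 ⟨c.2.2, ?_⟩
    rw [AddSubgroup.mem_comap]
    have h : boundary X n (n - 1) (boundary X (n + 1) n c.1) ∈ chainsIn B' (n - 1) := by
      rw [boundary_boundary]
      exact AddSubgroup.zero_mem _
    exact h)

/-- The connecting homomorphism `H_{n+1}(A, B) → H_n(B, B')` of the triple `B' ⊆ B ⊆ A`, which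
sends the class of `c` to the class of its boundary. -/
def connecting (A B B' : Set X) (n : ℕ) : RelHomology A B (n + 1) →+ RelHomology B B' n :=
  QuotientAddGroup.map _ _ (relCyclesBoundary A B B' n) (by
    rintro ⟨c, hc⟩ h
    obtain ⟨b, hb, e, ⟨a, -, rfl⟩, hce⟩ := AddSubgroup.mem_sup.1 (AddSubgroup.mem_addSubgroupOf.1 h)
    change boundary X (n + 1) n c ∈ relBoundaries B B' n
    replace hce : b + boundary X (n + 1 + 1) (n + 1) a = c := hce
    rw [← hce, map_add, boundary_boundary, add_zero]
    exact AddSubgroup.mem_sup_right ⟨b, hb, rfl⟩)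

section Cellular

variable [T2Space X]

/-- The `n`-th cellular chain group `H_n(C_n, C_{n-1})` of a CW complex `C`.  Here
`skeletonLT C (n + 1)` is the `n`-skeleton, and `skeletonLT C n` is the `(n - 1)`-skeleton. -/
abbrev CellularChains (C : Set X) [CWComplex C] (n : ℕ) : Type u :=
  RelHomology (RelCWComplex.skeletonLT C ((n + 1 : ℕ) : ℕ∞) : Set X)
    (RelCWComplex.skeletonLT C (n : ℕ∞) : Set X) n

/-- The cellular boundary operator. -/
def cellularBoundary (C : Set X) [CWComplex C] (n : ℕ) :
    CellularChains C (n + 1) →+ CellularChains C n :=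
  connecting _ _ _ n

/-- Integral cellular cochains. -/
abbrev CellularCochains (C : Set X) [CWComplex C] (n : ℕ) : Type u :=
  CellularChains C n →+ ℤ

/-- The cellular coboundary operator, dual to the cellular boundary operator. -/
def cellularCoboundary (C : Set X) [CWComplex C] (n : ℕ) :
    CellularCochains C n →+ CellularCochains C (n + 1) :=
  AddMonoidHom.compHom' (cellularBoundary C n)

/-- The closed unit ball in `Fin n → ℝ` (lifted to the universe of `X`). -/
abbrev Disk (n : ℕ) : Type u := ULift.{u} (Metric.closedBall (0 : Fin n → ℝ) 1)

/-- The boundary sphere of the closed unit ball. -/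
def diskSphere (n : ℕ) : Set (Disk.{u} n) := {x | (x.down : Fin n → ℝ) ∈ Metric.sphere 0 1}

/-- The characteristic map of a cell as a continuous map on the closed unit ball. -/
def charMap (C : Set X) [CWComplex C] (n : ℕ) (e : RelCWComplex.cell C n) : C(Disk.{u} n, X) :=
  ⟨fun x => RelCWComplex.map n e x.down,
    (continuousOn_iff_continuous_domRestrict.1 (RelCWComplex.continuousOn n e)).comp
      continuous_uliftDown⟩

/-- The cochain `f` vanishes on the `n`-cell `e`: it is zero on the image of `H_n(D^n, S^{n-1})`
in `H_n(C_n, C_{n-1})` under the characteristic map of `e`. This image is the infinite cyclic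
group generated by the basis element of the cellular chain group given by `e`. -/
def VanishesOnCell {C : Set X} [CWComplex C] {n : ℕ} (f : CellularCochains C n)
    (e : RelCWComplex.cell C n) : Prop :=
  ∀ z ∈ relCycles Set.univ (diskSphere.{u} n) n, ∀ c : relCycles _ _ n,
    singularMap (charMap C n e) n z = c → f (relClass _ _ n c) = 0

/-- `Hom_c`: the cochains that vanish on all but finitely many `n`-cells. -/
def compactCochains (C : Set X) [CWComplex C] (n : ℕ) : AddSubgroup (CellularCochains C n) where
  carrier := {f | {e : RelCWComplex.cell C n | ¬ VanishesOnCell f e}.Finite}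
  zero_mem' := by simp [VanishesOnCell]
  add_mem' {f g} hf hg := (Set.Finite.union hf hg).subset (fun e he => by
    by_contra h
    obtain ⟨h1, h2⟩ := not_or.1 h
    exact he (fun z hz c hc => by
      rw [AddMonoidHom.add_apply, not_not.1 h1 z hz c hc, not_not.1 h2 z hz c hc, add_zero]))
  neg_mem' {f} hf := Set.Finite.subset hf (fun e he h => he (fun z hz c hc => by
    rw [AddMonoidHom.neg_apply, h z hz c hc, neg_zero]))

/-- The cochains of a CW complex `C` that restrict to zero on the subcomplex `A`, that is, that
vanish on the image of the cellular chains of `A`. -/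
def relCochains (C A : Set X) [CWComplex C] [CWComplex A] (n : ℕ) :
    AddSubgroup (CellularCochains C n) where
  carrier := {f | ∀ c : relCycles (RelCWComplex.skeletonLT C ((n + 1 : ℕ) : ℕ∞) : Set X)
      (RelCWComplex.skeletonLT C (n : ℕ∞) : Set X) n,
    (c : SingularChains X n) ∈
      relCycles (RelCWComplex.skeletonLT A ((n + 1 : ℕ) : ℕ∞) : Set X)
        (RelCWComplex.skeletonLT A (n : ℕ∞) : Set X) n →
    f (relClass _ _ n c) = 0}
  zero_mem' c hc := rfl
  add_mem' hf hg c hc := by rw [AddMonoidHom.add_apply, hf c hc, hg c hc, add_zero]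
  neg_mem' hf c hc := by rw [AddMonoidHom.neg_apply, hf c hc, neg_zero]

/-- The group `C_c^n(C, A)` of compactly supported relative cochains: the kernel of the
restriction map from `Hom_c(C_n(C), ℤ)` to `Hom_c(C_n(A), ℤ)`. -/
def relCompactCochains (C A : Set X) [CWComplex C] [CWComplex A] (n : ℕ) :
    AddSubgroup (CellularCochains C n) :=
  compactCochains C n ⊓ relCochains C A n

/-- Compactly supported relative cocycles. -/
def relCompactCocycles (C A : Set X) [CWComplex C] [CWComplex A] (n : ℕ) :
    AddSubgroup (CellularCochains C n) :=
  relCompactCochains C A n ⊓ (cellularCoboundary C n).ker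

/-- Coboundaries of compactly supported relative cochains. -/
def relCompactCoboundaries (C A : Set X) [CWComplex C] [CWComplex A] :
    (n : ℕ) → AddSubgroup (CellularCochains C n)
  | 0 => ⊥
  | n + 1 => (relCompactCochains C A n).map (cellularCoboundary C n)

/-- The relative cohomology with compact support `H^n_c(C, A)` of a CW complex `C` and a
subcomplex `A`: cocycles in `C_c^n(C, A)` modulo coboundaries of elements of `C_c^{n-1}(C, A)`.
(If `C` is locally finite, then the coboundary operator preserves compact supports.) -/
abbrev RelCompactCohomology (C A : Set X) [CWComplex C] [CWComplex A] (n : ℕ) : Type u :=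
  relCompactCocycles C A n ⧸
    (relCompactCoboundaries C A n).addSubgroupOf (relCompactCocycles C A n)

end Cellular

/-! ### `G`-CW complexes and classifying spaces for proper actions -/

section GCW

variable (G : Type v) [Group G] (X : Type u) [TopologicalSpace X] [T2Space X] [MulAction G X]
  [ContinuousConstSMul G X] [CWComplex (Set.univ : Set X)]

/-- `X` is a `G`-CW complex, for the discrete group `G`: the elements of `G` permute the open
cells, and an element that maps an open cell to itself fixes this cell pointwise. -/
class IsGCWComplex : Prop where
  smul_openCell : ∀ (g : G) (n : ℕ) (e : RelCWComplex.cell (Set.univ : Set X) n),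
    ∃ e' : RelCWComplex.cell (Set.univ : Set X) n,
      (fun x => g • x) '' RelCWComplex.openCell n e = RelCWComplex.openCell n e'
  smul_eq : ∀ (g : G) (n : ℕ) (e : RelCWComplex.cell (Set.univ : Set X) n),
    (fun x => g • x) '' RelCWComplex.openCell n e = RelCWComplex.openCell n e →
      ∀ x ∈ RelCWComplex.openCell n e, g • x = x

/-- The `G`-CW complex `X` is a cocompact model for the classifying space for proper actions of
`G`: point stabilizers are finite, the orbit space is compact, and the fixed point sets of all
finite subgroups are contractible. -/
structure IsCocompactModel : Prop extends IsGCWComplex G X where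
  finite_stabilizer : ∀ x : X, Finite (MulAction.stabilizer G x)
  compactSpace_quotient : CompactSpace (Quotient (MulAction.orbitRel G X))
  contractible : ∀ H : Subgroup G, Finite H → ContractibleSpace (MulAction.fixedPoints H X)

variable {G}

/-- The fixed point set `X^K`. -/
def fixedSet (K : Subgroup G) : Set X := MulAction.fixedPoints K X

/-- The singular set: the union of the sets `X^L` over the finite subgroups `L` of `G` that
strictly contain `K`. -/
def singSet (K : Subgroup G) : Set X := ⋃ L ∈ {L : Subgroup G | Finite L ∧ K < L}, fixedSet X L

variable {X}

theorem mem_fixedSet {K : Subgroup G} {x : X} : x ∈ fixedSet X K ↔ ∀ g ∈ K, g • x = x :=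
  ⟨fun h g hg => h ⟨g, hg⟩, fun h g => h g.1 g.2⟩

theorem isClosed_fixedSet (K : Subgroup G) : IsClosed (fixedSet X K) := by
  have : fixedSet X K = ⋂ g ∈ K, {x : X | g • x = x} := by
    ext x; simp [mem_fixedSet]
  rw [this]
  exact isClosed_biInter fun g _ => isClosed_eq (continuous_const_smul g) continuous_id

/-- An open cell that meets `X^K` lies in `X^K`. -/
theorem openCell_subset_fixedSet [hX : IsGCWComplex G X] (K : Subgroup G) {n : ℕ}
    {e : RelCWComplex.cell (Set.univ : Set X) n} {x : X} (hxe : x ∈ RelCWComplex.openCell n e)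
    (hx : x ∈ fixedSet X K) : RelCWComplex.openCell n e ⊆ fixedSet X K := by
  intro y hy
  rw [mem_fixedSet] at hx ⊢
  intro g hg
  refine hX.smul_eq g n e ?_ y hy
  obtain ⟨e', he'⟩ := hX.smul_openCell g n e
  have hx' : x ∈ RelCWComplex.openCell n e' := he' ▸ ⟨x, hxe, hx g hg⟩
  have := RelCWComplex.eq_of_not_disjoint_openCell (Set.not_disjoint_iff.2 ⟨x, hxe, hx'⟩)
  rw [he']
  cases this
  rfl

theorem exists_mem_openCell (x : X) :
    ∃ (n : ℕ) (e : RelCWComplex.cell (Set.univ : Set X) n), x ∈ RelCWComplex.openCell n e := by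
  have : x ∈ (Set.univ : Set X) := trivial
  rw [← CWComplex.iUnion_openCell_eq_complex (C := (Set.univ : Set X))] at this
  simpa using this

variable [hX : IsGCWComplex G X]

/-- The subcomplex `X^K` of the `G`-CW complex `X`. -/
def fixedComplex (K : Subgroup G) : CWComplex.Subcomplex (Set.univ : Set X) :=
  CWComplex.Subcomplex.mk' _ (fixedSet X K)
    (fun n => {e | RelCWComplex.openCell n e ⊆ fixedSet X K})
    (fun n e => by
      rw [← RelCWComplex.closure_openCell_eq_closedCell]
      exact (isClosed_fixedSet K).closure_subset_iff.2 e.2)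
    (by
      refine Set.Subset.antisymm (Set.iUnion_subset fun n => Set.iUnion_subset fun e => e.2) ?_
      intro x hx
      obtain ⟨n, e, he⟩ := exists_mem_openCell x
      exact Set.mem_iUnion₂.2 ⟨n, ⟨e, openCell_subset_fixedSet K he hx⟩, he⟩)

/-- The subcomplex `X^K_sing` of the `G`-CW complex `X`. -/
def singComplex (K : Subgroup G) : CWComplex.Subcomplex (Set.univ : Set X) :=
  CWComplex.Subcomplex.mk' _ (singSet X K)
    (fun n => {e | RelCWComplex.openCell n e ⊆ singSet X K})
    (fun n e => by
      have h0 := RelCWComplex.map_zero_mem_openCell n e.1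
      obtain ⟨L, hL, hx⟩ := Set.mem_iUnion₂.1 (e.2 h0)
      refine subset_trans ?_ (Set.subset_biUnion_of_mem (u := fun L => fixedSet X L) hL)
      rw [← RelCWComplex.closure_openCell_eq_closedCell]
      exact (isClosed_fixedSet L).closure_subset_iff.2 (openCell_subset_fixedSet L h0 hx))
    (by
      refine Set.Subset.antisymm (Set.iUnion_subset fun n => Set.iUnion_subset fun e => e.2) ?_
      intro x hx
      obtain ⟨n, e, he⟩ := exists_mem_openCell x
      obtain ⟨L, hL, hxL⟩ := Set.mem_iUnion₂.1 hx
      refine Set.mem_iUnion₂.2 ⟨n, ⟨e, ?_⟩, he⟩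
      exact subset_trans (openCell_subset_fixedSet L he hxL)
        (Set.subset_biUnion_of_mem (u := fun L => fixedSet X L) hL))

end GCW

end BredonCW

end

/-!
The cells of a cocompact model `X` form `G`-sets with finite stabilizers and finitely many orbits,
because a choice of one point in every cell, made equivariantly, has closed discrete image in the
compact orbit space (`exists_finite_cell_invariant`). In particular `X` is finite-dimensional.

**The resolution.** The cellular chain groups are free on the cells: attaching `n`-cells changes
singular homology only in degree `n`, where every cell contributes one basis element
(`IsAttaching.basisEquiv`). This rests on excision, proved by barycentric subdivision, and on the
homology of the ball relative to its boundary, computed by moving the complement of a coordinate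
subspace through half spaces (`exists_fundamentalCycle`). If `X^H` is contractible, then its cellular
chain complex is exact (`exists_cellBoundary_eq`). An element of `G` that maps a cell to itself fixes
it pointwise, so characteristic maps can be chosen equivariantly, the group permutes the basis, and
the boundary of a cell only involves cells with larger or equal stabilizer. All of this is recorded
in the structure `CellModel`. The chains of the complexes `X^H`, as functors on the orbit category,
are free Bredon modules, hence projective, and form a resolution of the constant functor
(`CellModel.resolution`). Morphisms between these modules are the equivariant maps of chains that do
not decrease stabilizers (`IsStabMap`).

**Length and contractions.** For a projective resolution, a resolution of length `m` of the same
object exists if and only if the given one has a partial contraction in degree `m + 1`, and then it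
has one in all higher degrees (`hasContraction_of_isZero`, `exists_resolution_of_hasContraction`).

**Contractions and cohomology.** Call a map pure if it preserves stabilizers. Taking the pure part of
a map is multiplicative (`grade_comp`), and the transpose of the pure part of the cellular
differential is the differential of the compactly supported cochains of `(X^K, X^K_sing)`, for all `K`
together. If the cohomology of these pairs vanishes above degree `m`, then the pure part of the
complex is contractible above `m`: starting from the dimension of `X` and descending, the defect of
the contraction built so far is a matrix whose rows are cocycles, and an equivariant choice of
cochains bounding them extends the contraction (`CellModel.exists_pure_factor`). This pure contraction
`s` of the pure part satisfies `d s + s d = 1 + (strictly increasing)` for the full differential `d`,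
which is invertible since the orders of stabilizers are bounded (`exists_inverse_of_grade_eq_one`),
and so it can be corrected to a contraction of the full complex (`CellModel.exists_contraction`).
Conversely the transpose of a contraction contracts the relative cochains
(`CellModel.not_hasCohomology`). Finally, the cohomology does not vanish in all degrees, since
otherwise `d : C₁ → C₀` would be surjective, contradicting the augmentation
(`CellModel.exists_hasCohomology`).
-/

noncomputable section

namespace BredonCW

universe w w'

/-! ### Singular chains as formal sums of simplices -/

/-- The standard topological simplex, lifted to the universe `u`. -/
abbrev Simplex (n : ℕ) : Type u := ULift.{u} (stdSimplex ℝ (Fin (n + 1)))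

/-- The affine map of standard simplices induced by a map of vertices. -/
def simplexMap {m n : ℕ} (f : Fin (m + 1) → Fin (n + 1)) : C(Simplex.{u} m, Simplex.{u} n) :=
  ⟨fun x => ⟨stdSimplex.map f x.down⟩,
    continuous_uliftUp.comp ((stdSimplex.continuous_map f).comp continuous_uliftDown)⟩

section

open Simplicial

variable {X : Type u} [TopologicalSpace X] {Y : Type u} [TopologicalSpace Y]

theorem hom_sum_apply {ι : Type*} (s : Finset ι) {A B : AddCommGrpCat.{u}} (f : ι → (A ⟶ B))
    (a : A) :
    (∑ i ∈ s, f i).hom a = ∑ i ∈ s, (f i).hom a :=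
  (DFunLike.congr_fun (map_sum AddCommGrpCat.homAddEquiv f s) a).trans
    (AddMonoidHom.finsetSum_apply _ _ _)

/-- Homomorphisms from `ULift ℤ`, the coefficient group of singular chains, are determined by the
image of `1`. -/
theorem uliftInt_hom_ext {A : Type*} [AddCommGroup A] {f g : ULift.{u} ℤ →+ A}
    (h : f ⟨1⟩ = g ⟨1⟩) : f = g := by
  ext ⟨k⟩
  have hk : (⟨k⟩ : ULift.{u} ℤ) = k • ⟨1⟩ := by ext; simp
  rw [hk, map_zsmul, map_zsmul, h]

/-- Continuous maps from the standard simplex to `X` are the simplices of the singular simplicial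
set of `X`. -/
def simplexEquiv (X : Type u) [TopologicalSpace X] (n : ℕ) :
    C(Simplex.{u} n, X) ≃ (TopCat.toSSet.obj (TopCat.of X)) _⦋n⦌ where
  toFun σ := ULift.up (TopCat.ofHom σ)
  invFun s := (ULift.down s).hom
  left_inv _ := rfl
  right_inv _ := rfl

/-- The singular chain given by one singular simplex with coefficient `1`. -/
def single {n : ℕ} (σ : C(Simplex.{u} n, X)) : SingularChains X n :=
  ((TopCat.toSSet.obj (TopCat.of X)).ιChainComplex (R := AddCommGrpCat.of (ULift.{u} ℤ))
    (simplexEquiv X n σ)).hom (ULift.up 1)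

theorem boundary_single {n : ℕ} (σ : C(Simplex.{u} (n + 1), X)) :
    boundary X (n + 1) n (single σ) =
      ∑ i : Fin (n + 2), (-1 : ℤ) ^ i.val • single (σ.comp (simplexMap i.succAbove)) := by
  have := DFunLike.congr_fun (congrArg AddCommGrpCat.Hom.hom
    (SSet.ιChainComplex_d (X := TopCat.toSSet.obj (TopCat.of X)) (R := AddCommGrpCat.of
      (ULift.{u} ℤ)) (simplexEquiv X _ σ))) (ULift.up 1)
  refine this.trans ?_
  exact hom_sum_apply _ _ _

theorem singularMap_single {n : ℕ} (f : C(X, Y)) (σ : C(Simplex.{u} n, X)) :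
    singularMap f n (single σ) = single (f.comp σ) :=
  DFunLike.congr_fun (congrArg AddCommGrpCat.Hom.hom
    (SSet.ι_chainComplexMap_f (TopCat.toSSet.obj (TopCat.of X)) (TopCat.toSSet.obj (TopCat.of Y))
      (TopCat.toSSet.map (TopCat.ofHom f)) (AddCommGrpCat.of (ULift.{u} ℤ)) (simplexEquiv X _ σ)))
        (ULift.up 1)

/-- The coefficient function of a singular chain. -/
def coeffs (X : Type u) [TopologicalSpace X] (n : ℕ) :
    SingularChains X n →+ (C(Simplex.{u} n, X) →₀ ℤ) :=
  (Limits.Sigma.desc (f := fun _ : (TopCat.toSSet.obj (TopCat.of X)) _⦋n⦌ => AddCommGrpCat.of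
    (ULift.{u} ℤ))
     (P := AddCommGrpCat.of (C(Simplex.{u} n, X) →₀ ℤ))
    fun s => AddCommGrpCat.ofHom
      ((Finsupp.singleAddHom ((simplexEquiv X n).symm s)).comp
        (AddEquiv.ulift (α := ℤ)).toAddMonoidHom)).hom

theorem coeffs_single {n : ℕ} (σ : C(Simplex.{u} n, X)) :
    coeffs X n (single σ) = Finsupp.single σ 1 := by
  have := DFunLike.congr_fun (congrArg AddCommGrpCat.Hom.hom
    (Limits.Sigma.ι_desc (f := fun _ : (TopCat.toSSet.obj (TopCat.of X)) _⦋n⦌ => AddCommGrpCat.of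
      (ULift.{u} ℤ))
     (P := AddCommGrpCat.of (C(Simplex.{u} n, X) →₀ ℤ))
    (fun s => AddCommGrpCat.ofHom
      ((Finsupp.singleAddHom ((simplexEquiv X n).symm s)).comp
        (AddEquiv.ulift (α := ℤ)).toAddMonoidHom)) (simplexEquiv X n σ))) (ULift.up 1)
  exact this

/-- The chain with given coefficients. -/
def ofCoeffs (X : Type u) [TopologicalSpace X] (n : ℕ) :
     (C(Simplex.{u} n, X) →₀ ℤ) →+ SingularChains X n :=
  Finsupp.liftAddHom fun σ => (AddMonoidHom.flip (smulAddHom ℤ (SingularChains X n))) (single σ)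

theorem hom_ext_single {n : ℕ} {A : Type*} [AddCommGroup A] {f g : SingularChains X n →+ A}
    (h : ∀ σ, f (single σ) = g (single σ)) : f = g := by
  have key : (ofCoeffs X n).comp (coeffs X n) = AddMonoidHom.id _ := by
    have : (AddCommGrpCat.ofHom ((ofCoeffs X n).comp (coeffs X n)) : (singularFunctor.obj
      (TopCat.of X)).X n ⟶ (singularFunctor.obj (TopCat.of X)).X n) = 𝟙 _ := by
      refine SSet.chainComplex_hom_ext (X := TopCat.toSSet.obj (TopCat.of X))
        (R := AddCommGrpCat.of (ULift.{u} ℤ)) fun s => ?_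
      obtain ⟨σ, rfl⟩ := (simplexEquiv X n).surjective s
      refine AddCommGrpCat.hom_ext (uliftInt_hom_ext ?_)
      change ofCoeffs X n (coeffs X n (single σ)) = single σ
      rw [coeffs_single]
      simp [ofCoeffs]
    exact congrArg AddCommGrpCat.Hom.hom this
  have h2 : f.comp (ofCoeffs X n) = g.comp (ofCoeffs X n) := by
    refine Finsupp.addHom_ext fun σ k => ?_
    simp [ofCoeffs, h]
  rw [← f.comp_id, ← g.comp_id, ← key, ← AddMonoidHom.comp_assoc, h2, AddMonoidHom.comp_assoc]

@[simp]
theorem coeffs_ofCoeffs {n : ℕ} (f : C(Simplex.{u} n, X) →₀ ℤ) :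
    coeffs X n (ofCoeffs X n f) = f := by
  have : (coeffs X n).comp (ofCoeffs X n) = AddMonoidHom.id _ := by
    refine Finsupp.addHom_ext fun σ k => ?_
    simp [ofCoeffs, coeffs_single]
  exact DFunLike.congr_fun this f

@[simp]
theorem ofCoeffs_coeffs {n : ℕ} (c : SingularChains X n) : ofCoeffs X n (coeffs X n c) = c := by
  have : (ofCoeffs X n).comp (coeffs X n) = AddMonoidHom.id _ :=
    hom_ext_single fun σ => by simp [ofCoeffs, coeffs_single]
  exact DFunLike.congr_fun this c

theorem coeffs_injective (n : ℕ) : Function.Injective (coeffs X n) :=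
  Function.LeftInverse.injective ofCoeffs_coeffs

theorem eq_sum_single {n : ℕ} (c : SingularChains X n) :
    c = ∑ σ ∈ (coeffs X n c).support, coeffs X n c σ • single σ := by
  conv_lhs => rw [← ofCoeffs_coeffs c]
  simp [ofCoeffs, Finsupp.sum]

theorem coeffs_singularMap {n : ℕ} (f : C(X, Y)) (c : SingularChains X n) :
    coeffs Y n (singularMap f n c) = (coeffs X n c).mapDomain f.comp := by
  have : (coeffs Y n).comp (singularMap f n) =
      (Finsupp.mapDomain.addMonoidHom f.comp).comp (coeffs X n) :=
    hom_ext_single fun σ => by simp [singularMap_single, coeffs_single]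
  exact DFunLike.congr_fun this c

theorem singularMap_injective {f : C(X, Y)} (hf : Function.Injective f) (n : ℕ) :
    Function.Injective (singularMap f n) := by
  intro a b h
  apply coeffs_injective
  apply Finsupp.mapDomain_injective (f := f.comp)
  · intro σ τ h
    ext t
    exact hf (DFunLike.congr_fun h t)
  · rw [← coeffs_singularMap, ← coeffs_singularMap, h]

theorem singularMap_comp {Z : Type u} [TopologicalSpace Z] (g : C(Y, Z)) (f : C(X, Y)) (n : ℕ)
    (c : SingularChains X n) : singularMap (g.comp f) n c = singularMap g n
      (singularMap f n c) := by
  have : singularMap (g.comp f) n = (singularMap g n).comp (singularMap f n) :=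
    hom_ext_single fun σ => by simp [singularMap_single, ContinuousMap.comp_assoc]
  exact DFunLike.congr_fun this c

@[simp]
theorem singularMap_id (n : ℕ) (c : SingularChains X n) :
    singularMap (ContinuousMap.id X) n c = c := by
  have : singularMap (ContinuousMap.id X) n = AddMonoidHom.id _ :=
    hom_ext_single fun σ => by simp [singularMap_single]
  exact DFunLike.congr_fun this c

theorem boundary_singularMap (f : C(X, Y)) (i j : ℕ) (c : SingularChains X i) :
    boundary Y i j (singularMap f i c) = singularMap f j (boundary X i j c) :=
  DFunLike.congr_fun (congrArg AddCommGrpCat.Hom.hom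
    ((singularFunctor.map (TopCat.ofHom f)).comm i j)) c

@[simp]
theorem boundary_zero_zero (c : SingularChains X 0) : boundary X 0 0 c = 0 :=
  DFunLike.congr_fun (congrArg AddCommGrpCat.Hom.hom
    ((singularFunctor.obj (TopCat.of X)).shape 0 0 (by simp))) c

/-- The sum of the coefficients of a singular chain. -/
def augmentation (X : Type u) [TopologicalSpace X] (n : ℕ) : SingularChains X n →+ ℤ :=
  (Finsupp.liftAddHom fun _ => AddMonoidHom.id ℤ).comp (coeffs X n)

@[simp]
theorem augmentation_single {n : ℕ} (σ : C(Simplex.{u} n, X)) :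
    augmentation X n (single σ) = 1 := by
  simp [augmentation, coeffs_single]

@[simp]
theorem augmentation_singularMap {n : ℕ} (f : C(X, Y)) (c : SingularChains X n) :
    augmentation Y n (singularMap f n c) = augmentation X n c := by
  have : (augmentation Y n).comp (singularMap f n) = augmentation X n :=
    hom_ext_single fun σ => by simp [singularMap_single]
  exact DFunLike.congr_fun this c

@[simp]
theorem augmentation_boundary (c : SingularChains X 1) :
    augmentation X 0 (boundary X 1 0 c) = 0 := by
  have : (augmentation X 0).comp (boundary X 1 0) = 0 :=
    hom_ext_single fun σ => by simp [boundary_single, Fin.sum_univ_two]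
  exact DFunLike.congr_fun this c

/-! ### Chains in a subspace -/

/-- Chains in `A`, by definition images of chains of the subspace, are the chains all of whose
simplices have image in `A`. -/
theorem mem_chainsIn {A : Set X} {n : ℕ} {c : SingularChains X n} :
    c ∈ chainsIn A n ↔ ∀ σ ∈ (coeffs X n c).support, ∀ t, σ t ∈ A := by
  classical
  constructor
  · rintro ⟨c, rfl⟩ σ hσ t
    rw [coeffs_singularMap] at hσ
    obtain ⟨τ, -, rfl⟩ := Finset.mem_image.1 (Finsupp.mapDomain_support hσ)
    exact (τ t).2
  · intro h
    rw [eq_sum_single c]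
    refine AddSubgroup.sum_mem _ fun σ hσ => AddSubgroup.zsmul_mem _ ?_ _
    refine ⟨single ⟨fun t => ⟨σ t, h σ hσ t⟩, by fun_prop⟩, ?_⟩
    rw [singularMap_single]
    rfl

theorem single_mem_chainsIn {A : Set X} {n : ℕ} {σ : C(Simplex.{u} n, X)} (h : ∀ t, σ t ∈ A) :
    single σ ∈ chainsIn A n := by
  refine ⟨single ⟨fun t => ⟨σ t, h t⟩, by fun_prop⟩, ?_⟩
  rw [singularMap_single]
  rfl

theorem chainsIn_le {A : Set X} {n : ℕ} {S : AddSubgroup (SingularChains X n)}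
    (h : ∀ σ : C(Simplex.{u} n, X), (∀ t, σ t ∈ A) → single σ ∈ S) : chainsIn A n ≤ S := by
  intro c hc
  rw [eq_sum_single c]
  exact AddSubgroup.sum_mem _ fun σ hσ => AddSubgroup.zsmul_mem _ (h σ (mem_chainsIn.1 hc σ hσ)) _

theorem chainsIn_mono {A B : Set X} (h : A ⊆ B) (n : ℕ) : chainsIn A n ≤ chainsIn B n :=
  chainsIn_le fun _ hσ => single_mem_chainsIn fun t => h (hσ t)

theorem mem_chainsIn_inter {A B : Set X} {n : ℕ} {c : SingularChains X n}
    (hA : c ∈ chainsIn A n) (hB : c ∈ chainsIn B n) : c ∈ chainsIn (A ∩ B) n :=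
  mem_chainsIn.2 fun σ hσ t => ⟨mem_chainsIn.1 hA σ hσ t, mem_chainsIn.1 hB σ hσ t⟩

@[simp]
theorem mem_chainsIn_univ {n : ℕ} (c : SingularChains X n) : c ∈ chainsIn Set.univ n :=
  mem_chainsIn.2 fun _ _ _ => trivial

theorem eq_zero_of_mem_chainsIn_empty {n : ℕ} {c : SingularChains X n}
    (h : c ∈ chainsIn (∅ : Set X) n) : c = 0 := by
  apply coeffs_injective
  rw [map_zero, ← Finsupp.support_eq_empty, Finset.eq_empty_iff_forall_notMem]
  exact fun σ hσ => mem_chainsIn.1 h σ hσ ⟨Classical.arbitrary _⟩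

theorem singularMap_mem_chainsIn {f : C(X, Y)} {A : Set X} {B : Set Y} (h : Set.MapsTo f A B)
    {n : ℕ} {c : SingularChains X n} (hc : c ∈ chainsIn A n) :
    singularMap f n c ∈ chainsIn B n := by
  have : chainsIn A n ≤ (chainsIn B n).comap (singularMap f n) := chainsIn_le fun σ hσ => by
    rw [AddSubgroup.mem_comap, singularMap_single]
    exact single_mem_chainsIn fun t => h (hσ t)
  exact this hc

theorem boundary_mem_chainsIn {A : Set X} {i : ℕ} (j : ℕ) {c : SingularChains X i}
    (hc : c ∈ chainsIn A i) : boundary X i j c ∈ chainsIn A j := by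
  obtain ⟨c, rfl⟩ := hc
  exact ⟨boundary A i j c, (boundary_singularMap _ _ _ _).symm⟩

/-- A chain in `f '' A` comes from a chain in `A` if `f` is an embedding on `A`. -/
theorem exists_singularMap_eq {f : C(X, Y)} {A : Set X} {B : Set Y}
    (g : C(B, X)) (hgA : ∀ y, g y ∈ A) (hg : ∀ y, f (g y) = y) {n : ℕ}
    {c : SingularChains Y n} (hc : c ∈ chainsIn B n) :
    ∃ b ∈ chainsIn A n, singularMap f n b = c := by
  obtain ⟨c, rfl⟩ := hc
  refine ⟨singularMap g n c, singularMap_mem_chainsIn (A := Set.univ) (fun y _ => hgA y)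
    (mem_chainsIn_univ c), ?_⟩
  rw [← singularMap_comp]
  congr 2
  ext y
  exact hg y

end

/-! ### Acyclicity of contractible spaces -/

section

open Simplicial

variable {X : Type u} [TopologicalSpace X] {Y : Type u} [TopologicalSpace Y]

theorem exists_boundary_eq_of_exactAt {n : ℕ}
    (h : (singularFunctor.obj (TopCat.of X)).ExactAt (n + 1)) {c : SingularChains X (n + 1)}
    (hc : boundary X (n + 1) n c = 0) : ∃ b, boundary X (n + 2) (n + 1) b = c := by
  rw [HomologicalComplex.exactAt_iff' _ (n + 2) (n + 1) n (by simp) (by simp),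
    ShortComplex.ab_exact_iff] at h
  exact h c hc

/-- The singular homology of a point vanishes in positive degrees. -/
theorem exists_boundary_eq_of_subsingleton [Subsingleton X] {n : ℕ}
    {c : SingularChains X (n + 1)}
    (hc : boundary X (n + 1) n c = 0) : ∃ b, boundary X (n + 2) (n + 1) b = c :=
  exists_boundary_eq_of_exactAt
    (AlgebraicTopology.singularChainComplexFunctor_exactAt_of_totallyDisconnectedSpace _ _ _ _
      (by simp)) hc

theorem eq_zero_of_augmentation_eq_zero [Subsingleton X] {n : ℕ} {c : SingularChains X n}
    (hc : augmentation X n c = 0) : c = 0 := by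
  have : Subsingleton C(Simplex.{u} n, X) := ⟨fun f g => by ext; exact Subsingleton.elim _ _⟩
  by_contra hne
  have h1 : coeffs X n c ≠ 0 := fun h => hne (coeffs_injective n (h.trans (map_zero _).symm))
  obtain ⟨σ, hσ⟩ := Finsupp.ne_iff.1 h1
  have h2 : coeffs X n c = Finsupp.single σ (coeffs X n c σ) := by
    ext τ
    rw [Subsingleton.elim τ σ, Finsupp.single_eq_same]
  rw [augmentation, AddMonoidHom.comp_apply, h2] at hc
  exact hσ (by simpa using hc)

/-- Homotopic maps induce chain homotopic maps. -/
theorem exists_chainHomotopy {f g : C(X, Y)} (h : f.Homotopic g) :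
    ∃ s : ∀ n, SingularChains X n →+ SingularChains Y (n + 1),
      (∀ c, singularMap f 0 c = boundary Y 1 0 (s 0 c) + singularMap g 0 c) ∧
      ∀ n c, singularMap f (n + 1) c = boundary Y (n + 2) (n + 1) (s (n + 1) c) +
        s n (boundary X (n + 1) n c) + singularMap g (n + 1) c := by
  obtain ⟨H⟩ := h
  let K := TopCat.Homotopy.singularChainComplexFunctorObjMap (X := TopCat.of X) (Y := TopCat.of Y)
    (f := TopCat.ofHom f) (g := TopCat.ofHom g) H (AddCommGrpCat.of (ULift.{u} ℤ))
  refine ⟨fun n => (K.hom n (n + 1)).hom, fun c => ?_, fun n c => ?_⟩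
  · have := K.comm 0
    rw [Homotopy.dNext_zero_chainComplex, Homotopy.prevD_chainComplex, zero_add] at this
    exact DFunLike.congr_fun (congrArg AddCommGrpCat.Hom.hom this) c
  · have := K.comm (n + 1)
    rw [Homotopy.dNext_succ_chainComplex, Homotopy.prevD_chainComplex, add_comm (_ ≫ _)] at this
    exact DFunLike.congr_fun (congrArg AddCommGrpCat.Hom.hom this) c

/-- The augmented singular chain complex of a contractible space is exact. -/
theorem exists_boundary_eq_of_contractible [ContractibleSpace X] {n : ℕ} {c : SingularChains X n}
    (hc : boundary X n (n - 1) c = 0) (h0 : n = 0 → augmentation X n c = 0) :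
    ∃ b, boundary X (n + 1) n b = c := by
  obtain ⟨x, hx⟩ := id_nullhomotopic X
  obtain ⟨s, hs0, hs⟩ := exists_chainHomotopy hx
  have hfac : ContinuousMap.const X x = (ContinuousMap.const PUnit.{u + 1} x).comp
      (ContinuousMap.const X PUnit.unit) := rfl
  rw [hfac] at hs0 hs
  cases n with
  | zero =>
    have := hs0 c
    rw [singularMap_comp, eq_zero_of_augmentation_eq_zero (X := PUnit.{u + 1}) (n := 0)
      (c := singularMap (ContinuousMap.const X PUnit.unit) 0 c)
      (by simpa using h0 rfl), map_zero, add_zero, singularMap_id] at this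
    exact ⟨_, this.symm⟩
  | succ n =>
    replace hc : boundary X (n + 1) n c = 0 := hc
    have := hs n c
    obtain ⟨b, hb⟩ := exists_boundary_eq_of_subsingleton
      (c := singularMap (ContinuousMap.const X PUnit.unit.{u + 1}) (n + 1) c)
      (by rw [boundary_singularMap, hc, map_zero])
    rw [singularMap_comp, ← hb, ← boundary_singularMap, hc, map_zero, add_zero, ← map_add,
      singularMap_id] at this
    exact ⟨_, this.symm⟩

end

/-! ### Natural chain operators and acyclic models -/

section

open Simplicial

variable (F : TopCat.{u} ⥤ TopCat.{u})

/-- The natural transformation from singular chains of `X` to singular chains of `F X` which sends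
the identical singular simplex to `m`. -/
def modelOp {n k : ℕ} (m : SingularChains (F.obj (TopCat.of (Simplex.{u} n))) k)
    (X : Type u) [TopologicalSpace X] :
    SingularChains X n →+ SingularChains (F.obj (TopCat.of X)) k :=
  (Finsupp.liftAddHom fun σ => AddMonoidHom.flip (smulAddHom ℤ _)
    (singularMap (F.map (TopCat.ofHom σ)).hom k m)).comp (coeffs X n)

variable {F} {X : Type u} [TopologicalSpace X] {Y : Type u} [TopologicalSpace Y]

@[simp]
theorem modelOp_single {n k : ℕ} (m : SingularChains (F.obj (TopCat.of (Simplex.{u} n))) k)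
    (σ : C(Simplex.{u} n, X)) :
    modelOp F m X (single σ) = singularMap (F.map (TopCat.ofHom σ)).hom k m := by
  simp [modelOp, coeffs_single]

theorem modelOp_singularMap {n k : ℕ} (m : SingularChains (F.obj (TopCat.of (Simplex.{u} n))) k)
    (f : C(X, Y)) (c : SingularChains X n) :
    modelOp F m Y (singularMap f n c) =
      singularMap (F.map (TopCat.ofHom f)).hom k (modelOp F m X c) := by
  have : (modelOp F m Y).comp (singularMap f n) =
      (singularMap (F.map (TopCat.ofHom f)).hom k).comp (modelOp F m X) :=
    hom_ext_single fun σ => by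
      simp only [AddMonoidHom.comp_apply, singularMap_single, modelOp_single]
      rw [← singularMap_comp]
      congr 2
      exact congrArg TopCat.Hom.hom (F.map_comp (TopCat.ofHom σ) (TopCat.ofHom f))
  exact DFunLike.congr_fun this c

/-- The identical singular simplex. -/
abbrev idSimplex (n : ℕ) : SingularChains (Simplex.{u} n) n := single (ContinuousMap.id _)

theorem singularMap_idSimplex {n : ℕ} (σ : C(Simplex.{u} n, X)) :
    singularMap σ n (idSimplex n) = single σ := by
  rw [singularMap_single, ContinuousMap.comp_id]

/-- Recursive choice of a sequence in which consecutive terms satisfy a relation `R`, where the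
condition `Q n` on a term guarantees that a next term exists. -/
theorem exists_seq_of_step {α : ℕ → Type*} {Q : ∀ n, α n → Prop} {R : ∀ n, α n → α (n + 1) → Prop}
    (h0 : ∃ a, Q 0 a) (h : ∀ n a, Q n a → ∃ b, Q (n + 1) b ∧ R n a b) :
    ∃ f : ∀ n, α n, Q 0 (f 0) ∧ ∀ n, R n (f n) (f (n + 1)) := by
  choose a ha using h0
  choose b hb hR using h
  let f : ∀ n, {a : α n // Q n a} := fun n => Nat.rec ⟨a, ha⟩ (fun n x =>
    ⟨b n x.1 x.2, hb n x.1 x.2⟩) n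
  exact ⟨fun n => (f n).1, (f 0).2, fun n => hR n (f n).1 (f n).2⟩

/-- The method of acyclic models: a natural chain map from the singular chains of `X` to those of
`F X` that has augmentation zero is naturally null-homotopic, if `F` takes the standard simplices
to contractible spaces. -/
theorem exists_natural_nullHomotopy
    (hF : ∀ n, ContractibleSpace (F.obj (TopCat.of (Simplex.{u} n))))
    (m : ∀ n, SingularChains (F.obj (TopCat.of (Simplex.{u} n))) n)
    (h0 : augmentation _ 0 (m 0) = 0)
    (hm : ∀ n, boundary _ (n + 1) n (m (n + 1)) =
      modelOp F (m n) _ (boundary _ (n + 1) n (idSimplex (n + 1)))) :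
    ∃ T : ∀ n, SingularChains (F.obj (TopCat.of (Simplex.{u} n))) (n + 1),
      (∀ (X : Type u) [TopologicalSpace X] (c : SingularChains X 0),
        boundary _ 1 0 (modelOp F (T 0) X c) = modelOp F (m 0) X c) ∧
      ∀ (X : Type u) [TopologicalSpace X] (n : ℕ) (c : SingularChains X (n + 1)),
        boundary _ (n + 2) (n + 1) (modelOp F (T (n + 1)) X c) =
          modelOp F (m (n + 1)) X c - modelOp F (T n) X (boundary _ (n + 1) n c) := by
  have ext0 : ∀ (n : ℕ) (T : SingularChains (F.obj (TopCat.of (Simplex.{u} n))) (n + 1))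
      (m' : SingularChains (F.obj (TopCat.of (Simplex.{u} n))) n), boundary _ (n + 1) n T = m' →
      ∀ (X : Type u) [TopologicalSpace X] (c : SingularChains X n),
        boundary _ (n + 1) n (modelOp F T X c) = modelOp F m' X c := by
    intro n T m' h X _ c
    have : (boundary _ (n + 1) n).comp (modelOp F T X) = modelOp F m' X :=
      hom_ext_single fun σ => by
        simp only [AddMonoidHom.comp_apply, modelOp_single]
        rw [boundary_singularMap, h]
    exact DFunLike.congr_fun this c
  have ext1 : ∀ (n : ℕ) (T : SingularChains (F.obj (TopCat.of (Simplex.{u} n))) (n + 1))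
      (T' : SingularChains (F.obj (TopCat.of (Simplex.{u} (n + 1)))) (n + 2)),
      boundary _ (n + 2) (n + 1) T' =
        m (n + 1) - modelOp F T _ (boundary _ (n + 1) n (idSimplex (n + 1))) →
      ∀ (X : Type u) [TopologicalSpace X] (c : SingularChains X (n + 1)),
        boundary _ (n + 2) (n + 1) (modelOp F T' X c) =
          modelOp F (m (n + 1)) X c - modelOp F T X (boundary _ (n + 1) n c) := by
    intro n T T' h X _ c
    rw [ext0 (n + 1) T' _ h X c]
    have : modelOp F (m (n + 1) - modelOp F T _ (boundary _ (n + 1) n (idSimplex (n + 1)))) X =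
        modelOp F (m (n + 1)) X - (modelOp F T X).comp (boundary _ (n + 1) n) :=
      hom_ext_single fun σ => by
        simp only [AddMonoidHom.sub_apply, AddMonoidHom.comp_apply, modelOp_single, map_sub]
        rw [← modelOp_singularMap, ← boundary_singularMap, singularMap_idSimplex]
    exact DFunLike.congr_fun this c
  obtain ⟨T, hT0, hT⟩ := exists_seq_of_step
    (α := fun n => SingularChains (F.obj (TopCat.of (Simplex.{u} n))) (n + 1))
    (Q := fun n T => (n = 0 → boundary _ (n + 1) n T = m n) ∧
      ∀ (X : Type u) [TopologicalSpace X] (c : SingularChains X n),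
      boundary X n (n - 1) c = 0 → boundary _ (n + 1) n (modelOp F T X c) = modelOp F (m n) X c)
    (R := fun n T T' => boundary _ (n + 2) (n + 1) T' =
      m (n + 1) - modelOp F T _ (boundary _ (n + 1) n (idSimplex (n + 1))))
    (by
      have := hF 0
      obtain ⟨b, hb⟩ := exists_boundary_eq_of_contractible (c := m 0) (boundary_zero_zero _)
        (fun _ => h0)
      exact ⟨b, fun _ => hb, fun X _ c _ => ext0 0 b _ hb X c⟩)
    (by
      rintro n T ⟨-, hT⟩
      have := hF (n + 1)
      obtain ⟨b, hb⟩ := exists_boundary_eq_of_contractible (n := n + 1)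
        (c := m (n + 1) - modelOp F T _ (boundary _ (n + 1) n (idSimplex (n + 1)))) (by
          change boundary _ (n + 1) n _ = 0
          rw [map_sub, hT _ _ (boundary_boundary _ _ _ _ _), hm, sub_self]) (by simp)
      refine ⟨b, ⟨by simp, fun X _ c hc => ?_⟩, hb⟩
      rw [ext1 n T b hb, show boundary X (n + 1) n c = 0 from hc, map_zero, sub_zero])
  exact ⟨T, fun X _ c => ext0 0 (T 0) _ (hT0.1 rfl) X c, fun X _ n c => ext1 n _ _ (hT n) X c⟩

end

section
variable {X : Type u} [TopologicalSpace X] {Y : Type u} [TopologicalSpace Y]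

/-! ### The prism operator -/

/-- Chains can be tested for lying in a subspace after applying an injective map. -/
theorem mem_chainsIn_preimage {f : C(X, Y)} (hf : Function.Injective f) {B : Set Y} {n : ℕ}
    {c : SingularChains X n} (hc : singularMap f n c ∈ chainsIn B n) :
    c ∈ chainsIn (f ⁻¹' B) n := by
  have hinj : Function.Injective (f.comp : C(Simplex.{u} n, X) → C(Simplex.{u} n, Y)) :=
    fun σ τ h => by
      ext t
      exact hf (DFunLike.congr_fun h t)
  refine mem_chainsIn.2 fun σ hσ t => mem_chainsIn.1 hc (f.comp σ) ?_ t
  rw [coeffs_singularMap, Finsupp.mem_support_iff, Finsupp.mapDomain_apply hinj]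
  exact Finsupp.mem_support_iff.1 hσ

/-- The product with the unit interval. -/
abbrev cylinder : TopCat.{u} ⥤ TopCat.{u} where
  obj X := TopCat.of (X × unitInterval)
  map f := TopCat.ofHom (f.hom.prodMap (ContinuousMap.id _))

/-- The inclusion of a space into its cylinder at height `t`. -/
def cylinderIncl (X : Type u) [TopologicalSpace X] (t : unitInterval) : C(X, X × unitInterval) :=
  (ContinuousMap.id X).prodMk (ContinuousMap.const X t)

/-- The natural operator from chains of `X` to chains of its cylinder that is given by a chain of
the cylinder over the standard simplex. -/
def cylinderOp {n k : ℕ} (m : SingularChains (Simplex.{u} n × unitInterval) k)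
    (X : Type u) [TopologicalSpace X] : SingularChains X n →+ SingularChains (X × unitInterval) k :=
  modelOp cylinder m X

theorem cylinderOp_single {n k : ℕ} (m : SingularChains (Simplex.{u} n × unitInterval) k)
    (σ : C(Simplex.{u} n, X)) :
    cylinderOp m X (single σ) = singularMap (σ.prodMap (ContinuousMap.id _)) k m :=
  modelOp_single (F := cylinder) m σ

theorem cylinderOp_mem_chainsIn {n k : ℕ} (m : SingularChains (Simplex.{u} n × unitInterval) k)
    {B : Set X} {c : SingularChains X n} (hc : c ∈ chainsIn B n) :
    cylinderOp m X c ∈ chainsIn (B ×ˢ (Set.univ : Set unitInterval)) k := by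
  have : chainsIn B n ≤ (chainsIn (B ×ˢ (Set.univ : Set unitInterval)) k).comap
      (cylinderOp m X) := chainsIn_le fun σ hσ => by
    rw [AddSubgroup.mem_comap, cylinderOp_single]
    have h : Set.MapsTo (σ.prodMap (ContinuousMap.id unitInterval)) Set.univ
        (B ×ˢ (Set.univ : Set unitInterval)) := fun p _ => ⟨hσ p.1, trivial⟩
    exact singularMap_mem_chainsIn h
      (mem_chainsIn_univ m)
  exact this hc

instance contractibleSpace_simplex (n : ℕ) : ContractibleSpace (Simplex.{u} n) :=
  have : ContractibleSpace (stdSimplex ℝ (Fin (n + 1))) :=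
    (convex_stdSimplex ℝ (Fin (n + 1))).contractibleSpace
      ⟨_, (Classical.arbitrary (stdSimplex ℝ (Fin (n + 1)))).2⟩
  Homeomorph.ulift.contractibleSpace

instance contractibleSpace_unitInterval : ContractibleSpace unitInterval :=
  (convex_Icc (0 : ℝ) 1).contractibleSpace ⟨0, by simp⟩

/-- The difference of the two ends of the cylinder over the standard simplex. -/
def cylinderEnds (n : ℕ) : SingularChains (Simplex.{u} n × unitInterval) n :=
  singularMap (cylinderIncl _ 1) n (idSimplex n) - singularMap (cylinderIncl _ 0) n (idSimplex n)

/-- The natural operator given by the ends of the cylinder is the difference of the inclusions at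
the heights `1` and `0`. -/
theorem cylinderOp_cylinderEnds {n : ℕ} (c : SingularChains X n) :
    cylinderOp (cylinderEnds n) X c =
      singularMap (cylinderIncl X 1) n c - singularMap (cylinderIncl X 0) n c := by
  have : cylinderOp (cylinderEnds n) X =
      singularMap (cylinderIncl X 1) n - singularMap (cylinderIncl X 0) n :=
    hom_ext_single fun σ => by
      rw [cylinderOp_single, cylinderEnds, map_sub]
      rw [← singularMap_comp, ← singularMap_comp, AddMonoidHom.sub_apply,
        singularMap_single, singularMap_single, singularMap_single, singularMap_single]
      rfl
  exact DFunLike.congr_fun this c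

/-- A chain `c` with boundary in `B` gives a chain in the cylinder, with boundary the difference of
the two copies of `c`, up to a chain in the cylinder over `B`. -/
theorem exists_prism {n : ℕ} (c : SingularChains X n) {B : Set X}
    (hc : boundary X n (n - 1) c ∈ chainsIn B (n - 1)) :
    ∃ p : SingularChains (X × unitInterval) (n + 1),
      ∃ q ∈ chainsIn (B ×ˢ (Set.univ : Set unitInterval)) n,
        boundary _ (n + 1) n p =
          singularMap (cylinderIncl X 1) n c - singularMap (cylinderIncl X 0) n c - q := by
  obtain ⟨T, hT0, hT⟩ := exists_natural_nullHomotopy (F := cylinder)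
    (fun n => (inferInstance : ContractibleSpace (Simplex.{u} n × unitInterval))) cylinderEnds
    (by
      change augmentation (Simplex.{u} 0 × unitInterval) 0 (cylinderEnds 0) = 0
      rw [cylinderEnds, map_sub, augmentation_singularMap, augmentation_singularMap, sub_self])
    (fun n => by
      change _ = cylinderOp (cylinderEnds n) _ _
      rw [cylinderOp_cylinderEnds]
      change boundary (Simplex.{u} (n + 1) × unitInterval) (n + 1) n _ = _
      rw [cylinderEnds, map_sub, boundary_singularMap, boundary_singularMap])
  cases n with
  | zero =>
    refine ⟨cylinderOp (T 0) X c, 0, AddSubgroup.zero_mem _, ?_⟩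
    rw [sub_zero, ← cylinderOp_cylinderEnds]
    exact hT0 X c
  | succ n =>
    refine ⟨cylinderOp (T (n + 1)) X c, cylinderOp (T n) X (boundary X (n + 1) n c),
      cylinderOp_mem_chainsIn _ hc, ?_⟩
    rw [← cylinderOp_cylinderEnds]
    exact hT X n c

/-! ### Relative homology -/

variable {A A' B B' C : Set X} {n : ℕ}

theorem mem_relCycles {c : SingularChains X n} : c ∈ relCycles A B n ↔
    c ∈ chainsIn A n ∧ boundary X n (n - 1) c ∈ chainsIn B (n - 1) := Iff.rfl

theorem mem_relCycles_succ {c : SingularChains X (n + 1)} : c ∈ relCycles A B (n + 1) ↔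
    c ∈ chainsIn A (n + 1) ∧ boundary X (n + 1) n c ∈ chainsIn B n := Iff.rfl

theorem mem_relCycles_zero {c : SingularChains X 0} : c ∈ relCycles A B 0 ↔ c ∈ chainsIn A 0 := by
  refine ⟨fun h => h.1, fun h => ⟨h, ?_⟩⟩
  change boundary X 0 0 c ∈ chainsIn B 0
  rw [boundary_zero_zero]
  exact AddSubgroup.zero_mem _

theorem mem_relBoundaries {c : SingularChains X n} : c ∈ relBoundaries A B n ↔
    ∃ b ∈ chainsIn B n, ∃ a ∈ chainsIn A (n + 1), c = b + boundary X (n + 1) n a := by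
  constructor
  · intro h
    obtain ⟨b, hb, e, ⟨a, ha, rfl⟩, rfl⟩ := AddSubgroup.mem_sup.1 h
    exact ⟨b, hb, a, ha, rfl⟩
  · rintro ⟨b, hb, a, ha, rfl⟩
    exact AddSubgroup.mem_sup.2 ⟨b, hb, _, ⟨a, ha, rfl⟩, rfl⟩

theorem mem_relBoundaries_of_mem_chainsIn {c : SingularChains X n} (h : c ∈ chainsIn B n) :
    c ∈ relBoundaries A B n := AddSubgroup.mem_sup_left h

theorem boundary_mem_relBoundaries {c : SingularChains X (n + 1)} (h : c ∈ chainsIn A (n + 1)) :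
    boundary X (n + 1) n c ∈ relBoundaries A B n := AddSubgroup.mem_sup_right ⟨c, h, rfl⟩

theorem relCycles_mono (hA : A ⊆ A') (hB : B ⊆ B') (n : ℕ) :
    relCycles A B n ≤ relCycles A' B' n :=
  fun _ h => mem_relCycles.2 ⟨chainsIn_mono hA n h.1, chainsIn_mono hB _ (mem_relCycles.1 h).2⟩

theorem relBoundaries_mono (hA : A ⊆ A') (hB : B ⊆ B') (n : ℕ) :
    relBoundaries A B n ≤ relBoundaries A' B' n :=
  sup_le_sup (chainsIn_mono hB n) (AddSubgroup.map_mono (chainsIn_mono hA _))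

theorem boundary_mem_relCycles {c : SingularChains X (n + 1)} (hc : c ∈ relCycles A B (n + 1)) :
    boundary X (n + 1) n c ∈ relCycles B C n := by
  refine mem_relCycles.2 ⟨(mem_relCycles_succ.1 hc).2, ?_⟩
  rw [boundary_boundary]
  exact AddSubgroup.zero_mem _

theorem singularMap_mem_relCycles {f : C(X, Y)} {A' B' : Set Y} (hA : Set.MapsTo f A A')
    (hB : Set.MapsTo f B B') {c : SingularChains X n} (hc : c ∈ relCycles A B n) :
    singularMap f n c ∈ relCycles A' B' n := by
  refine mem_relCycles.2 ⟨singularMap_mem_chainsIn hA hc.1, ?_⟩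
  rw [boundary_singularMap]
  exact singularMap_mem_chainsIn hB (mem_relCycles.1 hc).2

theorem singularMap_mem_relBoundaries {f : C(X, Y)} {A' B' : Set Y} (hA : Set.MapsTo f A A')
    (hB : Set.MapsTo f B B') {c : SingularChains X n} (hc : c ∈ relBoundaries A B n) :
    singularMap f n c ∈ relBoundaries A' B' n := by
  obtain ⟨b, hb, a, ha, rfl⟩ := mem_relBoundaries.1 hc
  rw [map_add, ← boundary_singularMap]
  exact add_mem (mem_relBoundaries_of_mem_chainsIn (singularMap_mem_chainsIn hB hb))
    (boundary_mem_relBoundaries (singularMap_mem_chainsIn hA ha))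

/-- The relative homology groups of the pair `(A, B)` vanish. -/
def RelAcyclic (A B : Set X) : Prop := ∀ n, relCycles A B n ≤ relBoundaries A B n

/-- The homology of a pair `(A, B)` vanishes if `A` can be deformed into `B` within `A`, keeping
`B` inside `B`. -/
theorem relAcyclic_of_deformation (H : C(A × unitInterval, X)) (h0 : ∀ a, H (a, 0) = a)
    (hA : ∀ p, H p ∈ A) (hB : ∀ (a : A) t, (a : X) ∈ B → H (a, t) ∈ B) (h1 : ∀ a, H (a, 1) ∈ B) :
    RelAcyclic A B := by
  intro n c hc
  have hc1 := hc
  obtain ⟨⟨c, rfl⟩, hcB⟩ := hc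
  replace hcB : boundary X n (n - 1) (singularMap _ n c) ∈ chainsIn B (n - 1) := hcB
  rw [boundary_singularMap] at hcB
  obtain ⟨p, q, hq, hpq⟩ := exists_prism c (mem_chainsIn_preimage Subtype.val_injective hcB)
  have e0 : H.comp (cylinderIncl A 0) = ⟨Subtype.val, continuous_subtype_val⟩ := by
    ext a; exact h0 a
  have := congrArg (singularMap H n) hpq
  rw [map_sub, map_sub, ← singularMap_comp, ← singularMap_comp, e0, ← boundary_singularMap] at this
  refine mem_relBoundaries.2 ⟨singularMap (H.comp (cylinderIncl A 1)) n c - singularMap H n q,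
    sub_mem ?_ ?_, - singularMap H (n + 1) p, neg_mem ?_, ?_⟩
  · exact singularMap_mem_chainsIn (A := Set.univ) (fun a _ => h1 a) (mem_chainsIn_univ c)
  · exact singularMap_mem_chainsIn (fun p hp => hB p.1 p.2 hp.1) hq
  · exact singularMap_mem_chainsIn (A := Set.univ) (fun a _ => hA a) (mem_chainsIn_univ p)
  · rw [map_neg, this]
    abel

/-! ### The exact sequence of a triple -/

/-- Exactness at `H_{n+1}(A, B)` in the sequence of the triple `(A, B, B')`. -/
theorem exists_relCycles_of_boundary_mem {z : SingularChains X (n + 1)} (hBA : B ⊆ A)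
    (hz : z ∈ relCycles A B (n + 1)) (h : boundary X (n + 1) n z ∈ relBoundaries B B' n) :
    ∃ z' ∈ relCycles A B' (n + 1), z - z' ∈ relBoundaries A B (n + 1) := by
  obtain ⟨b', hb', b, hb, e⟩ := mem_relBoundaries.1 h
  refine ⟨z - b, mem_relCycles_succ.2 ⟨sub_mem hz.1 (chainsIn_mono hBA _ hb), ?_⟩, ?_⟩
  · rw [map_sub, e, add_sub_cancel_right]
    exact hb'
  · rw [sub_sub_cancel]
    exact mem_relBoundaries_of_mem_chainsIn hb

/-- Exactness at `H_n(B, B')` in the sequence of the triple `(A, B, B')`. -/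
theorem exists_relCycles_boundary_sub_mem {w : SingularChains X n} (hB' : B' ⊆ B)
    (hw : w ∈ relCycles B B' n) (h : w ∈ relBoundaries A B' n) :
    ∃ z ∈ relCycles A B (n + 1), boundary X (n + 1) n z - w ∈ relBoundaries B B' n := by
  obtain ⟨b', hb', a, ha, rfl⟩ := mem_relBoundaries.1 h
  refine ⟨a, mem_relCycles_succ.2 ⟨ha, ?_⟩, ?_⟩
  · simpa using sub_mem (mem_relCycles.1 hw).1 (chainsIn_mono hB' _ hb')
  · rw [sub_add_cancel_right]
    exact neg_mem (mem_relBoundaries_of_mem_chainsIn hb')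

/-- Exactness at `H_n(A, B')` in the sequence of the triple `(A, B, B')`. -/
theorem exists_relCycles_sub_mem {z : SingularChains X n}
    (hz : z ∈ relCycles A B' n) (h : z ∈ relBoundaries A B n) :
    ∃ w ∈ relCycles B B' n, z - w ∈ relBoundaries A B' n := by
  obtain ⟨b, hb, a, ha, rfl⟩ := mem_relBoundaries.1 h
  refine ⟨b, mem_relCycles.2 ⟨hb, ?_⟩, ?_⟩
  · have := (mem_relCycles.1 hz).2
    rw [map_add, boundary_boundary, add_zero] at this
    exact this
  · rw [add_sub_cancel_left]
    exact boundary_mem_relBoundaries ha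

/-- The inclusion of the pair `(A, B)` into `(A', B')` induces an isomorphism in relative homology
of degree `n`. -/
structure RelIso (A B A' B' : Set X) (n : ℕ) : Prop where
  subset : A ⊆ A'
  subset' : B ⊆ B'
  surj : ∀ z ∈ relCycles A' B' n, ∃ w ∈ relCycles A B n, z - w ∈ relBoundaries A' B' n
  inj : ∀ w ∈ relCycles A B n, w ∈ relBoundaries A' B' n → w ∈ relBoundaries A B n

theorem RelIso.nonempty_addEquiv (h : RelIso A B A' B' n) :
    Nonempty (RelHomology A B n ≃+ RelHomology A' B' n) := by
  let f : RelHomology A B n →+ RelHomology A' B' n := QuotientAddGroup.map _ _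
    (AddSubgroup.inclusion (relCycles_mono h.subset h.subset' n)) (fun c hc =>
      relBoundaries_mono h.subset h.subset' n hc)
  refine ⟨AddEquiv.ofBijective f ⟨(injective_iff_map_eq_zero f).2 fun x hx => ?_, fun y => ?_⟩⟩
  · obtain ⟨x, rfl⟩ := QuotientAddGroup.mk_surjective x
    exact (QuotientAddGroup.eq_zero_iff x).2
      (h.inj x.1 x.2 ((QuotientAddGroup.eq_zero_iff (N := (relBoundaries A' B' n).addSubgroupOf _)
        (AddSubgroup.inclusion (relCycles_mono h.subset h.subset' n) x)).1 hx))
  · obtain ⟨y, rfl⟩ := QuotientAddGroup.mk_surjective y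
    obtain ⟨w, hw, hyw⟩ := h.surj y.1 y.2
    refine ⟨QuotientAddGroup.mk ⟨w, hw⟩, QuotientAddGroup.eq.2 ?_⟩
    rw [AddSubgroup.mem_addSubgroupOf]
    convert hyw using 1
    exact neg_add_eq_sub _ _

/-- If the pair `(A, A')` is acyclic, then `H(A', B) = H(A, B)`. -/
theorem relIso_of_relAcyclic_left (hB : B ⊆ A') (hA : A' ⊆ A) (h : RelAcyclic A A') (n : ℕ) :
    RelIso A' B A B n where
  subset := hA
  subset' := subset_rfl
  surj z hz := exists_relCycles_sub_mem hz (h n (relCycles_mono subset_rfl hB n hz))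
  inj w hw hw' := by
    obtain ⟨z, hz, hzw⟩ := exists_relCycles_boundary_sub_mem hB hw hw'
    obtain ⟨b, hb, a, -, rfl⟩ := mem_relBoundaries.1 (h _ hz)
    rw [map_add, boundary_boundary, add_zero] at hzw
    simpa using sub_mem (boundary_mem_relBoundaries hb) hzw

/-- If the pair `(A', B)` is acyclic, then `H(A, B) = H(A, A')`. -/
theorem relIso_of_relAcyclic_right (hB : B ⊆ A') (hA : A' ⊆ A) (h : RelAcyclic A' B) (n : ℕ) :
    RelIso A B A A' n where
  subset := subset_rfl
  subset' := hB
  surj z hz := by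
    cases n with
    | zero => exact ⟨z, mem_relCycles_zero.2 hz.1, by simp⟩
    | succ n => exact exists_relCycles_of_boundary_mem hA hz (h n (boundary_mem_relCycles hz))
  inj w hw hw' := by
    obtain ⟨w', hw'', hww⟩ := exists_relCycles_sub_mem hw hw'
    simpa using add_mem hww (relBoundaries_mono hA subset_rfl n (h n hw''))

theorem subsingleton_relHomology (h : relCycles A B n ≤ relBoundaries A B n) :
    Subsingleton (RelHomology A B n) := by
  refine subsingleton_of_forall_eq 0 fun x => ?_
  obtain ⟨x, rfl⟩ := QuotientAddGroup.mk_surjective x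
  exact (QuotientAddGroup.eq_zero_iff x).2 (h x.2)

theorem relCycles_le_relBoundaries [h : Subsingleton (RelHomology A B n)] :
    relCycles A B n ≤ relBoundaries A B n := fun x hx =>
  (QuotientAddGroup.eq_zero_iff (N := (relBoundaries A B n).addSubgroupOf _)
    (⟨x, hx⟩ : relCycles A B n)).1 (Subsingleton.elim _ _)

theorem relCycles_zero_le_of_relAcyclic (hB : B' ⊆ B) (h : RelAcyclic A B') :
    relCycles A B 0 ≤ relBoundaries A B 0 := fun _ hz =>
  relBoundaries_mono subset_rfl hB 0 (h 0 (mem_relCycles_zero.2 (mem_relCycles_zero.1 hz)))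

/-- If the pair `(A, B')` is acyclic, then the connecting homomorphism of the triple `(A, B, B')` is
an isomorphism. -/
theorem connecting_bijective_of_relAcyclic (hB : B' ⊆ B) (hA : B ⊆ A) (h : RelAcyclic A B')
    (n : ℕ) : Function.Bijective (connecting A B B' n) := by
  refine ⟨(injective_iff_map_eq_zero _).2 fun x hx => ?_, fun y => ?_⟩
  · obtain ⟨x, rfl⟩ := QuotientAddGroup.mk_surjective x
    obtain ⟨z, hz, hxz⟩ := exists_relCycles_of_boundary_mem hA x.2
      ((QuotientAddGroup.eq_zero_iff (N := (relBoundaries B B' n).addSubgroupOf _)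
        (relCyclesBoundary A B B' n x)).1 hx)
    refine (QuotientAddGroup.eq_zero_iff x).2 ?_
    simpa using! add_mem hxz (relBoundaries_mono subset_rfl hB _ (h _ hz))
  · obtain ⟨y, rfl⟩ := QuotientAddGroup.mk_surjective y
    obtain ⟨z, hz, hyz⟩ := exists_relCycles_boundary_sub_mem hB y.2
      (h n (relCycles_mono hA subset_rfl n y.2))
    refine ⟨QuotientAddGroup.mk ⟨z, hz⟩, Eq.symm (QuotientAddGroup.eq.2 ?_)⟩
    rw [AddSubgroup.mem_addSubgroupOf]
    convert hyz using 1
    exact neg_add_eq_sub _ _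

end

/-! ### Vertex chains and barycentric subdivision -/

section
variable {X : Type u} [TopologicalSpace X] {Y : Type u} [TopologicalSpace Y]

/-- The additive extension of a function to the free abelian group. -/
def freeLift {α M : Type*} [AddCommGroup M] (f : α → M) : (α →₀ ℤ) →+ M :=
  Finsupp.liftAddHom fun a => AddMonoidHom.flip (smulAddHom ℤ M) (f a)

@[simp]
theorem freeLift_single {α M : Type*} [AddCommGroup M] (f : α → M) (a : α) :
    freeLift f (Finsupp.single a 1) = f a := by simp [freeLift]

theorem free_hom_ext {α M : Type*} [AddCommGroup M] {f g : (α →₀ ℤ) →+ M}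
    (h : ∀ a, f (Finsupp.single a 1) = g (Finsupp.single a 1)) : f = g := by
  refine Finsupp.addHom_ext fun a k => ?_
  rw [← mul_one k, ← smul_eq_mul, ← Finsupp.smul_single, map_zsmul, map_zsmul, h]

/-- Chains of the full simplex with vertex set `E`: formal sums of `(n + 1)`-tuples. -/
abbrev VChain (E : Type*) (n : ℕ) : Type _ := (Fin (n + 1) → E) →₀ ℤ

variable {E E' : Type*} {n : ℕ}

/-- The boundary operator on vertex chains. -/
def vBoundary (E : Type*) (n : ℕ) : VChain E (n + 1) →+ VChain E n :=
  freeLift fun v => ∑ i : Fin (n + 2), (-1 : ℤ) ^ i.val • Finsupp.single (v ∘ i.succAbove) 1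

/-- The map of vertex chains induced by a map of vertices. -/
def vMap (f : E → E') (n : ℕ) : VChain E n →+ VChain E' n :=
  Finsupp.mapDomain.addMonoidHom (f ∘ ·)

/-- The cone with apex `b`. -/
def vCone (b : E) (n : ℕ) : VChain E n →+ VChain E (n + 1) :=
  Finsupp.mapDomain.addMonoidHom fun v => (Fin.cons b v : Fin (n + 2) → E)

@[simp]
theorem vBoundary_single (v : Fin (n + 2) → E) : vBoundary E n (Finsupp.single v 1) =
    ∑ i : Fin (n + 2), (-1 : ℤ) ^ i.val • Finsupp.single (v ∘ i.succAbove) 1 :=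
  freeLift_single _ _

@[simp]
theorem vMap_single (f : E → E') (v : Fin (n + 1) → E) :
    vMap f n (Finsupp.single v 1) = Finsupp.single (f ∘ v) 1 := Finsupp.mapDomain_single

@[simp]
theorem vCone_single (b : E) (v : Fin (n + 1) → E) :
    vCone b n (Finsupp.single v 1) = Finsupp.single (Fin.cons b v) 1 := Finsupp.mapDomain_single

theorem vBoundary_vMap (f : E → E') (c : VChain E (n + 1)) :
    vBoundary E' n (vMap f (n + 1) c) = vMap f n (vBoundary E n c) := by
  have : (vBoundary E' n).comp (vMap f (n + 1)) = (vMap f n).comp (vBoundary E n) :=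
    free_hom_ext fun v => by
      simp only [AddMonoidHom.comp_apply, vMap_single, vBoundary_single, map_sum, map_zsmul,
        Function.comp_assoc]
  exact DFunLike.congr_fun this c

theorem cons_comp_succAbove_succ {b : E} {v : Fin (n + 2) → E} (i : Fin (n + 2)) :
    (Fin.cons b v : Fin (n + 3) → E) ∘ i.succ.succAbove = Fin.cons b (v ∘ i.succAbove) := by
  funext j
  refine Fin.cases ?_ (fun j => ?_) j
  · simp
  · simp

/-- In positive degrees the cone operator is a contraction of the complex of vertex chains. -/
theorem vBoundary_vCone (b : E) (c : VChain E (n + 1)) :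
    vBoundary E (n + 1) (vCone b (n + 1) c) = c - vCone b n (vBoundary E n c) := by
  have : (vBoundary E (n + 1)).comp (vCone b (n + 1)) =
      AddMonoidHom.id _ - (vCone b n).comp (vBoundary E n) :=
    free_hom_ext fun v => by
      simp only [AddMonoidHom.comp_apply, vCone_single, vBoundary_single, AddMonoidHom.sub_apply,
        AddMonoidHom.id_apply, map_sum, map_zsmul]
      rw [Fin.sum_univ_succ, sub_eq_add_neg, ← Finset.sum_neg_distrib]
      congr 1
      · have : (Fin.cons b v : Fin (n + 3) → E) ∘ Fin.succAbove 0 = v := by ext; simp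
        rw [this]
        simp
      · refine Finset.sum_congr rfl fun i _ => ?_
        rw [cons_comp_succAbove_succ, Fin.val_succ, pow_succ, mul_neg_one, neg_smul]
  exact DFunLike.congr_fun this c

/-- In degree `0` the cone formula holds on chains of augmentation zero. -/
theorem vBoundary_vCone_zero (b : E) (v w : Fin 1 → E) :
    vBoundary E 0 (vCone b 0 (Finsupp.single v 1 - Finsupp.single w 1)) =
      Finsupp.single v 1 - Finsupp.single w 1 := by
  have h0 : ∀ v : Fin 1 → E, (Fin.cons b v : Fin 2 → E) ∘ Fin.succAbove 0 = v := by
    intro v; ext; simp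
  have h1 : ∀ v : Fin 1 → E, (Fin.cons b v : Fin 2 → E) ∘ Fin.succAbove 1 = fun _ => b := by
    intro v; ext i; fin_cases i; simp
  rw [map_sub, map_sub, vCone_single, vCone_single, vBoundary_single, vBoundary_single,
    Fin.sum_univ_two, Fin.sum_univ_two, h0, h0, h1, h1]
  simp

/-- The barycenter of the standard simplex. -/
def baryPoint (n : ℕ) : Simplex.{u} n := ⟨stdSimplex.barycenter⟩

/-- The barycentric subdivision of the standard simplex, as a vertex chain. -/
def baryChain : (n : ℕ) → VChain (Simplex.{u} n) n
  | 0 => Finsupp.single (fun _ => baryPoint 0) 1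
  | n + 1 => vCone (baryPoint (n + 1)) n
      (∑ i : Fin (n + 2), (-1 : ℤ) ^ i.val • vMap (simplexMap i.succAbove) n (baryChain n))

/-- The barycentric subdivision of a singular chain, as a chain of vertices. -/
def vSubdivide (X : Type u) [TopologicalSpace X] (n : ℕ) : SingularChains X n →+ VChain X n :=
  (freeLift fun σ : C(Simplex.{u} n, X) => vMap σ n (baryChain n)).comp (coeffs X n)

@[simp]
theorem vSubdivide_single (σ : C(Simplex.{u} n, X)) :
    vSubdivide X n (single σ) = vMap σ n (baryChain n) := by
  simp [vSubdivide, coeffs_single]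

theorem vSubdivide_singularMap (f : C(X, Y)) (c : SingularChains X n) :
    vSubdivide Y n (singularMap f n c) = vMap f n (vSubdivide X n c) := by
  have : (vSubdivide Y n).comp (singularMap f n) = (vMap f n).comp (vSubdivide X n) :=
    hom_ext_single fun σ => by
      simp only [AddMonoidHom.comp_apply, singularMap_single, vSubdivide_single]
      have : (vMap (f.comp σ) n) = (vMap f n).comp (vMap σ n) :=
        free_hom_ext fun v => by simp [Function.comp_assoc]
      exact DFunLike.congr_fun this _
  exact DFunLike.congr_fun this c

theorem baryChain_succ (n : ℕ) : baryChain.{u} (n + 1) = vCone (baryPoint (n + 1)) n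
    (vSubdivide _ n (boundary _ (n + 1) n (idSimplex (n + 1)))) := by
  rw [baryChain, boundary_single]
  simp [map_sum, map_zsmul]

/-- Subdivision commutes with the boundary if it does so on the identical simplex. -/
theorem vBoundary_vSubdivide_of (h : vBoundary _ n (baryChain.{u} (n + 1)) =
      vSubdivide _ n (boundary _ (n + 1) n (idSimplex (n + 1)))) (c : SingularChains X (n + 1)) :
    vBoundary X n (vSubdivide X (n + 1) c) = vSubdivide X n (boundary X (n + 1) n c) := by
  have : (vBoundary X n).comp (vSubdivide X (n + 1)) =
      (vSubdivide X n).comp (boundary X (n + 1) n) :=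
    hom_ext_single fun σ => by
      rw [AddMonoidHom.comp_apply, vSubdivide_single, vBoundary_vMap, h, ← vSubdivide_singularMap,
        ← boundary_singularMap, singularMap_idSimplex, AddMonoidHom.comp_apply]
  exact DFunLike.congr_fun this c

/-- The boundary of the subdivided simplex is the subdivided boundary: by induction the subdivided
boundary is a cycle, hence it is the boundary of its cone. -/
theorem vBoundary_baryChain (n : ℕ) : vBoundary _ n (baryChain.{u} (n + 1)) =
    vSubdivide _ n (boundary _ (n + 1) n (idSimplex (n + 1))) := by
  induction n with
  | zero =>
    rw [baryChain_succ, boundary_single, Fin.sum_univ_two, map_add, map_zsmul, map_zsmul,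
      vSubdivide_single, vSubdivide_single, baryChain, vMap_single, vMap_single, Fin.val_zero,
      Fin.val_one, pow_zero, pow_one, one_smul, neg_one_smul, ← sub_eq_add_neg]
    exact vBoundary_vCone_zero _ _ _
  | succ n ih =>
    rw [baryChain_succ, vBoundary_vCone, vBoundary_vSubdivide_of ih, boundary_boundary, map_zero,
      map_zero, sub_zero]

/-! ### Affine simplices -/

/-- The affine map between standard simplices with given images of the vertices. -/
def affineSimplex {m : ℕ} (v : Fin (n + 1) → Simplex.{u} m) : C(Simplex.{u} n, Simplex.{u} m) where
  toFun t := ⟨⟨fun j => ∑ i, t.down i * (v i).down j, by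
    refine ⟨fun j => Finset.sum_nonneg fun i _ => mul_nonneg (t.down.2.1 i) ((v i).down.2.1 j), ?_⟩
    rw [Finset.sum_comm]
    have h1 : ∀ i, ∑ j, (v i).down j = 1 := fun i => (v i).down.2.2
    have h2 : ∑ i, t.down i = 1 := t.down.2.2
    simp only [← Finset.mul_sum, h1, mul_one, h2]⟩⟩
  continuous_toFun := by
    refine continuous_uliftUp.comp (Continuous.subtype_mk (continuous_pi fun j => ?_) _)
    refine continuous_finsetSum _ fun i _ => Continuous.mul ?_ continuous_const
    exact (continuous_apply i).comp (continuous_subtype_val.comp continuous_uliftDown)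

theorem affineSimplex_apply {m : ℕ} (v : Fin (n + 1) → Simplex.{u} m) (t : Simplex.{u} n)
    (j : Fin (m + 1)) : (affineSimplex v t).down j = ∑ i, t.down i * (v i).down j := rfl

theorem simplex_ext {x y : Simplex.{u} n} (h : ∀ j, x.down j = y.down j) : x = y :=
  ULift.ext _ _ (Subtype.ext (funext h))

theorem affineSimplex_comp {k m : ℕ} (w : Fin (n + 1) → Simplex.{u} m)
    (v : Fin (k + 1) → Simplex.{u} n) :
    (affineSimplex w).comp (affineSimplex v) = affineSimplex (affineSimplex w ∘ v) := by
  refine ContinuousMap.ext fun t => simplex_ext fun j => ?_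
  simp only [ContinuousMap.comp_apply, affineSimplex_apply, Function.comp_apply,
    Finset.sum_mul, Finset.mul_sum]
  rw [Finset.sum_comm]
  simp only [mul_assoc]

/-- The vertices of the standard simplex. -/
def simplexVertex (i : Fin (n + 1)) : Simplex.{u} n := ⟨stdSimplex.vertex i⟩

theorem affineSimplex_simplexVertex {m : ℕ} (v : Fin (n + 1) → Simplex.{u} m) (i : Fin (n + 1)) :
    affineSimplex v (simplexVertex i) = v i := by
  refine simplex_ext fun j => ?_
  rw [affineSimplex_apply, Finset.sum_eq_single i]
  · simp [simplexVertex]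
  · intro k _ hk
    simp [simplexVertex, hk]
  · simp

theorem affineSimplex_id : affineSimplex (simplexVertex (n := n)) = ContinuousMap.id _ := by
  refine ContinuousMap.ext fun t => simplex_ext fun j => ?_
  rw [affineSimplex_apply, Finset.sum_eq_single j]
  · simp [simplexVertex]
  · intro k _ hk
    simp [simplexVertex, hk.symm]
  · simp

theorem simplexMap_eq_affineSimplex {m : ℕ} (f : Fin (n + 1) → Fin (m + 1)) :
    simplexMap f = affineSimplex (fun i => simplexVertex.{u} (f i)) := by
  refine ContinuousMap.ext fun t => simplex_ext fun j => ?_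
  rw [affineSimplex_apply]
  simp [simplexMap, simplexVertex, FunOnFinite.linearMap_apply_apply, Finset.sum_filter,
    Pi.single_apply, eq_comm]

theorem affineSimplex_comp_simplexMap {k m : ℕ} (v : Fin (n + 1) → Simplex.{u} m)
    (f : Fin (k + 1) → Fin (n + 1)) :
    (affineSimplex v).comp (simplexMap f) = affineSimplex (v ∘ f) := by
  rw [simplexMap_eq_affineSimplex, affineSimplex_comp]
  congr 1
  funext i
  exact affineSimplex_simplexVertex v (f i)

/-- The singular chain of affine simplices given by a vertex chain. -/
def realize (m n : ℕ) : VChain (Simplex.{u} m) n →+ SingularChains (Simplex.{u} m) n :=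
  freeLift fun v => single (affineSimplex v)

@[simp]
theorem realize_single {m : ℕ} (v : Fin (n + 1) → Simplex.{u} m) :
    realize m n (Finsupp.single v 1) = single (affineSimplex v) := freeLift_single _ _

/-- Realization of vertex chains by affine simplices is a chain map. -/
theorem boundary_realize {m : ℕ} (c : VChain (Simplex.{u} m) (n + 1)) :
    boundary _ (n + 1) n (realize m (n + 1) c) = realize m n (vBoundary _ n c) := by
  have : (boundary _ (n + 1) n).comp (realize m (n + 1)) =
      (realize m n).comp (vBoundary (Simplex.{u} m) n) :=
    free_hom_ext fun v => by
      simp only [AddMonoidHom.comp_apply, realize_single, boundary_single, vBoundary_single,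
        map_sum,
        map_zsmul, affineSimplex_comp_simplexMap]
  exact DFunLike.congr_fun this c

theorem singularMap_affineSimplex_realize {m k : ℕ} (w : Fin (m + 1) → Simplex.{u} k)
    (c : VChain (Simplex.{u} m) n) :
    singularMap (affineSimplex w) n (realize m n c) = realize k n (vMap (affineSimplex w) n c) := by
  have : (singularMap (affineSimplex w) n).comp (realize m n) =
      (realize k n).comp (vMap (affineSimplex w) n) :=
    free_hom_ext fun v => by
      simp [singularMap_single, affineSimplex_comp]
  exact DFunLike.congr_fun this c

end

section
variable {X : Type u} [TopologicalSpace X] {Y : Type u} [TopologicalSpace Y] {n : ℕ}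

/-! ### The subdivision operator -/

/-- The natural operator on singular chains given by a chain of the standard simplex. -/
def simplexOp {k : ℕ} (m : SingularChains (Simplex.{u} n) k) (X : Type u) [TopologicalSpace X] :
    SingularChains X n →+ SingularChains X k :=
  modelOp (𝟭 TopCat.{u}) m X

@[simp]
theorem simplexOp_single {k : ℕ} (m : SingularChains (Simplex.{u} n) k) (σ : C(Simplex.{u} n, X)) :
    simplexOp m X (single σ) = singularMap σ k m :=
  modelOp_single (F := 𝟭 TopCat.{u}) m σ

theorem simplexOp_singularMap {k : ℕ} (m : SingularChains (Simplex.{u} n) k) (f : C(X, Y))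
    (c : SingularChains X n) :
    simplexOp m Y (singularMap f n c) = singularMap f k (simplexOp m X c) :=
  modelOp_singularMap (F := 𝟭 TopCat.{u}) m f c

theorem simplexOp_mem_chainsIn {k : ℕ} (m : SingularChains (Simplex.{u} n) k) {A : Set X}
    {c : SingularChains X n} (hc : c ∈ chainsIn A n) : simplexOp m X c ∈ chainsIn A k := by
  obtain ⟨c, rfl⟩ := hc
  rw [simplexOp_singularMap]
  exact ⟨_, rfl⟩

/-- Barycentric subdivision of singular chains. -/
def subdivide (X : Type u) [TopologicalSpace X] (n : ℕ) :
    SingularChains X n →+ SingularChains X n :=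
  simplexOp (realize n n (baryChain n)) X

theorem subdivide_singularMap (f : C(X, Y)) (c : SingularChains X n) :
    subdivide Y n (singularMap f n c) = singularMap f n (subdivide X n c) :=
  simplexOp_singularMap _ _ _

theorem subdivide_mem_chainsIn {A : Set X} {c : SingularChains X n} (hc : c ∈ chainsIn A n) :
    subdivide X n c ∈ chainsIn A n := simplexOp_mem_chainsIn _ hc

theorem subdivide_single_affineSimplex {m : ℕ} (v : Fin (n + 1) → Simplex.{u} m) :
    subdivide _ n (single (affineSimplex v)) =
      realize m n (vMap (affineSimplex v) n (baryChain n)) := by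
  rw [subdivide, simplexOp_single, singularMap_affineSimplex_realize]

theorem boundary_realize_baryChain (n : ℕ) :
    boundary _ (n + 1) n (realize (n + 1) (n + 1) (baryChain.{u} (n + 1))) =
      subdivide _ n (boundary _ (n + 1) n (idSimplex (n + 1))) := by
  rw [boundary_realize, vBoundary_baryChain, boundary_single]
  simp only [map_sum, map_zsmul, vSubdivide_single, ContinuousMap.id_comp,
    simplexMap_eq_affineSimplex, subdivide_single_affineSimplex]

/-- Subdivision is a chain map. -/
theorem boundary_subdivide (c : SingularChains X (n + 1)) :
    boundary X (n + 1) n (subdivide X (n + 1) c) = subdivide X n (boundary X (n + 1) n c) := by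
  have : (boundary X (n + 1) n).comp (subdivide X (n + 1)) =
      (subdivide X n).comp (boundary X (n + 1) n) :=
    hom_ext_single fun σ => by
      rw [AddMonoidHom.comp_apply, AddMonoidHom.comp_apply, subdivide, simplexOp_single,
        boundary_singularMap, boundary_realize_baryChain, ← subdivide_singularMap,
        ← boundary_singularMap, singularMap_idSimplex]
  exact DFunLike.congr_fun this c

theorem simplexOp_sub {k : ℕ} (m m' : SingularChains (Simplex.{u} n) k) (c : SingularChains X n) :
    simplexOp (m - m') X c = simplexOp m X c - simplexOp m' X c := by
  have : simplexOp (m - m') X = simplexOp m X - simplexOp m' X :=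
    hom_ext_single fun σ => by simp [map_sub]
  exact DFunLike.congr_fun this c

theorem simplexOp_idSimplex (c : SingularChains X n) : simplexOp (idSimplex n) X c = c := by
  have : simplexOp (idSimplex n) X = AddMonoidHom.id _ :=
    hom_ext_single fun σ => by simp [singularMap_idSimplex]
  exact DFunLike.congr_fun this c

/-- Subdivision is chain homotopic to the identity. -/
theorem exists_subdivide_homotopy (X : Type u) [TopologicalSpace X] :
    ∃ T : ∀ n, SingularChains X n →+ SingularChains X (n + 1),
      (∀ A n, ∀ c ∈ chainsIn A n, T n c ∈ chainsIn A (n + 1)) ∧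
      (∀ c, c - subdivide X 0 c = boundary X 1 0 (T 0 c)) ∧
      ∀ n c, c - subdivide X (n + 1) c =
        boundary X (n + 2) (n + 1) (T (n + 1) c) + T n (boundary X (n + 1) n c) := by
  let m : ∀ n, SingularChains (Simplex.{u} n) n := fun n =>
    idSimplex n - realize n n (baryChain n)
  have hm : ∀ (X : Type u) [TopologicalSpace X] n (c : SingularChains X n),
      simplexOp (m n) X c = c - subdivide X n c := fun X _ n c => by
    rw [simplexOp_sub, simplexOp_idSimplex, subdivide]
  obtain ⟨T, hT0, hT⟩ := exists_natural_nullHomotopy (F := 𝟭 TopCat.{u})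
    (fun n => contractibleSpace_simplex n) m
    (by
      change augmentation (Simplex.{u} 0) 0 _ = 0
      rw [map_sub, augmentation_single, baryChain, realize_single, augmentation_single, sub_self])
    (fun n => by
      change boundary (Simplex.{u} (n + 1)) (n + 1) n _ = simplexOp (m n) _ _
      rw [hm, map_sub, boundary_realize_baryChain])
  refine ⟨fun n => simplexOp (T n) X, fun A n c hc => simplexOp_mem_chainsIn _ hc,
    fun c => ?_, fun n c => ?_⟩
  · rw [← hm]
    exact (hT0 X c).symm
  · rw [← hm, ← sub_eq_iff_eq_add]
    exact (hT X n c).symm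

/-- Iterated barycentric subdivision. -/
def subdivideIter (X : Type u) [TopologicalSpace X] (n : ℕ) :
    ℕ → (SingularChains X n →+ SingularChains X n)
  | 0 => AddMonoidHom.id _
  | k + 1 => (subdivide X n).comp (subdivideIter X n k)

theorem subdivideIter_succ (k : ℕ) (c : SingularChains X n) :
    subdivideIter X n (k + 1) c = subdivide X n (subdivideIter X n k c) := rfl

theorem subdivideIter_singularMap (k : ℕ) (f : C(X, Y)) (c : SingularChains X n) :
    subdivideIter Y n k (singularMap f n c) = singularMap f n (subdivideIter X n k c) := by
  induction k with
  | zero => rfl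
  | succ k ih => rw [subdivideIter_succ, ih, subdivide_singularMap, subdivideIter_succ]

theorem subdivideIter_mem_chainsIn (k : ℕ) {A : Set X} {c : SingularChains X n}
    (hc : c ∈ chainsIn A n) : subdivideIter X n k c ∈ chainsIn A n := by
  induction k with
  | zero => exact hc
  | succ k ih => exact subdivide_mem_chainsIn ih

theorem boundary_subdivideIter (k : ℕ) (c : SingularChains X (n + 1)) :
    boundary X (n + 1) n (subdivideIter X (n + 1) k c) =
      subdivideIter X n k (boundary X (n + 1) n c) := by
  induction k with
  | zero => rfl
  | succ k ih => rw [subdivideIter_succ, boundary_subdivide, ih, subdivideIter_succ]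

/-- Iterated subdivision is chain homotopic to the identity, by a homotopy that preserves subspaces.
-/
theorem exists_subdivideIter_homotopy (X : Type u) [TopologicalSpace X] (k : ℕ) :
    ∃ T : ∀ n, SingularChains X n →+ SingularChains X (n + 1),
      (∀ A n, ∀ c ∈ chainsIn A n, T n c ∈ chainsIn A (n + 1)) ∧
      (∀ c, c - subdivideIter X 0 k c = boundary X 1 0 (T 0 c)) ∧
      ∀ n c, c - subdivideIter X (n + 1) k c =
        boundary X (n + 2) (n + 1) (T (n + 1) c) + T n (boundary X (n + 1) n c) := by
  obtain ⟨S, hS, hS0, hS1⟩ := exists_subdivide_homotopy X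
  induction k with
  | zero => exact ⟨fun _ => 0, fun A n c _ => AddSubgroup.zero_mem _, by simp [subdivideIter],
      by simp [subdivideIter]⟩
  | succ k ih =>
    obtain ⟨T, hT, hT0, hT1⟩ := ih
    refine ⟨fun n => T n + (S n).comp (subdivideIter X n k), fun A n c hc =>
      add_mem (hT A n c hc) (hS A n _ (subdivideIter_mem_chainsIn k hc)), fun c => ?_,
      fun n c => ?_⟩
    · rw [AddMonoidHom.add_apply, map_add, ← hT0, AddMonoidHom.comp_apply, ← hS0,
        subdivideIter_succ]
      abel
    · have h1 := hT1 n c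
      have h2 := hS1 n (subdivideIter X (n + 1) k c)
      rw [boundary_subdivideIter] at h2
      simp only [AddMonoidHom.add_apply, map_add, AddMonoidHom.comp_apply]
      rw [subdivideIter_succ, ← sub_add_sub_cancel c (subdivideIter X (n + 1) k c), h1, h2]
      abel

/-! ### The mesh of the barycentric subdivision -/

/-- The `ℓ¹`-distance of two points of the standard simplex. -/
def l1dist (x y : Simplex.{u} n) : ℝ := ∑ k, |x.down k - y.down k|

theorem l1dist_simplexMap_le {m : ℕ} (f : Fin (n + 1) → Fin (m + 1)) (x y : Simplex.{u} n) :
    l1dist (simplexMap f x) (simplexMap f y) ≤ l1dist x y := by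
  have : ∀ (x : Simplex.{u} n) k, (simplexMap f x).down k = ∑ i with f i = k, x.down i := by
    intro x k
    simp [simplexMap, FunOnFinite.linearMap_apply_apply]
  simp only [l1dist, this, ← Finset.sum_sub_distrib]
  calc ∑ k, |∑ i with f i = k, (x.down i - y.down i)|
      ≤ ∑ k, ∑ i with f i = k, |x.down i - y.down i| :=
        Finset.sum_le_sum fun k _ => Finset.abs_sum_le_sum_abs _ _
    _ = ∑ k, |x.down k - y.down k| := Finset.sum_fiberwise _ _ _

/-- The `ℓ¹`-distance of the barycenter from any point is largest at the vertices. -/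
theorem l1dist_baryPoint_le (x : Simplex.{u} n) :
    l1dist (baryPoint n) x ≤ 2 * (n / (n + 1)) := by
  have h1 : ∑ k, x.down k = 1 := x.down.2.2
  have h0 : ∀ k, 0 ≤ x.down k := x.down.2.1
  have hb : ∀ k, (baryPoint.{u} n).down k = ((n : ℝ) + 1)⁻¹ := by
    intro k
    change ((Fintype.card (Fin (n + 1)) : ℝ))⁻¹ = _
    simp
  have hN : (0 : ℝ) < ((n : ℝ) + 1)⁻¹ := by positivity
  set a : ℝ := ((n : ℝ) + 1)⁻¹ with ha
  have hsum : ∑ _k : Fin (n + 1), a = 1 := by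
    rw [Finset.sum_const, Finset.card_univ, Fintype.card_fin, nsmul_eq_mul, ha]
    push_cast
    exact mul_inv_cancel₀ (by positivity)
  -- `|a - b| = a + b - 2 * min a b` reduces the claim to a lower bound for the sum of the minima
  have hmin : a ≤ ∑ k, min a (x.down k) := by
    by_cases h : ∃ k, a ≤ x.down k
    · obtain ⟨k, hk⟩ := h
      calc a = min a (x.down k) := (min_eq_left hk).symm
        _ ≤ _ := Finset.single_le_sum (f := fun k => min a (x.down k))
          (fun i _ => le_min hN.le (h0 i)) (Finset.mem_univ k)
    · push Not at h
      rw [Finset.sum_congr rfl fun k _ => min_eq_right (h k).le, h1, ha]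
      exact inv_le_one_of_one_le₀ (by linarith [Nat.cast_nonneg (α := ℝ) n])
  have habs : ∀ k, |a - x.down k| = a + x.down k - 2 * min a (x.down k) := by
    intro k
    rcases le_total a (x.down k) with h | h
    · rw [min_eq_left h, abs_of_nonpos (by linarith)]
      ring
    · rw [min_eq_right h, abs_of_nonneg (by linarith)]
      ring
  have h2 : (n : ℝ) / (n + 1) = 1 - a := by
    rw [ha]
    field_simp
    ring
  rw [l1dist, Finset.sum_congr rfl fun k _ => by rw [hb, habs], Finset.sum_sub_distrib,
    Finset.sum_add_distrib, hsum, h1, ← Finset.mul_sum, h2]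
  linarith

theorem l1dist_comm (x y : Simplex.{u} n) : l1dist x y = l1dist y x := by
  simp only [l1dist, abs_sub_comm]

theorem mul_div_succ_mono (n : ℕ) :
    2 * ((n : ℝ) / (n + 1)) ≤ 2 * (((n + 1 : ℕ) : ℝ) / ((n + 1 : ℕ) + 1)) := by
  push_cast
  have : (n : ℝ) / (n + 1) ≤ ((n : ℝ) + 1) / (n + 1 + 1) := by
    rw [div_le_div_iff₀ (by positivity) (by positivity)]
    nlinarith
  linarith

/-- The vertices of each simplex in the barycentric subdivision of the standard simplex have
`ℓ¹`-distance at most `2 n / (n + 1)`, while the vertices of the standard simplex have distance `2`.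
-/
theorem baryChain_mem_supported (n : ℕ) : baryChain.{u} n ∈ Finsupp.supported ℤ ℤ
    {v | ∀ i j, l1dist (v i) (v j) ≤ 2 * (n / (n + 1))} := by
  induction n with
  | zero =>
    refine Finsupp.single_mem_supported _ _ ?_
    intro i j
    simp [l1dist]
  | succ n ih =>
    refine Finsupp.supported_comap_lmapDomain ℤ ℤ
      (fun v => (Fin.cons (baryPoint (n + 1)) v : Fin (n + 2) → Simplex.{u} (n + 1))) _
      (Submodule.sum_mem _ fun k _ => Submodule.smul_mem _ _ ?_)
    refine Finsupp.supported_comap_lmapDomain ℤ ℤ _ _ (Finsupp.supported_mono ?_ ih)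
    intro v hv i j
    have hb := fun x => l1dist_baryPoint_le (n := n + 1) x
    have h0 : (0 : ℝ) ≤ 2 * (((n + 1 : ℕ) : ℝ) / ((n + 1 : ℕ) + 1)) := by positivity
    refine Fin.cases (Fin.cases ?_ (fun j => ?_) j) (fun i => Fin.cases ?_ (fun j => ?_) j) i
    · simpa [l1dist] using h0
    · exact hb _
    · rw [l1dist_comm]
      exact hb _
    · exact (l1dist_simplexMap_le _ _ _).trans ((hv i j).trans (mul_div_succ_mono n))

/-- A combination with coefficients of sum zero of numbers in an interval of length `ε`. The factor
`1 / 2` comes from centering the interval, and it makes subdivision strictly contracting. -/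
theorem abs_sum_mul_le {ι : Type*} [Fintype ι] [Nonempty ι] (c a : ι → ℝ) {ε : ℝ}
    (hc : ∑ k, c k = 0) (ha : ∀ k l, |a k - a l| ≤ ε) :
    |∑ k, c k * a k| ≤ (∑ k, |c k|) * (ε / 2) := by
  obtain ⟨p, hp⟩ := Finite.exists_max a
  obtain ⟨q, hq⟩ := Finite.exists_min a
  have h : ∑ k, c k * a k = ∑ k, c k * (a k - (a p + a q) / 2) := by
    simp only [mul_sub, Finset.sum_sub_distrib, ← Finset.sum_mul, hc, zero_mul, sub_zero]
  rw [h, Finset.sum_mul]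
  refine (Finset.abs_sum_le_sum_abs _ _).trans (Finset.sum_le_sum fun k _ => ?_)
  rw [abs_mul]
  refine mul_le_mul_of_nonneg_left ?_ (abs_nonneg _)
  have := abs_le.1 (ha p q)
  rw [abs_le]
  constructor <;> linarith [hp k, hq k]

theorem simplex_dist_le_iff {x y : Simplex.{u} n} {r : ℝ} (hr : 0 ≤ r) :
    dist x y ≤ r ↔ ∀ j, |x.down j - y.down j| ≤ r :=
  (dist_pi_le_iff hr (f := (x.down : Fin (n + 1) → ℝ)) (g := y.down))

/-- An affine map is Lipschitz from the `ℓ¹`-distance, with half the diameter of the set of vertices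
as constant. -/
theorem dist_affineSimplex_le {m : ℕ} {v : Fin (n + 1) → Simplex.{u} m} {ε : ℝ}
    (hv : ∀ i j, dist (v i) (v j) ≤ ε) (x y : Simplex.{u} n) :
    dist (affineSimplex v x) (affineSimplex v y) ≤ l1dist x y * (ε / 2) := by
  have hε : 0 ≤ ε := dist_nonneg.trans (hv 0 0)
  refine (simplex_dist_le_iff (mul_nonneg (Finset.sum_nonneg fun _ _ => abs_nonneg _)
    (by linarith))).2 fun j => ?_
  rw [affineSimplex_apply, affineSimplex_apply, ← Finset.sum_sub_distrib]
  simp only [← sub_mul]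
  refine abs_sum_mul_le _ _ ?_ fun k l => (simplex_dist_le_iff hε).1 (hv k l) j
  have hx : ∑ k, x.down k = 1 := x.down.2.2
  have hy : ∑ k, y.down k = 1 := y.down.2.2
  rw [Finset.sum_sub_distrib, hx, hy, sub_self]

/-- The subgroup of chains generated by the affine simplices of diameter at most `ε`. -/
def smallChains (m n : ℕ) (ε : ℝ) : AddSubgroup (SingularChains (Simplex.{u} m) n) :=
  AddSubgroup.closure {c | ∃ v : Fin (n + 1) → Simplex.{u} m,
    (∀ i j, dist (v i) (v j) ≤ ε) ∧ c = single (affineSimplex v)}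

/-- Subdivision shrinks affine simplices by the factor `n / (n + 1)`. -/
theorem subdivide_mem_smallChains {m : ℕ} {ε : ℝ} {c : SingularChains (Simplex.{u} m) n}
    (hc : c ∈ smallChains m n ε) : subdivide _ n c ∈ smallChains m n (n / (n + 1) * ε) := by
  have : smallChains m n ε ≤ (smallChains m n (n / (n + 1) * ε)).comap
      (subdivide (Simplex.{u} m) n) := by
    refine (AddSubgroup.closure_le _).2 ?_
    rintro _ ⟨v, hv, rfl⟩
    have hε : 0 ≤ ε := dist_nonneg.trans (hv 0 0)
    rw [SetLike.mem_coe, AddSubgroup.mem_comap, subdivide_single_affineSimplex]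
    have h := baryChain_mem_supported.{u} n
    generalize baryChain.{u} n = b at h
    rw [Finsupp.mem_supported] at h
    rw [← Finsupp.sum_single b, Finsupp.sum, map_sum, map_sum]
    refine AddSubgroup.sum_mem _ fun w hw => ?_
    have hb : Finsupp.single w (b w) = b w • Finsupp.single w (1 : ℤ) := by
      rw [Finsupp.smul_single, smul_eq_mul, mul_one]
    rw [hb, map_zsmul, map_zsmul, vMap_single, realize_single]
    refine AddSubgroup.zsmul_mem _ ?_ _
    refine AddSubgroup.subset_closure ⟨_, fun i j => ?_, rfl⟩
    refine (dist_affineSimplex_le hv _ _).trans ?_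
    have := mul_le_mul_of_nonneg_right (h hw i j) (by linarith : 0 ≤ ε / 2)
    calc _ ≤ _ := this
      _ = _ := by ring
  exact this hc

/-- The `k`-fold subdivision of the standard simplex has mesh at most `(n / (n + 1)) ^ k`. -/
theorem subdivideIter_idSimplex_mem (n k : ℕ) :
    subdivideIter _ n k (idSimplex n) ∈ smallChains.{u} n n ((n / (n + 1)) ^ k) := by
  induction k with
  | zero =>
    refine AddSubgroup.subset_closure ⟨simplexVertex, fun i j => ?_, by
      rw [affineSimplex_id]; rfl⟩
    rw [pow_zero]
    refine (simplex_dist_le_iff zero_le_one).2 fun l => ?_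
    have h0 : ∀ x : Simplex.{u} n, 0 ≤ x.down l := fun x => x.down.2.1 l
    have h1 : ∀ x : Simplex.{u} n, x.down l ≤ 1 := fun x =>
      (Finset.single_le_sum (fun i _ => x.down.2.1 i) (Finset.mem_univ l)).trans_eq x.down.2.2
    rw [abs_le]
    constructor <;> linarith [h0 (simplexVertex i), h0 (simplexVertex j), h1 (simplexVertex i),
      h1 (simplexVertex j)]
  | succ k ih =>
    rw [subdivideIter_succ, pow_succ']
    exact subdivide_mem_smallChains ih

/-! ### Excision -/

/-- By the Lebesgue number lemma, the pieces of a sufficiently fine subdivision of a singular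
simplex each lie in one of the two open sets. -/
theorem exists_subdivideIter_single_mem {O₁ O₂ Z : Set X} (h₁ : IsOpen O₁) (h₂ : IsOpen O₂)
    (hZ : Z ⊆ O₁ ∪ O₂) (σ : C(Simplex.{u} n, X)) (hσ : ∀ t, σ t ∈ Z) :
    ∃ k, subdivideIter X n k (single σ) ∈ chainsIn (Z ∩ O₁) n ⊔ chainsIn (Z ∩ O₂) n := by
  obtain ⟨δ, hδ, h⟩ := lebesgue_number_lemma_of_metric (s := (Set.univ : Set (Simplex.{u} n)))
    (c := fun b : Bool => σ ⁻¹' (if b then O₁ else O₂)) isCompact_univ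
    (fun b => IsOpen.preimage σ.continuous (by cases b <;> assumption)) (fun t _ => by
      rcases hZ (hσ t) with h | h
      · exact Set.mem_iUnion.2 ⟨true, h⟩
      · exact Set.mem_iUnion.2 ⟨false, h⟩)
  obtain ⟨k, hk⟩ := exists_pow_lt_of_lt_one hδ (y := (n : ℝ) / (n + 1))
    (by rw [div_lt_one (by positivity)]; linarith)
  refine ⟨k, ?_⟩
  rw [← singularMap_idSimplex, subdivideIter_singularMap]
  have key : smallChains n n ((n / (n + 1)) ^ k) ≤
      (chainsIn (Z ∩ O₁) n ⊔ chainsIn (Z ∩ O₂) n).comap (singularMap σ n) := by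
    refine (AddSubgroup.closure_le _).2 ?_
    rintro _ ⟨v, hv, rfl⟩
    rw [SetLike.mem_coe, AddSubgroup.mem_comap, singularMap_single]
    obtain ⟨b, hb⟩ := h (v 0) trivial
    -- the distance of any point from the vertex `v 0` is at most `2 * (ε / 2) = ε < δ`
    have himg : ∀ t, affineSimplex v t ∈ Metric.ball (v 0) δ := by
      intro t
      rw [Metric.mem_ball, ← affineSimplex_simplexVertex v 0]
      have hl : l1dist t (simplexVertex 0) ≤ 2 := by
        have ht : ∑ k, t.down k = 1 := t.down.2.2
        have hs : ∑ k, (simplexVertex.{u} (0 : Fin (n + 1))).down k = 1 :=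
          (simplexVertex.{u} (0 : Fin (n + 1))).down.2.2
        have h0 : ∀ (x : Simplex.{u} n) k, 0 ≤ x.down k := fun x k => x.down.2.1 k
        calc l1dist t (simplexVertex 0)
            ≤ ∑ k, (t.down k + (simplexVertex.{u} (0 : Fin (n + 1))).down k) :=
              Finset.sum_le_sum fun k _ => by
                rw [abs_le]
                constructor <;> linarith [h0 t k, h0 (simplexVertex 0) k]
          _ = 2 := by rw [Finset.sum_add_distrib, ht, hs]; norm_num
      have h0 : 0 ≤ ((n : ℝ) / (n + 1)) ^ k := by positivity
      refine (dist_affineSimplex_le hv _ _).trans_lt (lt_of_le_of_lt ?_ hk)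
      nlinarith
    cases b with
    | true => exact AddSubgroup.mem_sup_left (single_mem_chainsIn fun t => ⟨hσ _, hb (himg t)⟩)
    | false => exact AddSubgroup.mem_sup_right (single_mem_chainsIn fun t => ⟨hσ _, hb (himg t)⟩)
  exact key (subdivideIter_idSimplex_mem n k)

/-- A chain that is already small remains small under further subdivision. -/
theorem subdivideIter_mem_sup {A B : Set X} {c : SingularChains X n} {k l : ℕ} (hkl : k ≤ l)
    (h : subdivideIter X n k c ∈ chainsIn A n ⊔ chainsIn B n) :
    subdivideIter X n l c ∈ chainsIn A n ⊔ chainsIn B n := by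
  induction l, hkl using Nat.le_induction with
  | base => exact h
  | succ l _ ih =>
    obtain ⟨a, ha, b, hb, e⟩ := AddSubgroup.mem_sup.1 ih
    rw [subdivideIter_succ, ← e, map_add]
    exact add_mem (AddSubgroup.mem_sup_left (subdivide_mem_chainsIn ha))
      (AddSubgroup.mem_sup_right (subdivide_mem_chainsIn hb))

/-- Every chain becomes a sum of small chains after sufficiently many subdivisions. -/
theorem exists_subdivideIter_mem {O₁ O₂ Z : Set X} (h₁ : IsOpen O₁) (h₂ : IsOpen O₂)
    (hZ : Z ⊆ O₁ ∪ O₂) {c : SingularChains X n} (hc : c ∈ chainsIn Z n) :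
    ∃ k, subdivideIter X n k c ∈ chainsIn (Z ∩ O₁) n ⊔ chainsIn (Z ∩ O₂) n := by
  choose! k hk using fun (σ : C(Simplex.{u} n, X)) (hσ : ∀ t, σ t ∈ Z) =>
    exists_subdivideIter_single_mem h₁ h₂ hZ σ hσ
  refine ⟨(coeffs X n c).support.sup k, ?_⟩
  -- the number of subdivisions must not be rewritten together with the chain
  generalize hK : (coeffs X n c).support.sup k = K
  rw [eq_sum_single c, map_sum]
  refine AddSubgroup.sum_mem _ fun σ hσ => ?_
  rw [map_zsmul]
  exact AddSubgroup.zsmul_mem _ (subdivideIter_mem_sup (hK ▸ Finset.le_sup hσ)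
    (hk σ (mem_chainsIn.1 hc σ hσ))) _

/-- Excision: if `Z` is covered by two open sets `O₁` and `O₂`, then the inclusion of `Z ∩ O₁` into
`Z` induces an isomorphism `H(Z ∩ O₁, Z ∩ O₁ ∩ O₂) = H(Z, Z ∩ O₂)`. -/
theorem relIso_excision {O₁ O₂ Z : Set X} (h₁ : IsOpen O₁) (h₂ : IsOpen O₂)
    (hZ : Z ⊆ O₁ ∪ O₂) (n : ℕ) : RelIso (Z ∩ O₁) (Z ∩ O₁ ∩ (Z ∩ O₂)) Z (Z ∩ O₂) n where
  subset := Set.inter_subset_left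
  subset' := Set.inter_subset_right
  surj z hz := by
    obtain ⟨hzZ, hzV⟩ := mem_relCycles.1 hz
    obtain ⟨k, hk⟩ := exists_subdivideIter_mem h₁ h₂ hZ hzZ
    obtain ⟨x, hx, y, hy, e⟩ := AddSubgroup.mem_sup.1 hk
    obtain ⟨T, hT, hT0, hT1⟩ := exists_subdivideIter_homotopy X k
    have hbd : boundary X n (n - 1) (subdivideIter X n k z) ∈ chainsIn (Z ∩ O₂) (n - 1) := by
      cases n with
      | zero =>
        change boundary X 0 0 _ ∈ _
        rw [boundary_zero_zero]
        exact AddSubgroup.zero_mem _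
      | succ n =>
        change boundary X (n + 1) n _ ∈ _
        rw [boundary_subdivideIter]
        exact subdivideIter_mem_chainsIn k hzV
    have hd : ∃ d ∈ chainsIn (Z ∩ O₂) n,
        z - subdivideIter X n k z = boundary X (n + 1) n (T n z) + d := by
      cases n with
      | zero => exact ⟨0, AddSubgroup.zero_mem _, by rw [hT0, add_zero]⟩
      | succ n => exact ⟨_, hT _ _ _ hzV, hT1 n z⟩
    obtain ⟨d, hd, hzd⟩ := hd
    refine ⟨x, mem_relCycles.2 ⟨hx, mem_chainsIn_inter (boundary_mem_chainsIn _ hx) ?_⟩, ?_⟩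
    · have := sub_mem hbd (boundary_mem_chainsIn (n - 1) hy)
      rwa [← e, map_add, add_sub_cancel_right] at this
    · have : z - x = y + d + boundary X (n + 1) n (T n z) := by
        rw [add_assoc, add_comm d, ← hzd, ← e]
        abel
      rw [this]
      exact mem_relBoundaries.2 ⟨_, add_mem hy hd, _, hT _ _ _ hzZ, rfl⟩
  inj w hw hw' := by
    obtain ⟨v, hv, a, ha, rfl⟩ := mem_relBoundaries.1 hw'
    obtain ⟨k, hk⟩ := exists_subdivideIter_mem h₁ h₂ hZ ha
    obtain ⟨x, hx, y, hy, e⟩ := AddSubgroup.mem_sup.1 hk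
    obtain ⟨T, hT, hT0, hT1⟩ := exists_subdivideIter_homotopy X k
    set w := v + boundary X (n + 1) n a with hwdef
    have hwU := (mem_relCycles.1 hw).1
    have h1 := congrArg (boundary X (n + 1) n) (hT1 n a)
    rw [map_sub, map_add, boundary_boundary, zero_add, ← e, map_add] at h1
    have h2 : boundary X (n + 1) n a = w - v := by rw [hwdef, add_sub_cancel_left]
    rw [h2, map_sub, map_sub] at h1
    have h3 : w - boundary X (n + 1) n (x + T n w) =
        v + boundary X (n + 1) n y - boundary X (n + 1) n (T n v) := by
      rw [map_add, sub_eq_sub_iff_add_eq_add]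
      rw [sub_eq_sub_iff_add_eq_add] at h1
      rw [← sub_eq_zero] at h1 ⊢
      rw [← h1]
      abel
    have hxT : x + T n w ∈ chainsIn (Z ∩ O₁) (n + 1) := add_mem hx (hT _ _ _ hwU)
    refine mem_relBoundaries.2 ⟨w - boundary X (n + 1) n (x + T n w), mem_chainsIn_inter
      (sub_mem hwU (boundary_mem_chainsIn _ hxT)) ?_, _, hxT, (sub_add_cancel _ _).symm⟩
    rw [h3]
    exact sub_mem (add_mem hv (boundary_mem_chainsIn _ hy)) (boundary_mem_chainsIn _ (hT _ _ _ hv))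

end

section
variable {X : Type u} [TopologicalSpace X] {n : ℕ} {J : Type*}

/-! ### Attaching cells -/

/-- The norm of a point of the closed unit ball. -/
def diskNorm (x : Disk.{u} n) : ℝ := ‖(x.down : Fin n → ℝ)‖

theorem continuous_diskNorm : Continuous (diskNorm : Disk.{u} n → ℝ) :=
  (continuous_subtype_val.comp continuous_uliftDown).norm

theorem diskNorm_le (x : Disk.{u} n) : diskNorm x ≤ 1 := mem_closedBall_zero_iff.1 x.down.2

theorem diskNorm_nonneg (x : Disk.{u} n) : 0 ≤ diskNorm x := norm_nonneg _

theorem mem_diskSphere {x : Disk.{u} n} : x ∈ diskSphere n ↔ diskNorm x = 1 :=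
  mem_sphere_zero_iff_norm

theorem isClosed_diskSphere : IsClosed (diskSphere.{u} n) := by
  have : diskSphere.{u} n = diskNorm ⁻¹' {1} := by
    ext x
    exact mem_diskSphere
  rw [this]
  exact isClosed_singleton.preimage continuous_diskNorm

instance : CompactSpace (Disk.{u} n) :=
  Homeomorph.ulift.symm.compactSpace

theorem stretch_aux (r : ℝ) {t : ℝ} (ht : 0 ≤ t) :
    0 ≤ (1 + t) / max 1 ((1 + t) * r) ∧ (1 + t) / max 1 ((1 + t) * r) * r ≤ 1 := by
  have h : 0 < max 1 ((1 + t) * r) := lt_max_of_lt_left one_pos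
  refine ⟨by positivity, ?_⟩
  rw [div_mul_eq_mul_div, div_le_one h]
  exact le_max_right _ _

/-- The homotopy of the closed unit ball that stretches it radially by the factor `1 + t`, and
stops at the boundary sphere. -/
def stretch (n : ℕ) : C(Disk.{u} n × unitInterval, Disk.{u} n) where
  toFun p := ⟨⟨((1 + (p.2 : ℝ)) / max 1 ((1 + p.2) * diskNorm p.1)) • (p.1.down : Fin n → ℝ), by
    have h := stretch_aux (diskNorm p.1) p.2.2.1
    rw [mem_closedBall_zero_iff, norm_smul, Real.norm_of_nonneg h.1]
    exact h.2⟩⟩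
  continuous_toFun := by
    refine continuous_uliftUp.comp (Continuous.subtype_mk (Continuous.fun_smul ?_ ?_) _)
    · have h := (continuous_diskNorm (n := n)).comp
        (continuous_fst (X := Disk.{u} n) (Y := unitInterval))
      refine Continuous.div (by fun_prop) (continuous_const.max (Continuous.mul (by fun_prop) h))
        fun p => ?_
      exact (lt_max_of_lt_left one_pos).ne'
    · exact continuous_subtype_val.comp (continuous_uliftDown.comp continuous_fst)

theorem diskNorm_stretch (x : Disk.{u} n) (t : unitInterval) :
    diskNorm (stretch n (x, t)) = min 1 ((1 + t) * diskNorm x) := by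
  have h := stretch_aux (diskNorm x) t.2.1
  change ‖((1 + (t : ℝ)) / max 1 ((1 + t) * diskNorm x)) • (x.down : Fin n → ℝ)‖ = _
  rw [norm_smul, Real.norm_of_nonneg h.1]
  change _ * diskNorm x = _
  rcases le_total ((1 + (t : ℝ)) * diskNorm x) 1 with h1 | h1
  · rw [max_eq_left h1, min_eq_right h1, div_one]
  · rw [max_eq_right h1, min_eq_left h1, div_mul_eq_mul_div, div_self (by linarith)]

theorem le_diskNorm_stretch (x : Disk.{u} n) (t : unitInterval) :
    diskNorm x ≤ diskNorm (stretch n (x, t)) := by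
  rw [diskNorm_stretch]
  refine le_min (diskNorm_le x) ?_
  have ht : 0 ≤ (t : ℝ) * diskNorm x := mul_nonneg t.2.1 (diskNorm_nonneg x)
  linarith

theorem stretch_zero (x : Disk.{u} n) : stretch n (x, 0) = x := by
  have h : ((1 + ((0 : unitInterval) : ℝ)) / max 1 ((1 +
    ((0 : unitInterval) : ℝ)) * diskNorm x)) = 1 := by
    rw [Set.Icc.coe_zero, add_zero, one_mul, max_eq_left (diskNorm_le x), div_one]
  refine ULift.ext _ _ (Subtype.ext ?_)
  change ((1 + ((0 : unitInterval) : ℝ)) / max 1 ((1 + ((0 : unitInterval) : ℝ)) * diskNorm x)) •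
    (x.down : Fin n → ℝ) = _
  rw [h, one_smul]

theorem stretch_of_mem_diskSphere {x : Disk.{u} n} (hx : x ∈ diskSphere n) (t : unitInterval) :
    stretch n (x, t) = x := by
  have ht : (0 : ℝ) ≤ t := t.2.1
  have h : ((1 + (t : ℝ)) / max 1 ((1 + t) * diskNorm x)) = 1 := by
    rw [mem_diskSphere.1 hx, mul_one, max_eq_right (by linarith), div_self (by linarith)]
  refine ULift.ext _ _ (Subtype.ext ?_)
  change ((1 + (t : ℝ)) / max 1 ((1 + t) * diskNorm x)) • (x.down : Fin n → ℝ) = _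
  rw [h, one_smul]

/-- `A` is obtained from the closed subspace `B` by attaching `n`-cells, with characteristic maps
`Φ j`. -/
structure IsAttaching (A B : Set X) (Φ : J → C(Disk.{u} n, X)) : Prop where
  isClosed : IsClosed B
  subset : B ⊆ A
  mem : ∀ j x, Φ j x ∈ A
  mem_iff : ∀ j x, Φ j x ∈ B ↔ x ∈ diskSphere n
  eq_of_eq : ∀ i j x y, x ∉ diskSphere n → Φ i x = Φ j y → i = j ∧ x = y
  cover : ∀ a ∈ A, a ∉ B → ∃ j x, Φ j x = a
  coherent : ∀ Z ⊆ A, IsClosed (Z ∩ B) → (∀ j, IsClosed (Φ j ⁻¹' Z)) → IsClosed Z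

namespace IsAttaching
variable {A B : Set X} {Φ : J → C(Disk.{u} n, X)} (h : IsAttaching A B Φ)
include h

/-- The radial stretching of the cells, fixing `B`, is a homotopy on `A`. As a map to the space of
paths with the compact-open topology, its continuity can be tested on `B` and on the cells. -/
theorem exists_stretch : ∃ H : A → C(unitInterval, X), Continuous H ∧
    (∀ a : A, a.1 ∈ B → ∀ t, H a t = a) ∧ ∀ j x t, H ⟨Φ j x, h.mem j x⟩ t = Φ j (stretch n
      (x, t)) := by
  classical
  have ex : ∀ a : A, ∃ f : C(unitInterval, X), (a.1 ∈ B → ∀ t, f t = a) ∧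
      ∀ j x, Φ j x = a → ∀ t, f t = Φ j (stretch n (x, t)) := by
    intro a
    by_cases ha : a.1 ∈ B
    · refine ⟨ContinuousMap.const _ a, fun _ t => rfl, fun j x hx t => ?_⟩
      rw [stretch_of_mem_diskSphere ((h.mem_iff j x).1 (hx ▸ ha)), hx]
      rfl
    · obtain ⟨i, y, hy⟩ := h.cover a a.2 ha
      refine ⟨(Φ i).comp ((stretch n).curry y), fun hb => absurd hb ha, fun j x hx t => ?_⟩
      obtain ⟨rfl, rfl⟩ := h.eq_of_eq i j y x
        (fun hs => ha (hy ▸ (h.mem_iff i y).2 hs)) (hy.trans hx.symm)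
      rfl
  choose H hHB hHΦ using ex
  refine ⟨H, continuous_iff_isClosed.2 fun Z hZ => ?_, hHB, fun j x t => hHΦ _ j x rfl t⟩
  have hcl : IsClosed (((↑) : A → X) '' (H ⁻¹' Z)) := by
    refine h.coherent _ (by rintro _ ⟨a, -, rfl⟩; exact a.2) ?_ fun j => ?_
    · have : ((↑) : A → X) '' (H ⁻¹' Z) ∩ B =
          (ContinuousMap.const' : C(X, C(unitInterval, X))) ⁻¹' Z ∩ B := by
        have hc : ∀ a : A, a.1 ∈ B →
            H a = (ContinuousMap.const' : C(X, C(unitInterval, X))) a := fun a ha => by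
          ext t
          exact hHB a ha t
        ext b
        constructor
        · rintro ⟨⟨a, ha, rfl⟩, hb⟩
          exact ⟨by rw [Set.mem_preimage, ← hc a hb]; exact ha, hb⟩
        · rintro ⟨hbZ, hb⟩
          exact ⟨⟨⟨b, h.subset hb⟩, by rw [Set.mem_preimage, hc _ hb]; exact hbZ, rfl⟩, hb⟩
      rw [this]
      exact (hZ.preimage (ContinuousMap.continuous _)).inter h.isClosed
    · have : Φ j ⁻¹' (((↑) : A → X) '' (H ⁻¹' Z)) =
          ((Φ j).comp (stretch n)).curry ⁻¹' Z := by
        have hc : ∀ x, H ⟨Φ j x, h.mem j x⟩ = ((Φ j).comp (stretch n)).curry x := fun x => by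
          ext t
          exact hHΦ _ j x rfl t
        ext x
        constructor
        · rintro ⟨⟨a, ha⟩, ha', e⟩
          subst e
          rw [Set.mem_preimage, ← hc]
          exact ha'
        · intro hx
          exact ⟨⟨Φ j x, h.mem j x⟩, by rw [Set.mem_preimage, hc]; exact hx, rfl⟩
      rw [this]
      exact hZ.preimage (ContinuousMap.continuous _)
  convert hcl.preimage continuous_subtype_val using 1
  rw [Set.preimage_image_eq _ Subtype.val_injective]

end IsAttaching

/-- The union of the images of the closed balls of radius `1 / 2` under the characteristic maps. -/
def cores (Φ : J → C(Disk.{u} n, X)) : Set X := ⋃ j, Φ j '' {x | diskNorm x ≤ 1 / 2}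

namespace IsAttaching
variable {A B : Set X} {Φ : J → C(Disk.{u} n, X)} (h : IsAttaching A B Φ)
include h

theorem mem_cores_iff (j : J) (x : Disk.{u} n) : Φ j x ∈ cores Φ ↔ diskNorm x ≤ 1 / 2 := by
  constructor
  · intro hx
    obtain ⟨i, y, hy, e⟩ := Set.mem_iUnion.1 hx
    obtain ⟨-, rfl⟩ := h.eq_of_eq i j y x (fun hs => by
      have h1 := mem_diskSphere.1 hs
      have h2 : diskNorm y ≤ 1 / 2 := hy
      linarith) e
    exact hy
  · exact fun hx => Set.mem_iUnion.2 ⟨j, x, hx, rfl⟩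

theorem disjoint_cores {b : X} (hb : b ∈ B) : b ∉ cores Φ := by
  rintro hc
  obtain ⟨i, y, hy, rfl⟩ := Set.mem_iUnion.1 hc
  have h1 := mem_diskSphere.1 ((h.mem_iff i y).1 hb)
  have h2 : diskNorm y ≤ 1 / 2 := hy
  linarith

theorem isClosed_cores : IsClosed (cores Φ) := by
  refine h.coherent _ ?_ ?_ fun j => ?_
  · exact Set.iUnion_subset fun j => Set.image_subset_iff.2 fun x _ => h.mem j x
  · convert isClosed_empty
    exact Set.eq_empty_iff_forall_notMem.2 fun b hb => h.disjoint_cores hb.2 hb.1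
  · have : Φ j ⁻¹' cores Φ = {x | diskNorm x ≤ 1 / 2} := Set.ext fun x => h.mem_cores_iff j x
    rw [this]
    exact isClosed_le continuous_diskNorm continuous_const

/-- A neighbourhood of `B` in `A` deforms into `B`. -/
theorem relAcyclic_collar : RelAcyclic (A ∩ (cores Φ)ᶜ) B := by
  obtain ⟨H, hH, hHB, hHΦ⟩ := h.exists_stretch
  let i : C(↑(A ∩ (cores Φ)ᶜ), A) := ⟨Set.inclusion Set.inter_subset_left, continuous_inclusion _⟩
  have key : ∀ (a : ↑(A ∩ (cores Φ)ᶜ)), a.1 ∉ B → ∃ j x, 1 / 2 < diskNorm x ∧ Φ j x = a.1 := by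
    intro a ha
    obtain ⟨j, x, e⟩ := h.cover a a.2.1 ha
    refine ⟨j, x, not_le.1 fun hx => a.2.2 ?_, e⟩
    rw [← e]
    exact (h.mem_cores_iff j x).2 hx
  have hi : ∀ (a : ↑(A ∩ (cores Φ)ᶜ)) j x, Φ j x = a.1 → i a = ⟨Φ j x, h.mem j x⟩ :=
    fun a j x e => Subtype.ext e.symm
  refine relAcyclic_of_deformation ((⟨H, hH⟩ : C(A, C(unitInterval, X))).comp i).uncurry
    (fun a => ?_) (fun p => ?_) (fun a t ha => ?_) (fun a => ?_)
  · change H (i a) 0 = a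
    by_cases ha : a.1 ∈ B
    · exact hHB _ ha 0
    · obtain ⟨j, x, -, e⟩ := key a ha
      rw [hi a j x e, hHΦ, stretch_zero, e]
  · obtain ⟨a, t⟩ := p
    change H (i a) t ∈ _
    by_cases ha : a.1 ∈ B
    · rw [hHB _ ha t]
      exact a.2
    · obtain ⟨j, x, hx, e⟩ := key a ha
      rw [hi a j x e, hHΦ]
      refine ⟨h.mem _ _, fun hc => ?_⟩
      have := (h.mem_cores_iff _ _).1 hc
      linarith [le_diskNorm_stretch x t]
  · change H (i a) t ∈ _
    rw [hHB _ ha t]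
    exact ha
  · change H (i a) 1 ∈ _
    by_cases ha : a.1 ∈ B
    · rw [hHB _ ha]
      exact ha
    · obtain ⟨j, x, hx, e⟩ := key a ha
      rw [hi a j x e, hHΦ, h.mem_iff, mem_diskSphere, diskNorm_stretch, Set.Icc.coe_one]
      exact min_eq_left (by linarith)

/-- The relative homology does not change if `B` is enlarged by the part of the cells outside of the
cores. -/
theorem relIso_collar (m : ℕ) : RelIso A B A (A ∩ (cores Φ)ᶜ) m :=
  relIso_of_relAcyclic_right (Set.subset_inter h.subset fun _ hb => h.disjoint_cores hb)
    Set.inter_subset_left h.relAcyclic_collar m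

/-- Excision of `B`: relative homology is computed in the union of the open cells. -/
theorem relIso_cells (m : ℕ) :
    RelIso (A ∩ Bᶜ) (A ∩ Bᶜ ∩ (A ∩ (cores Φ)ᶜ)) A (A ∩ (cores Φ)ᶜ) m :=
  relIso_excision h.isClosed.isOpen_compl h.isClosed_cores.isOpen_compl (fun a _ => by
    by_cases ha : a ∈ B
    · exact Or.inr (h.disjoint_cores ha)
    · exact Or.inl ha) m

end IsAttaching

/-- The closed ball is obtained from its boundary sphere by attaching a cell. -/
theorem isAttaching_disk (n : ℕ) : IsAttaching Set.univ (diskSphere.{u} n)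
    (fun _ : Unit => ContinuousMap.id (Disk.{u} n)) where
  isClosed := isClosed_diskSphere
  subset := Set.subset_univ _
  mem _ _ := trivial
  mem_iff _ _ := Iff.rfl
  eq_of_eq _ _ _ _ _ e := ⟨rfl, e⟩
  cover a _ _ := ⟨(), a, rfl⟩
  coherent _ _ _ hZ := hZ ()

/-- The open cell with characteristic map `f`. -/
def cellInterior (f : C(Disk.{u} n, X)) : Set X := f '' (diskSphere n)ᶜ

namespace IsAttaching
variable {A B : Set X} {Φ : J → C(Disk.{u} n, X)} (h : IsAttaching A B Φ)
include h

theorem cellInterior_subset (j : J) : cellInterior (Φ j) ⊆ A ∩ Bᶜ := by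
  rintro _ ⟨x, hx, rfl⟩
  exact ⟨h.mem j x, fun hb => hx ((h.mem_iff j x).1 hb)⟩

theorem mem_cellInterior_iff {j : J} {x : Disk.{u} n} :
    Φ j x ∈ cellInterior (Φ j) ↔ x ∈ (diskSphere n)ᶜ := by
  refine ⟨fun hx hs => ?_, fun hx => ⟨x, hx, rfl⟩⟩
  exact (h.cellInterior_subset j hx).2 ((h.mem_iff j x).2 hs)

theorem exists_mem_cellInterior {a : X} (ha : a ∈ A ∩ Bᶜ) : ∃ j, a ∈ cellInterior (Φ j) := by
  obtain ⟨j, x, rfl⟩ := h.cover a ha.1 ha.2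
  exact ⟨j, x, fun hs => ha.2 ((h.mem_iff j x).2 hs), rfl⟩

theorem eq_of_mem_cellInterior {a : X} {i j : J} (hi : a ∈ cellInterior (Φ i))
    (hj : a ∈ cellInterior (Φ j)) : i = j := by
  obtain ⟨x, hx, rfl⟩ := hi
  obtain ⟨y, hy, e⟩ := hj
  exact (h.eq_of_eq i j x y hx e.symm).1

/-- A simplex that avoids `B` lies in a single open cell. -/
theorem exists_forall_mem_cellInterior [T2Space X] {m : ℕ} (σ : C(Simplex.{u} m, X))
    (hσ : ∀ t, σ t ∈ A ∩ Bᶜ) : ∃ j, ∀ t, σ t ∈ cellInterior (Φ j) := by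
  have t₀ : Simplex.{u} m := Classical.arbitrary _
  obtain ⟨j, hj⟩ := h.exists_mem_cellInterior (hσ t₀)
  -- the open cell is the intersection of `Bᶜ` with the compact image of the ball
  have hclosed : IsClosed (σ ⁻¹' cellInterior (Φ j)) := by
    have : σ ⁻¹' cellInterior (Φ j) = σ ⁻¹' (Set.range (Φ j)) := by
      ext t
      refine ⟨fun ⟨x, _, e⟩ => ⟨x, e⟩, fun ⟨x, e⟩ => ⟨x, fun hs => (hσ t).2 ?_, e⟩⟩
      rw [← e]
      exact (h.mem_iff j x).2 hs
    rw [this]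
    exact (isCompact_range (Φ j).continuous).isClosed.preimage σ.continuous
  -- the complement of the open cell in `A` is closed by coherence
  have hopen : IsOpen (σ ⁻¹' cellInterior (Φ j)) := by
    have hc : IsClosed (A \ cellInterior (Φ j)) := by
      refine h.coherent _ Set.sdiff_subset ?_ fun i => ?_
      · have : A \ cellInterior (Φ j) ∩ B = B := Set.inter_eq_right.2 fun b hb =>
          ⟨h.subset hb, fun hc => (h.cellInterior_subset j hc).2 hb⟩
        rw [this]
        exact h.isClosed
      · by_cases hij : i = j
        · subst hij
          have : Φ i ⁻¹' (A \ cellInterior (Φ i)) = diskSphere n := by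
            ext x
            rw [Set.mem_preimage, Set.mem_sdiff, h.mem_cellInterior_iff, Set.notMem_compl_iff]
            exact and_iff_right (h.mem i x)
          rw [this]
          exact isClosed_diskSphere
        · have : Φ i ⁻¹' (A \ cellInterior (Φ j)) = Set.univ := by
            refine Set.eq_univ_of_forall fun x => ⟨h.mem i x, ?_⟩
            rintro ⟨y, hy, e⟩
            exact hij (h.eq_of_eq j i y x hy e).1.symm
          rw [this]
          exact isClosed_univ
    have : σ ⁻¹' cellInterior (Φ j) = σ ⁻¹' (A \ cellInterior (Φ j))ᶜ := by
      ext t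
      simp [(hσ t).1]
    rw [this]
    exact hc.isOpen_compl.preimage σ.continuous
  refine ⟨j, fun t => ?_⟩
  have := IsClopen.eq_univ ⟨hclosed, hopen⟩ ⟨t₀, hj⟩
  exact (this ▸ Set.mem_univ t : t ∈ σ ⁻¹' cellInterior (Φ j))

/-- The inverse of a characteristic map on the open cell. -/
theorem exists_section [T2Space X] (j : J) : ∃ g : C(cellInterior (Φ j), Disk.{u} n),
    (∀ y, g y ∈ (diskSphere n)ᶜ) ∧ ∀ y, Φ j (g y) = y := by
  have ex : ∀ y : cellInterior (Φ j), ∃ x : Disk.{u} n, x ∈ (diskSphere n)ᶜ ∧ Φ j x = y :=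
    fun y => y.2
  choose g hg hg' using ex
  refine ⟨⟨g, continuous_iff_isClosed.2 fun Z hZ => ?_⟩, hg, hg'⟩
  have hc : IsClosed (Φ j '' Z) := (hZ.isCompact.image (Φ j).continuous).isClosed
  convert hc.preimage continuous_subtype_val using 1
  ext y
  refine ⟨fun hy => ⟨g y, hy, hg' y⟩, ?_⟩
  rintro ⟨x, hx, e⟩
  have := (h.eq_of_eq j j (g y) x (hg y) ((hg' y).trans e.symm)).2
  rw [Set.mem_preimage, this]
  exact hx

/-- Chains in an open cell lift along the characteristic map. -/
theorem exists_lift [T2Space X] (j : J) {m : ℕ} {c : SingularChains X m}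
    (hc : c ∈ chainsIn (cellInterior (Φ j)) m) :
    ∃ b ∈ chainsIn (diskSphere.{u} n)ᶜ m, singularMap (Φ j) m b = c := by
  obtain ⟨g, hg, hg'⟩ := h.exists_section j
  exact exists_singularMap_eq g hg hg' hc

/-- The lift of a chain in an open cell and in `V` lies in the preimage of `V`. -/
theorem lift_mem_chainsIn (j : J) {m : ℕ} {c : SingularChains (Disk.{u} n) m}
    (hc : c ∈ chainsIn (diskSphere.{u} n)ᶜ m) {V : Set X}
    (hV : singularMap (Φ j) m c ∈ chainsIn V m) :
    c ∈ chainsIn ((diskSphere.{u} n)ᶜ ∩ Φ j ⁻¹' V) m := by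
  obtain ⟨c, rfl⟩ := hc
  rw [← singularMap_comp] at hV
  have hinj : Function.Injective ((Φ j).comp
      (⟨Subtype.val, continuous_subtype_val⟩ : C(↑(diskSphere.{u} n)ᶜ, Disk.{u} n))) :=
    fun x y e => Subtype.ext (h.eq_of_eq j j x y x.2 e).2
  have hmaps : Set.MapsTo
      (⟨Subtype.val, continuous_subtype_val⟩ : C(↑(diskSphere.{u} n)ᶜ, Disk.{u} n))
      ((Φ j).comp ⟨Subtype.val, continuous_subtype_val⟩ ⁻¹' V) ((diskSphere n)ᶜ ∩ Φ j ⁻¹' V) :=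
    fun x hx => ⟨x.2, hx⟩
  exact singularMap_mem_chainsIn hmaps (mem_chainsIn_preimage hinj hV)

theorem eq_zero_of_singularMap_eq_zero (j : J) {m : ℕ} {c : SingularChains (Disk.{u} n) m}
    (hc : c ∈ chainsIn (diskSphere.{u} n)ᶜ m) (h0 : singularMap (Φ j) m c = 0) : c = 0 := by
  apply eq_zero_of_mem_chainsIn_empty
  have := h.lift_mem_chainsIn j hc (V := ∅) (h0 ▸ AddSubgroup.zero_mem _)
  simpa using this

end IsAttaching

end

section
variable {X : Type u} [TopologicalSpace X] {n : ℕ} {J : Type*}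

/-! ### The homology of a pair obtained by attaching cells -/

open Classical in
/-- The part of a chain that consists of the simplices inside `V`. -/
def restrictChain (V : Set X) (m : ℕ) : SingularChains X m →+ SingularChains X m :=
  (ofCoeffs X m).comp ((Finsupp.filterAddHom fun σ : C(Simplex.{u} m, X) => ∀ t, σ t ∈ V).comp
    (coeffs X m))

open Classical in
theorem restrictChain_single_of_mem {V : Set X} {m : ℕ} {σ : C(Simplex.{u} m, X)}
    (h : ∀ t, σ t ∈ V) : restrictChain V m (single σ) = single σ := by
  apply coeffs_injective
  change coeffs X m (ofCoeffs X m (Finsupp.filter _ (coeffs X m (single σ)))) = _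
  rw [coeffs_ofCoeffs, coeffs_single]
  exact Finsupp.filter_single_of_pos _ h

open Classical in
theorem restrictChain_single_of_not {V : Set X} {m : ℕ} {σ : C(Simplex.{u} m, X)}
    (h : ¬ ∀ t, σ t ∈ V) : restrictChain V m (single σ) = 0 := by
  apply coeffs_injective
  change coeffs X m (ofCoeffs X m (Finsupp.filter _ (coeffs X m (single σ)))) = _
  rw [coeffs_ofCoeffs, coeffs_single, map_zero]
  exact Finsupp.filter_single_of_neg _ h

theorem restrictChain_eq_self {V : Set X} {m : ℕ} {c : SingularChains X m}
    (hc : c ∈ chainsIn V m) : restrictChain V m c = c := by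
  have : chainsIn V m ≤ (restrictChain V m).eqLocus (AddMonoidHom.id _) :=
    chainsIn_le fun σ hσ => restrictChain_single_of_mem hσ
  exact this hc

theorem restrictChain_eq_zero {V W : Set X} {m : ℕ} {c : SingularChains X m}
    (hc : c ∈ chainsIn W m) (h : Disjoint V W) : restrictChain V m c = 0 := by
  have : chainsIn W m ≤ (restrictChain V m).ker :=
    chainsIn_le fun σ hσ => restrictChain_single_of_not fun hσ' =>
      Set.disjoint_left.1 h (hσ' (Classical.arbitrary _)) (hσ _)
  exact this hc

theorem restrictChain_mem {V W : Set X} {m : ℕ} {c : SingularChains X m}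
    (hc : c ∈ chainsIn W m) : restrictChain V m c ∈ chainsIn (V ∩ W) m := by
  have : chainsIn W m ≤ (chainsIn (V ∩ W) m).comap (restrictChain V m) :=
    chainsIn_le fun σ hσ => by
      rw [AddSubgroup.mem_comap]
      by_cases h : ∀ t, σ t ∈ V
      · rw [restrictChain_single_of_mem h]
        exact single_mem_chainsIn fun t => ⟨h t, hσ t⟩
      · rw [restrictChain_single_of_not h]
        exact AddSubgroup.zero_mem _
  exact this hc

namespace IsAttaching
variable {A B : Set X} {Φ : J → C(Disk.{u} n, X)} (h : IsAttaching A B Φ) {m : ℕ}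
include h

theorem disjoint_cellInterior {i j : J} (hij : i ≠ j) :
    Disjoint (cellInterior (Φ i)) (cellInterior (Φ j)) :=
  Set.disjoint_left.2 fun _ hi hj => hij (h.eq_of_mem_cellInterior hi hj)

/-- Restriction to an open cell is a chain map on chains that avoid `B`, since no simplex that
avoids `B` meets two open cells. -/
theorem boundary_restrictChain [T2Space X] (i : J) {k l : ℕ} {c : SingularChains X k}
    (hc : c ∈ chainsIn (A ∩ Bᶜ) k) :
    boundary X k l (restrictChain (cellInterior (Φ i)) k c) =
      restrictChain (cellInterior (Φ i)) l (boundary X k l c) := by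
  have : chainsIn (A ∩ Bᶜ) k ≤ ((boundary X k l).comp
      (restrictChain (cellInterior (Φ i)) k)).eqLocus
        ((restrictChain (cellInterior (Φ i)) l).comp (boundary X k l)) := by
    refine chainsIn_le fun σ hσ => ?_
    obtain ⟨j, hj⟩ := h.exists_forall_mem_cellInterior σ hσ
    change boundary X k l (restrictChain _ k (single σ)) = restrictChain _ l (boundary X k l
      (single σ))
    have hs := single_mem_chainsIn hj
    by_cases hij : i = j
    · subst hij
      rw [restrictChain_eq_self hs, restrictChain_eq_self (boundary_mem_chainsIn l hs)]
    · rw [restrictChain_eq_zero hs (h.disjoint_cellInterior hij), map_zero,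
        restrictChain_eq_zero (boundary_mem_chainsIn l hs) (h.disjoint_cellInterior hij)]
  exact this hc

/-- A chain that avoids `B` is the sum of its restrictions to finitely many open cells. -/
theorem exists_eq_sum_restrictChain [T2Space X] {c : SingularChains X m}
    (hc : c ∈ chainsIn (A ∩ Bᶜ) m) :
    ∃ s : Finset J, c = ∑ j ∈ s, restrictChain (cellInterior (Φ j)) m c := by
  classical
  have ex : ∀ σ : (coeffs X m c).support, ∃ j, ∀ t, σ.1 t ∈ cellInterior (Φ j) := fun σ =>
    h.exists_forall_mem_cellInterior σ.1 (mem_chainsIn.1 hc σ.1 σ.2)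
  choose f hf using ex
  refine ⟨Finset.univ.image f, ?_⟩
  have key : ∀ σ : (coeffs X m c).support, ∑ j ∈ Finset.univ.image f,
      restrictChain (cellInterior (Φ j)) m (single σ.1) = single σ.1 := by
    intro σ
    have hs := single_mem_chainsIn (hf σ)
    rw [Finset.sum_eq_single_of_mem (f σ) (Finset.mem_image_of_mem _ (Finset.mem_univ _)),
      restrictChain_eq_self hs]
    exact fun j _ hj => restrictChain_eq_zero hs (h.disjoint_cellInterior hj)
  have e := eq_sum_single c
  rw [← Finset.sum_coe_sort] at e
  calc c = _ := e
    _ = ∑ σ : (coeffs X m c).support, coeffs X m c σ • ∑ j ∈ Finset.univ.image f,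
          restrictChain (cellInterior (Φ j)) m (single σ.1) := by simp only [key]
    _ = ∑ j ∈ Finset.univ.image f, restrictChain (cellInterior (Φ j)) m
          (∑ σ : (coeffs X m c).support, coeffs X m c σ • single σ.1) := by
        simp only [Finset.smul_sum, map_sum, map_zsmul]
        exact Finset.sum_comm
    _ = _ := by rw [← e]

theorem mapsTo_collar (j : J) : Set.MapsTo (Φ j)
    (Set.univ ∩ (cores fun _ : Unit => ContinuousMap.id (Disk.{u} n))ᶜ) (A ∩ (cores Φ)ᶜ) :=
  fun x hx => ⟨h.mem j x, fun hc =>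
    hx.2 (((isAttaching_disk n).mem_cores_iff () x).2 ((h.mem_cores_iff j x).1 hc))⟩

theorem lift_mem_collar (j : J) {c : SingularChains (Disk.{u} n) m}
    (hc : c ∈ chainsIn (diskSphere.{u} n)ᶜ m)
    (hV : singularMap (Φ j) m c ∈ chainsIn (A ∩ Bᶜ ∩ (A ∩ (cores Φ)ᶜ)) m) :
    c ∈ chainsIn (Set.univ ∩ (diskSphere n)ᶜ ∩
      (Set.univ ∩ (cores fun _ : Unit => ContinuousMap.id (Disk.{u} n))ᶜ)) m :=
by
  refine chainsIn_mono ?_ m (h.lift_mem_chainsIn j hc hV)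
  exact fun x hx => ⟨⟨trivial, hx.1⟩, trivial, fun hc =>
    hx.2.2.2 ((h.mem_cores_iff j x).2 (((isAttaching_disk n).mem_cores_iff () x).1 hc))⟩

/-- The relative homology of `(A, B)` is generated by the images of the relative cycles of the ball:
a cycle is moved into the union of the open cells by excision, and splits there. -/
theorem exists_sub_sum_mem [T2Space X] {z : SingularChains X m} (hz : z ∈ relCycles A B m) :
    ∃ (s : Finset J) (y : J → SingularChains (Disk.{u} n) m),
      (∀ j, y j ∈ relCycles Set.univ (diskSphere n) m) ∧
      z - ∑ j ∈ s, singularMap (Φ j) m (y j) ∈ relBoundaries A B m := by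
  have hzN := relCycles_mono subset_rfl (h.relIso_collar m).subset' m hz
  -- replace `z` by a chain in the union of the open cells
  obtain ⟨w, hw, hzw⟩ := (h.relIso_cells m).surj z hzN
  obtain ⟨hw1, hw2⟩ := mem_relCycles.1 hw
  obtain ⟨s, hs⟩ := h.exists_eq_sum_restrictChain hw1
  have ex : ∀ j, ∃ y ∈ relCycles Set.univ (diskSphere.{u} n) m,
      restrictChain (cellInterior (Φ j)) m w - singularMap (Φ j) m y ∈
        relBoundaries A (A ∩ (cores Φ)ᶜ) m := by
    intro j
    obtain ⟨b, hb, e⟩ := h.exists_lift j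
      (chainsIn_mono Set.inter_subset_left m (restrictChain_mem (V := cellInterior (Φ j)) hw1))
    have hb2 : boundary _ m (m - 1) b ∈ chainsIn (Set.univ ∩ (diskSphere n)ᶜ ∩
        (Set.univ ∩ (cores fun _ : Unit => ContinuousMap.id (Disk.{u} n))ᶜ)) (m - 1) := by
      refine h.lift_mem_collar j (boundary_mem_chainsIn _ hb) ?_
      rw [← boundary_singularMap, e, h.boundary_restrictChain j hw1]
      exact chainsIn_mono Set.inter_subset_right _ (restrictChain_mem hw2)
    have hD := isAttaching_disk.{u} n
    obtain ⟨y, hy, hby⟩ := (hD.relIso_collar m).surj b (mem_relCycles.2 ⟨mem_chainsIn_univ b,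
      chainsIn_mono Set.inter_subset_right _ hb2⟩)
    refine ⟨y, hy, ?_⟩
    rw [← e, ← map_sub]
    exact singularMap_mem_relBoundaries (fun x _ => h.mem j x) (h.mapsTo_collar j) hby
  choose y hy hwy using ex
  refine ⟨s, y, hy, (h.relIso_collar m).inj _ (sub_mem hz (sum_mem fun j _ =>
    singularMap_mem_relCycles (fun x _ => h.mem j x) (fun x hx => (h.mem_iff j x).2 hx) (hy j))) ?_⟩
  have : z - ∑ j ∈ s, singularMap (Φ j) m (y j) = (z - w) +
      ∑ j ∈ s, (restrictChain (cellInterior (Φ j)) m w - singularMap (Φ j) m (y j)) := by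
    rw [Finset.sum_sub_distrib, ← hs]
    abel
  rw [this]
  exact add_mem hzw (sum_mem fun j _ => hwy j)

/-- The relative homology groups of the balls embed as a direct sum into that of `(A, B)`: after
excision, a bounding chain can be restricted to each open cell separately. -/
theorem mem_relBoundaries_of_sum_mem [T2Space X] {s : Finset J}
    {y : J → SingularChains (Disk.{u} n) m}
    (hy : ∀ j, y j ∈ relCycles Set.univ (diskSphere n) m)
    (hs : ∑ j ∈ s, singularMap (Φ j) m (y j) ∈ relBoundaries A B m) {i : J} (hi : i ∈ s) :
    y i ∈ relBoundaries Set.univ (diskSphere n) m := by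
  have hD := isAttaching_disk.{u} n
  have ex : ∀ j, ∃ w ∈ relCycles (Set.univ ∩ (diskSphere n)ᶜ) (Set.univ ∩ (diskSphere n)ᶜ ∩
      (Set.univ ∩ (cores fun _ : Unit => ContinuousMap.id (Disk.{u} n))ᶜ)) m, y j - w ∈
      relBoundaries Set.univ
        (Set.univ ∩ (cores fun _ : Unit => ContinuousMap.id (Disk.{u} n))ᶜ) m := fun j =>
    (hD.relIso_cells m).surj (y j) (relCycles_mono subset_rfl (hD.relIso_collar m).subset' m (hy j))
  -- `w j` is homologous to `y j` and lies in the open ball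
  choose w hw hyw using ex
  have hint : ∀ j, Set.MapsTo (Φ j) (Set.univ ∩ (diskSphere n)ᶜ) (cellInterior (Φ j)) :=
    fun j x hx => ⟨x, hx.2, rfl⟩
  have hwc : ∀ j, singularMap (Φ j) m (w j) ∈ chainsIn (cellInterior (Φ j)) m := fun j =>
    singularMap_mem_chainsIn (hint j) (hw j).1
  have hsum : ∑ j ∈ s, singularMap (Φ j) m (w j) ∈ relBoundaries A (A ∩ (cores Φ)ᶜ) m := by
    have : ∑ j ∈ s, singularMap (Φ j) m (w j) = ∑ j ∈ s, singularMap (Φ j) m (y j) -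
        ∑ j ∈ s, singularMap (Φ j) m (y j - w j) := by
      rw [← Finset.sum_sub_distrib]
      refine Finset.sum_congr rfl fun j _ => ?_
      rw [map_sub, sub_sub_cancel]
    rw [this]
    exact sub_mem (relBoundaries_mono subset_rfl (h.relIso_collar m).subset' m hs)
      (sum_mem fun j _ => singularMap_mem_relBoundaries (fun x _ => h.mem j x)
        (h.mapsTo_collar j) (hyw j))
  have hint' : ∀ j, Set.MapsTo (Φ j) (Set.univ ∩ (diskSphere n)ᶜ ∩
      (Set.univ ∩ (cores fun _ : Unit => ContinuousMap.id (Disk.{u} n))ᶜ))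
      (A ∩ Bᶜ ∩ (A ∩ (cores Φ)ᶜ)) :=
    fun j x hx => ⟨h.cellInterior_subset j (hint j hx.1), h.mapsTo_collar j hx.2⟩
  have hcyc : ∑ j ∈ s, singularMap (Φ j) m (w j) ∈
      relCycles (A ∩ Bᶜ) (A ∩ Bᶜ ∩ (A ∩ (cores Φ)ᶜ)) m :=
    sum_mem fun j _ => singularMap_mem_relCycles
      (fun x hx => h.cellInterior_subset j (hint j hx))
      (hint' j) (hw j)
  obtain ⟨b, hb, a, ha, e⟩ := mem_relBoundaries.1 ((h.relIso_cells m).inj _ hcyc hsum)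
  -- restrict the bounding chain to the `i`-th open cell, and lift it to the ball
  have e' := congrArg (restrictChain (cellInterior (Φ i)) m) e
  rw [map_sum, Finset.sum_eq_single_of_mem i hi fun j _ hj =>
    restrictChain_eq_zero (hwc j) (h.disjoint_cellInterior hj.symm), restrictChain_eq_self (hwc i),
    map_add, ← h.boundary_restrictChain i ha] at e'
  obtain ⟨a', ha', ea⟩ := h.exists_lift i
    (chainsIn_mono Set.inter_subset_left _ (restrictChain_mem (V := cellInterior (Φ i)) ha))
  have hb0 := restrictChain_mem (V := cellInterior (Φ i)) hb
  obtain ⟨b', hb', eb⟩ := h.exists_lift i (chainsIn_mono Set.inter_subset_left _ hb0)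
  rw [← ea, ← eb, boundary_singularMap, ← map_add, ← sub_eq_zero, ← map_sub] at e'
  have e'' := h.eq_zero_of_singularMap_eq_zero i (sub_mem (chainsIn_mono Set.inter_subset_right _
    (hw i).1) (add_mem hb' (boundary_mem_chainsIn _ ha'))) e'
  have hb'' := h.lift_mem_collar i hb' (by
    rw [eb]
    exact chainsIn_mono Set.inter_subset_right _ hb0)
  refine (hD.relIso_collar m).inj _ (hy i) ?_
  rw [← sub_add_cancel (y i) (w i)]
  refine add_mem (hyw i) ?_
  rw [sub_eq_zero.1 e'']
  exact (mem_relBoundaries.2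
    ⟨b', chainsIn_mono Set.inter_subset_right _ hb'', a', mem_chainsIn_univ _, rfl⟩)

end IsAttaching
end

section
variable {X : Type u} [TopologicalSpace X] {Y : Type u} [TopologicalSpace Y] {n : ℕ}

/-! ### The homology of a ball relative to its boundary sphere -/

/-- Relative homology only depends on the subspaces, not on the ambient space. -/
theorem nonempty_relHomology_equiv {f : C(Y, X)} (hf : Function.Injective f) {A' B' : Set X}
    (g : C(A', Y)) (hg : ∀ y, f (g y) = y) (hA : ∀ y, f y ∈ A') (hB : B' ⊆ A') (m : ℕ) :
    Nonempty (RelHomology (Set.univ : Set Y) (f ⁻¹' B') m ≃+ RelHomology A' B' m) := by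
  have hA' : Set.MapsTo f Set.univ A' := fun y _ => hA y
  have hB' : Set.MapsTo f (f ⁻¹' B') B' := fun y hy => hy
  have lift : ∀ {k} {c : SingularChains X k}, c ∈ chainsIn A' k → ∃ b, singularMap f k b = c :=
    fun hc => let ⟨b, _, e⟩ := exists_singularMap_eq (A := Set.univ) g (fun _ => trivial) hg hc
      ⟨b, e⟩
  let F : RelHomology (Set.univ : Set Y) (f ⁻¹' B') m →+ RelHomology A' B' m :=
    QuotientAddGroup.map _ _ (((singularMap f m).comp (relCycles _ _ m).subtype).codRestrict
      (relCycles A' B' m) fun c => singularMap_mem_relCycles hA' hB' c.2) (fun c hc =>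
        singularMap_mem_relBoundaries hA' hB' hc)
  refine ⟨AddEquiv.ofBijective F ⟨(injective_iff_map_eq_zero F).2 fun x hx => ?_, fun y => ?_⟩⟩
  · obtain ⟨⟨x, hx0⟩, rfl⟩ := QuotientAddGroup.mk_surjective x
    have h : singularMap f m x ∈ relBoundaries A' B' m := (QuotientAddGroup.eq_zero_iff
      (N := (relBoundaries A' B' m).addSubgroupOf _) (⟨singularMap f m x,
        singularMap_mem_relCycles hA' hB' hx0⟩ : relCycles A' B' m)).1 hx
    obtain ⟨b, hb, a, ha, e⟩ := mem_relBoundaries.1 h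
    obtain ⟨b, rfl⟩ := lift (chainsIn_mono hB m hb)
    obtain ⟨a, rfl⟩ := lift ha
    rw [boundary_singularMap, ← map_add] at e
    refine (QuotientAddGroup.eq_zero_iff _).2 ?_
    exact mem_relBoundaries.2 ⟨b, mem_chainsIn_preimage hf hb, a, mem_chainsIn_univ _,
      singularMap_injective hf m e⟩
  · obtain ⟨⟨y, hy⟩, rfl⟩ := QuotientAddGroup.mk_surjective y
    obtain ⟨x, rfl⟩ := lift hy.1
    have h2 := (mem_relCycles.1 hy).2
    rw [boundary_singularMap] at h2
    exact ⟨QuotientAddGroup.mk ⟨x, mem_relCycles.2 ⟨mem_chainsIn_univ _,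
      mem_chainsIn_preimage hf h2⟩⟩, rfl⟩

/-- Euclidean space (lifted to the universe of `X`). -/
abbrev Euc (n : ℕ) : Type u := ULift.{u} (Fin n → ℝ)

/-- The complement of a coordinate subspace: some coordinate with index `< k` is nonzero. -/
def nonzeroSet (n k : ℕ) : Set (Euc.{u} n) := {x | ∃ i : Fin n, i.1 < k ∧ x.down i ≠ 0}

/-- The points of `nonzeroSet n k`, and those with `s * x k > 0`. -/
def halfSet (k : Fin n) (s : ℝ) : Set (Euc.{u} n) :=
  nonzeroSet n k ∪ {x | 0 < s * x.down k}

/-- A deformation of `A` into `B` along the segments from `a` to `f a`. -/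
theorem relAcyclic_of_segment {A B : Set (Euc.{u} n)} (f : C(A, Fin n → ℝ))
    (hA : ∀ (a : A) (t : unitInterval), ULift.up ((1 - (t : ℝ)) • a.1.down + (t : ℝ) • f a) ∈ A)
    (hB : ∀ (a : A) (t : unitInterval), a.1 ∈ B →
      ULift.up ((1 - (t : ℝ)) • a.1.down + (t : ℝ) • f a) ∈ B)
    (h1 : ∀ a : A, ULift.up (f a) ∈ B) : RelAcyclic A B := by
  have hd : Continuous fun p : A × unitInterval => p.1.1.down :=
    continuous_uliftDown.comp (continuous_subtype_val.comp continuous_fst)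
  refine relAcyclic_of_deformation
    ⟨fun p => ULift.up ((1 - (p.2 : ℝ)) • p.1.1.down + (p.2 : ℝ) • f p.1),
      continuous_uliftUp.comp (by fun_prop)⟩ (fun a => ?_) (fun p => hA p.1 p.2)
    (fun a t => hB a t) (fun a => ?_)
  · simp
  · simpa using h1 a

theorem isOpen_nonzeroSet (k : ℕ) : IsOpen (nonzeroSet.{u} n k) := by
  have : nonzeroSet.{u} n k = ⋃ i : {i : Fin n // i.1 < k}, {x | x.down i.1 ≠ 0} := by
    ext x
    simp [nonzeroSet]
  rw [this]
  exact isOpen_iUnion fun i => isOpen_ne_fun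
    ((continuous_apply i.1).comp continuous_uliftDown) continuous_const

theorem isOpen_halfSet (k : Fin n) (s : ℝ) : IsOpen (halfSet.{u} k s) :=
  (isOpen_nonzeroSet k).union (isOpen_lt continuous_const
    (continuous_const.mul ((continuous_apply k).comp continuous_uliftDown)))

/-- The whole space deforms into `halfSet k s` along the segments to the point `s` on the `k`-th
axis. -/
theorem relAcyclic_halfSet (k : Fin n) {s : ℝ} (hs : s ≠ 0) :
    RelAcyclic Set.univ (halfSet.{u} k s) := by
  refine relAcyclic_of_segment (ContinuousMap.const _ (Pi.single k s)) (fun _ _ => trivial)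
    (fun a t ha => ?_) (fun a => Or.inr ?_)
  · have hs2 : 0 < s * s := mul_self_pos.2 hs
    rcases ha with ⟨i, hi, hai⟩ | ha
    · rcases eq_or_ne (t : ℝ) 1 with ht | ht
      · right
        simpa [ht] using hs2
      · left
        refine ⟨i, hi, ?_⟩
        have hik : i ≠ k := fun e => by simp [e] at hi
        simpa [hik, sub_eq_zero, hai] using ht.symm
    · right
      replace ha : 0 < s * a.1.down k := ha
      have ht0 : (0 : ℝ) ≤ t := t.2.1
      have ht1 : (t : ℝ) ≤ 1 := t.2.2
      have : 0 < (1 - (t : ℝ)) * (s * a.1.down k) + t * (s * s) := by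
        rcases ht1.lt_or_eq with h | h
        · exact add_pos_of_pos_of_nonneg (mul_pos (by linarith) ha) (by positivity)
        · rw [h]; simpa using hs2
      simp only [Set.mem_ofPred_eq, Pi.add_apply, Pi.smul_apply, smul_eq_mul,
        ContinuousMap.const_apply, Pi.single_eq_same]
      linarith
  · simpa using mul_self_pos.2 hs

theorem nonzeroSet_subset_halfSet (k : Fin n) (s : ℝ) : nonzeroSet.{u} n k ⊆ halfSet k s :=
  Set.subset_union_left

theorem halfSet_union (k : Fin n) :
    halfSet.{u} k 1 ∪ halfSet k (-1) = nonzeroSet n (k + 1) := by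
  ext x
  constructor
  · have aux : ∀ s : ℝ, x ∈ halfSet k s → x ∈ nonzeroSet n (k + 1) := by
      rintro s (⟨i, hi, hx⟩ | hx)
      · exact ⟨i, by omega, hx⟩
      · exact ⟨k, by omega, fun h0 => by simp [h0] at hx⟩
    exact fun h => h.elim (aux _) (aux _)
  · rintro ⟨i, hi, hx⟩
    rcases Nat.lt_succ_iff_lt_or_eq.1 hi with h | h
    · exact Or.inl (Or.inl ⟨i, h, hx⟩)
    · obtain rfl : i = k := Fin.ext h
      rcases hx.lt_or_gt with h0 | h0
      · exact Or.inr (Or.inr (by simpa using h0))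
      · exact Or.inl (Or.inr (by simpa using h0))

theorem halfSet_inter (k : Fin n) :
    halfSet.{u} k 1 ∩ halfSet k (-1) = nonzeroSet n k := by
  rw [halfSet, halfSet, ← Set.union_inter_distrib_left, Set.union_eq_left]
  rintro x ⟨h1, h2⟩
  simp only [Set.mem_ofPred_eq] at h1 h2
  linarith

theorem halfSet_subset (k : Fin n) {s : ℝ} (hs : s = 1 ∨ s = -1) :
    halfSet.{u} k s ⊆ nonzeroSet n (k + 1) := by
  rw [← halfSet_union]
  rcases hs with rfl | rfl
  · exact Set.subset_union_left
  · exact Set.subset_union_right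

/-- Write `W k` for `nonzeroSet n k`, with the two halves `H⁺` and `H⁻` of `W (k + 1)`. Then
`H_{m+1}(ℝⁿ, W (k + 1)) = H_m(W (k + 1), H⁻) = H_m(H⁺, W k) = H_m(ℝⁿ, W k)`, by the connecting
homomorphism, by excision, and because `ℝⁿ` deforms into each of the halves. -/
theorem nonempty_relHomology_nonzeroSet_succ (k : Fin n) (m : ℕ) :
    Nonempty (RelHomology Set.univ (nonzeroSet.{u} n (k + 1)) (m + 1) ≃+
      RelHomology Set.univ (nonzeroSet.{u} n k) m) := by
  have e1 := AddEquiv.ofBijective _ (connecting_bijective_of_relAcyclic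
    (halfSet_subset k (Or.inr rfl)) (Set.subset_univ _)
    (relAcyclic_halfSet.{u} k (s := -1) (by norm_num)) m)
  obtain ⟨e2⟩ := (relIso_excision (isOpen_halfSet.{u} k 1) (isOpen_halfSet k (-1))
    (halfSet_union k).ge m).nonempty_addEquiv
  rw [Set.inter_eq_right.2 (halfSet_subset k (Or.inl rfl)),
    Set.inter_eq_right.2 (halfSet_subset k (Or.inr rfl)), halfSet_inter] at e2
  obtain ⟨e3⟩ := (relIso_of_relAcyclic_left (nonzeroSet_subset_halfSet k 1) (Set.subset_univ _)
    (relAcyclic_halfSet.{u} k one_ne_zero) m).nonempty_addEquiv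
  exact ⟨e1.trans (e2.symm.trans e3)⟩

/-- Iterating the degree shift: the homology of `ℝⁿ` relative to `nonzeroSet n k` is that of `ℝⁿ`
shifted by `k`. -/
theorem relHomology_nonzeroSet {k : ℕ} (hk : k ≤ n) :
    (∀ m < k, Subsingleton (RelHomology Set.univ (nonzeroSet.{u} n k) m)) ∧
    ∀ m, Nonempty (RelHomology Set.univ (nonzeroSet.{u} n k) (m + k) ≃+
      RelHomology Set.univ (∅ : Set (Euc.{u} n)) m) := by
  induction k with
  | zero =>
    have : nonzeroSet.{u} n 0 = ∅ := by simp [nonzeroSet]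
    rw [this]
    exact ⟨fun m hm => absurd hm (Nat.not_lt_zero m), fun m => ⟨AddEquiv.refl _⟩⟩
  | succ k ih =>
    obtain ⟨h1, h2⟩ := ih (by omega)
    refine ⟨fun m hm => ?_, fun m => ?_⟩
    · cases m with
      | zero =>
        exact subsingleton_relHomology (relCycles_zero_le_of_relAcyclic
          (halfSet_subset ⟨k, hk⟩ (Or.inl rfl)) (relAcyclic_halfSet ⟨k, hk⟩ one_ne_zero))
      | succ m =>
        obtain ⟨e⟩ := nonempty_relHomology_nonzeroSet_succ.{u} (⟨k, hk⟩ : Fin n) m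
        have := h1 m (by omega)
        exact e.toEquiv.subsingleton
    · obtain ⟨e⟩ := nonempty_relHomology_nonzeroSet_succ.{u} (⟨k, hk⟩ : Fin n) (m + k)
      obtain ⟨e'⟩ := h2 m
      exact ⟨e.trans e'⟩

theorem relCycles_univ_empty_le [ContractibleSpace X] {m : ℕ} (hm : m ≠ 0) :
    relCycles (Set.univ : Set X) ∅ m ≤ relBoundaries Set.univ ∅ m := by
  intro z hz
  obtain ⟨b, rfl⟩ := exists_boundary_eq_of_contractible
    (eq_zero_of_mem_chainsIn_empty (mem_relCycles.1 hz).2) (fun h => absurd h hm)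
  exact boundary_mem_relBoundaries (mem_chainsIn_univ b)

theorem augmentation_eq_zero_of_mem_relBoundaries {A : Set X} {c : SingularChains X 0}
    (h : c ∈ relBoundaries A ∅ 0) : augmentation X 0 c = 0 := by
  obtain ⟨b, hb, a, -, rfl⟩ := mem_relBoundaries.1 h
  rw [eq_zero_of_mem_chainsIn_empty hb, zero_add, augmentation_boundary]

/-- The homology of a contractible space in degree zero is infinite cyclic, by the augmentation. -/
theorem nonempty_relHomology_zero_equiv [ContractibleSpace X] :
    Nonempty (RelHomology (Set.univ : Set X) ∅ 0 ≃+ ℤ) := by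
  let F : RelHomology (Set.univ : Set X) ∅ 0 →+ ℤ :=
    QuotientAddGroup.lift _ ((augmentation X 0).comp (relCycles _ _ 0).subtype)
      (fun c hc => augmentation_eq_zero_of_mem_relBoundaries hc)
  refine ⟨AddEquiv.ofBijective F ⟨(injective_iff_map_eq_zero F).2 fun x hx => ?_, fun k => ?_⟩⟩
  · obtain ⟨⟨x, hx0⟩, rfl⟩ := QuotientAddGroup.mk_surjective x
    obtain ⟨b, rfl⟩ := exists_boundary_eq_of_contractible (n := 0) (c := x)
      (boundary_zero_zero x) (fun _ => hx)
    exact (QuotientAddGroup.eq_zero_iff _).2 (boundary_mem_relBoundaries (mem_chainsIn_univ b))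
  · have x : X := Classical.arbitrary X
    refine ⟨QuotientAddGroup.mk ⟨k • single (ContinuousMap.const _ x),
      mem_relCycles_zero.2 (mem_chainsIn_univ _)⟩, ?_⟩
    change augmentation X 0 (k • single _) = k
    rw [map_zsmul, augmentation_single, smul_eq_mul, mul_one]

/-- The inclusion of the closed unit ball. -/
def diskIncl (n : ℕ) : C(Disk.{u} n, Euc.{u} n) :=
  ⟨fun x => ⟨x.down⟩, continuous_uliftUp.comp (continuous_subtype_val.comp continuous_uliftDown)⟩

theorem mem_nonzeroSet_self {x : Euc.{u} n} : x ∈ nonzeroSet n n ↔ x.down ≠ 0 := by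
  rw [Function.ne_iff]
  exact ⟨fun ⟨i, _, h⟩ => ⟨i, h⟩, fun ⟨i, h⟩ => ⟨i, i.2, h⟩⟩

/-- The pair of the ball and its boundary sphere has the homology of the pair `ℝⁿ`, `ℝⁿ \ {0}`, by
radial deformations. -/
theorem nonempty_relHomology_disk (n m : ℕ) :
    Nonempty (RelHomology Set.univ (diskSphere.{u} n) m ≃+
      RelHomology Set.univ (nonzeroSet.{u} n n) m) := by
  let D : Set (Euc.{u} n) := {x | ‖x.down‖ ≤ 1}
  let S : Set (Euc.{u} n) := {x | ‖x.down‖ = 1}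
  have hSD : S ⊆ D := fun x hx => le_of_eq hx
  have hSW : S ⊆ nonzeroSet n n := fun x hx => mem_nonzeroSet_self.2 fun h0 => by
    have hx : ‖x.down‖ = 1 := hx
    simp [h0] at hx
  have hinj : Function.Injective (diskIncl.{u} n) := fun x y h =>
    ULift.ext _ _ (Subtype.ext (congrArg ULift.down h))
  obtain ⟨e1⟩ := nonempty_relHomology_equiv (A' := D) (B' := S) hinj
    ⟨fun y => ⟨⟨y.1.down, mem_closedBall_zero_iff.2 y.2⟩⟩, continuous_uliftUp.comp
      (Continuous.subtype_mk (continuous_uliftDown.comp continuous_subtype_val) _)⟩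
    (fun y => rfl) (fun y => mem_closedBall_zero_iff.1 y.down.2) hSD m
  have hpre : diskIncl.{u} n ⁻¹' S = diskSphere n := by
    ext x
    exact mem_diskSphere.symm
  rw [hpre] at e1
  -- the retraction `a ↦ a / max 1 ‖a‖` onto the ball
  have hD : RelAcyclic (Set.univ : Set (Euc.{u} n)) D := by
    refine relAcyclic_of_segment ⟨fun a => (max 1 ‖a.1.down‖)⁻¹ • a.1.down, ?_⟩
      (fun _ _ => trivial) (fun a t ha => ?_) (fun a => ?_)
    · have hd : Continuous fun a : (Set.univ : Set (Euc.{u} n)) => a.1.down :=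
        continuous_uliftDown.comp continuous_subtype_val
      refine Continuous.fun_smul (Continuous.inv₀ (continuous_const.max hd.norm) fun a => ?_) hd
      exact (lt_max_of_lt_left one_pos).ne'
    · have : max 1 ‖a.1.down‖ = 1 := max_eq_left ha
      change ‖(1 - (t : ℝ)) • a.1.down + (t : ℝ) • ((max 1 ‖a.1.down‖)⁻¹ • a.1.down)‖ ≤ 1
      rw [this, inv_one, one_smul, ← add_smul, sub_add_cancel, one_smul]
      exact ha
    · change ‖(max 1 ‖a.1.down‖)⁻¹ • a.1.down‖ ≤ 1
      have h : 0 < max 1 ‖a.1.down‖ := lt_max_of_lt_left one_pos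
      rw [norm_smul, norm_inv, Real.norm_of_nonneg h.le, inv_mul_le_one₀ h]
      exact le_max_right _ _
  -- the retraction `a ↦ a / ‖a‖` onto the sphere
  have hW : RelAcyclic (nonzeroSet.{u} n n) S := by
    have hpos : ∀ a : nonzeroSet.{u} n n, 0 < ‖a.1.down‖ := fun a =>
      norm_pos_iff.2 (mem_nonzeroSet_self.1 a.2)
    refine relAcyclic_of_segment ⟨fun a => ‖a.1.down‖⁻¹ • a.1.down, ?_⟩
      (fun a t => ?_) (fun a t ha => ?_) (fun a => ?_)
    · have hd : Continuous fun a : nonzeroSet.{u} n n => a.1.down :=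
        continuous_uliftDown.comp continuous_subtype_val
      exact Continuous.fun_smul (Continuous.inv₀ hd.norm fun a => (hpos a).ne') hd
    · rw [mem_nonzeroSet_self]
      change (1 - (t : ℝ)) • a.1.down + (t : ℝ) • (‖a.1.down‖⁻¹ • a.1.down) ≠ 0
      have ht0 : (0 : ℝ) ≤ t := t.2.1
      have ht1 : (t : ℝ) ≤ 1 := t.2.2
      have hp := inv_pos.2 (hpos a)
      rw [smul_smul, ← add_smul]
      refine smul_ne_zero (ne_of_gt ?_) (mem_nonzeroSet_self.1 a.2)
      rcases ht1.lt_or_eq with h | h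
      · exact add_pos_of_pos_of_nonneg (by linarith) (by positivity)
      · rw [h]; simpa using hpos a
    · have ha' : ‖a.1.down‖ = 1 := ha
      change ‖(1 - (t : ℝ)) • a.1.down + (t : ℝ) • (‖a.1.down‖⁻¹ • a.1.down)‖ = 1
      rw [ha', inv_one, one_smul, ← add_smul, sub_add_cancel, one_smul]
      exact ha'
    · change ‖‖a.1.down‖⁻¹ • a.1.down‖ = 1
      rw [norm_smul, norm_inv, norm_norm, inv_mul_cancel₀ (hpos a).ne']
  obtain ⟨e2⟩ := (relIso_of_relAcyclic_left hSD (Set.subset_univ _) hD m).nonempty_addEquiv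
  obtain ⟨e3⟩ := (relIso_of_relAcyclic_right hSW (Set.subset_univ _) hW m).nonempty_addEquiv
  exact ⟨e1.trans (e2.trans e3)⟩

instance : ContractibleSpace (Euc.{u} n) :=
  Homeomorph.ulift.contractibleSpace

/-- The homology of the `n`-ball relative to its boundary vanishes in degrees other than `n`. -/
theorem relCycles_disk_le {n m : ℕ} (h : m ≠ n) :
    relCycles Set.univ (diskSphere.{u} n) m ≤ relBoundaries Set.univ (diskSphere n) m := by
  obtain ⟨e⟩ := nonempty_relHomology_disk.{u} n m
  obtain ⟨h1, h2⟩ := relHomology_nonzeroSet.{u} (le_refl n)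
  have : Subsingleton (RelHomology Set.univ (nonzeroSet.{u} n n) m) := by
    rcases lt_or_gt_of_ne h with h | h
    · exact h1 m h
    · obtain ⟨k, rfl⟩ := Nat.exists_eq_add_of_lt h
      obtain ⟨e⟩ := h2 (k + 1)
      have e' : n + k + 1 = k + 1 + n := by omega
      rw [e']
      have := subsingleton_relHomology (relCycles_univ_empty_le (X := Euc.{u} n) k.succ_ne_zero)
      exact e.toEquiv.subsingleton
  have := e.toEquiv.subsingleton
  exact relCycles_le_relBoundaries

/-- The relative homology group `H_n(D^n, S^{n-1})` is infinite cyclic. In degree `0` the generator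
is normalized to have augmentation `1`. -/
theorem exists_fundamentalCycle (n : ℕ) : ∃ ι ∈ relCycles Set.univ (diskSphere.{u} n) n,
    (∀ z ∈ relCycles Set.univ (diskSphere.{u} n) n, ∃ k : ℤ,
      z - k • ι ∈ relBoundaries Set.univ (diskSphere n) n) ∧
    (∀ k : ℤ, k • ι ∈ relBoundaries Set.univ (diskSphere n) n → k = 0) ∧
    (n = 0 → augmentation (Disk.{u} n) n ι = 1) := by
  have ex : ∃ ι ∈ relCycles Set.univ (diskSphere.{u} n) n,
      (∀ z ∈ relCycles Set.univ (diskSphere.{u} n) n, ∃ k : ℤ,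
        z - k • ι ∈ relBoundaries Set.univ (diskSphere n) n) ∧
      (∀ k : ℤ, k • ι ∈ relBoundaries Set.univ (diskSphere n) n → k = 0) := by
    obtain ⟨e1⟩ := nonempty_relHomology_disk.{u} n n
    obtain ⟨e2⟩ := (relHomology_nonzeroSet.{u} (le_refl n)).2 0
    rw [zero_add] at e2
    obtain ⟨e3⟩ := nonempty_relHomology_zero_equiv (X := Euc.{u} n)
    let e := e1.trans (e2.trans e3)
    obtain ⟨⟨ι, hι⟩, he⟩ := QuotientAddGroup.mk_surjective (e.symm 1)
    have mem_iff : ∀ z (hz : z ∈ relCycles Set.univ (diskSphere.{u} n) n),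
        z ∈ relBoundaries Set.univ (diskSphere n) n ↔ e (relClass _ _ n ⟨z, hz⟩) = 0 := by
      intro z hz
      rw [map_eq_zero_iff e e.injective]
      exact (QuotientAddGroup.eq_zero_iff (N := (relBoundaries Set.univ (diskSphere.{u} n)
        n).addSubgroupOf _) (⟨z, hz⟩ : relCycles Set.univ (diskSphere.{u} n) n)).symm
    have hk : ∀ k : ℤ, e (relClass _ _ n (k • ⟨ι, hι⟩)) = k := fun k => by
      rw [map_zsmul, map_zsmul]
      change k • e (QuotientAddGroup.mk _) = k
      rw [he, e.apply_symm_apply, smul_eq_mul, mul_one]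
    refine ⟨ι, hι, fun z hz => ⟨e (relClass _ _ n ⟨z, hz⟩), ?_⟩, fun k hkι => ?_⟩
    · rw [mem_iff _ (sub_mem hz (zsmul_mem hι _))]
      have : (⟨_, sub_mem hz (zsmul_mem hι (e (relClass _ _ n ⟨z, hz⟩)))⟩ :
          relCycles Set.univ (diskSphere.{u} n) n) =
          ⟨z, hz⟩ - e (relClass _ _ n ⟨z, hz⟩) • ⟨ι, hι⟩ := rfl
      rw [this, map_sub, map_sub, hk, sub_self]
    · rw [← hk k]
      exact (mem_iff _ (zsmul_mem hι k)).1 hkι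
  obtain ⟨ι, hι, h1, h2⟩ := ex
  -- in degree `0` a generator has augmentation `1` or `-1`; correct it by this sign
  by_cases hn : n = 0
  · subst hn
    have hS : diskSphere.{u} 0 = ∅ := Set.eq_empty_iff_forall_notMem.2 fun x hx => by
      have := mem_diskSphere.1 hx
      rw [diskNorm, Subsingleton.elim (x.down : Fin 0 → ℝ) 0, norm_zero] at this
      exact zero_ne_one this
    obtain ⟨k, hk⟩ := h1 (single (ContinuousMap.const _ ⟨⟨0, by simp⟩⟩))
      (mem_relCycles_zero.2 (mem_chainsIn_univ _))
    rw [hS] at hk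
    have hk' := augmentation_eq_zero_of_mem_relBoundaries hk
    rw [map_sub, map_zsmul, augmentation_single, sub_eq_zero, smul_eq_mul] at hk'
    have hkk : k * k = 1 := by
      rcases Int.eq_one_or_neg_one_of_mul_eq_one hk'.symm with rfl | rfl <;> rfl
    refine ⟨k • ι, zsmul_mem hι k, fun z hz => ?_, fun l hl => ?_, fun _ => ?_⟩
    · obtain ⟨l, hl⟩ := h1 z hz
      refine ⟨l * k, ?_⟩
      rwa [smul_smul, mul_assoc, hkk, mul_one]
    · rw [smul_smul] at hl
      have h0 := h2 _ hl
      calc l = l * k * k := by rw [mul_assoc, hkk, mul_one]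
        _ = 0 := by rw [h0, zero_mul]
    · rw [map_zsmul, smul_eq_mul, ← hk']
  · exact ⟨ι, hι, h1, h2, fun h => absurd h hn⟩

end

section
variable {X : Type u} [TopologicalSpace X] {n : ℕ} {J : Type*}

/-- A relative cycle whose class generates `H_n(D^n, S^{n-1})`. -/
def fundamentalCycle (n : ℕ) : SingularChains (Disk.{u} n) n :=
  (exists_fundamentalCycle n).choose

theorem fundamentalCycle_mem (n : ℕ) :
    fundamentalCycle.{u} n ∈ relCycles Set.univ (diskSphere n) n :=
  (exists_fundamentalCycle n).choose_spec.1

theorem exists_sub_zsmul_fundamentalCycle_mem {z : SingularChains (Disk.{u} n) n}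
    (hz : z ∈ relCycles Set.univ (diskSphere n) n) :
    ∃ k : ℤ, z - k • fundamentalCycle n ∈ relBoundaries Set.univ (diskSphere n) n :=
  (exists_fundamentalCycle n).choose_spec.2.1 z hz

theorem eq_zero_of_zsmul_fundamentalCycle_mem {k : ℤ}
    (h : k • fundamentalCycle.{u} n ∈ relBoundaries Set.univ (diskSphere n) n) : k = 0 :=
  (exists_fundamentalCycle n).choose_spec.2.2.1 k h

theorem augmentation_fundamentalCycle :
    augmentation (Disk.{u} 0) 0 (fundamentalCycle 0) = 1 :=
  (exists_fundamentalCycle 0).choose_spec.2.2.2 rfl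

/-- The linear combination of the images of the fundamental cycle under characteristic maps. -/
def cellSum (Φ : J → C(Disk.{u} n, X)) : (J →₀ ℤ) →+ SingularChains X n :=
  Finsupp.liftAddHom fun j => zmultiplesHom _ (singularMap (Φ j) n (fundamentalCycle n))

theorem cellSum_single (Φ : J → C(Disk.{u} n, X)) (j : J) (k : ℤ) :
    cellSum Φ (Finsupp.single j k) = k • singularMap (Φ j) n (fundamentalCycle n) := by
  simp [cellSum]

theorem cellSum_apply (Φ : J → C(Disk.{u} n, X)) (k : J →₀ ℤ) :
    cellSum Φ k = ∑ j ∈ k.support, singularMap (Φ j) n (k j • fundamentalCycle n) := by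
  simp [cellSum, Finsupp.sum]

namespace IsAttaching
variable {A B : Set X} {Φ : J → C(Disk.{u} n, X)} (h : IsAttaching A B Φ)
include h

/-- The homology of a pair obtained by attaching `n`-cells is concentrated in degree `n`. -/
theorem relCycles_le [T2Space X] {m : ℕ} (hm : m ≠ n) : relCycles A B m ≤ relBoundaries A B m := by
  intro z hz
  obtain ⟨s, y, hy, hzy⟩ := h.exists_sub_sum_mem hz
  rw [← sub_add_cancel z (∑ j ∈ s, singularMap (Φ j) m (y j))]
  exact add_mem hzy (sum_mem fun j _ => singularMap_mem_relBoundaries (fun x _ => h.mem j x)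
    (fun x hx => (h.mem_iff j x).2 hx) (relCycles_disk_le hm (hy j)))

theorem singularMap_mem {m : ℕ} (j : J) {z : SingularChains (Disk.{u} n) m}
    (hz : z ∈ relCycles Set.univ (diskSphere n) m) : singularMap (Φ j) m z ∈ relCycles A B m :=
  singularMap_mem_relCycles (fun x _ => h.mem j x) (fun x hx => (h.mem_iff j x).2 hx) hz

theorem cellSum_mem (k : J →₀ ℤ) : cellSum Φ k ∈ relCycles A B n := by
  rw [cellSum_apply]
  exact sum_mem fun j _ => h.singularMap_mem j (zsmul_mem (fundamentalCycle_mem n) _)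

/-- The images of the fundamental cycle generate `H_n(A, B)`. -/
theorem exists_sub_cellSum_mem [T2Space X] {z : SingularChains X n} (hz : z ∈ relCycles A B n) :
    ∃ k : J →₀ ℤ, z - cellSum Φ k ∈ relBoundaries A B n := by
  obtain ⟨s, y, hy, hzy⟩ := h.exists_sub_sum_mem hz
  choose k hk using fun j => exists_sub_zsmul_fundamentalCycle_mem (hy j)
  refine ⟨∑ j ∈ s, Finsupp.single j (k j), ?_⟩
  have : z - cellSum Φ (∑ j ∈ s, Finsupp.single j (k j)) =
      (z - ∑ j ∈ s, singularMap (Φ j) n (y j)) +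
        ∑ j ∈ s, singularMap (Φ j) n (y j - k j • fundamentalCycle n) := by
    simp only [map_sum, cellSum_single, map_sub, map_zsmul, Finset.sum_sub_distrib]
    abel
  rw [this]
  exact add_mem hzy (sum_mem fun j _ => singularMap_mem_relBoundaries (fun x _ => h.mem j x)
    (fun x hx => (h.mem_iff j x).2 hx) (hk j))

/-- The images of the fundamental cycle are linearly independent in `H_n(A, B)`. -/
theorem eq_zero_of_cellSum_mem [T2Space X] {k : J →₀ ℤ} (hk : cellSum Φ k ∈ relBoundaries A B n) :
    k = 0 := by
  rw [cellSum_apply] at hk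
  by_contra hne
  obtain ⟨j, hj⟩ := Finsupp.support_nonempty_iff.2 hne
  have := h.mem_relBoundaries_of_sum_mem (fun j => zsmul_mem (fundamentalCycle_mem n) (k j)) hk hj
  exact Finsupp.mem_support_iff.1 hj (eq_zero_of_zsmul_fundamentalCycle_mem this)

/-- The classes of the images of the fundamental cycle form a basis of `H_n(A, B)`. -/
def basisEquiv [T2Space X] : (J →₀ ℤ) ≃+ RelHomology A B n :=
  AddEquiv.ofBijective
    ((relClass A B n).comp ((cellSum Φ).codRestrict (relCycles A B n) h.cellSum_mem)) <| by
    refine ⟨(injective_iff_map_eq_zero _).2 fun k hk => ?_, fun y => ?_⟩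
    · exact h.eq_zero_of_cellSum_mem ((QuotientAddGroup.eq_zero_iff
        (N := (relBoundaries A B n).addSubgroupOf _)
        (⟨cellSum Φ k, h.cellSum_mem k⟩ : relCycles A B n)).1 hk)
    · obtain ⟨⟨z, hz⟩, rfl⟩ := QuotientAddGroup.mk_surjective y
      obtain ⟨k, hk⟩ := h.exists_sub_cellSum_mem hz
      refine ⟨k, QuotientAddGroup.eq.2 ?_⟩
      rw [AddSubgroup.mem_addSubgroupOf]
      convert hk using 1
      exact neg_add_eq_sub _ _

end IsAttaching

theorem relClass_eq_iff {A B : Set X} {z w : relCycles A B n} :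
    relClass A B n z = relClass A B n w ↔ (z : SingularChains X n) - w ∈ relBoundaries A B n := by
  rw [← sub_eq_zero, ← map_sub]
  exact QuotientAddGroup.eq_zero_iff (N := (relBoundaries A B n).addSubgroupOf _) (z - w)

/-! ### Filtrations with homology concentrated in one degree -/

section Filtration

variable {A B B' : Set X}

theorem relCycles_le_of_triple (hB : B' ⊆ B) (hA : B ⊆ A)
    (h1 : relCycles A B n ≤ relBoundaries A B n) (h2 : relCycles B B' n ≤ relBoundaries B B' n) :
    relCycles A B' n ≤ relBoundaries A B' n := by
  intro z hz
  obtain ⟨w, hw, hzw⟩ := exists_relCycles_sub_mem hz (h1 (relCycles_mono subset_rfl hB n hz))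
  rw [← sub_add_cancel z w]
  exact add_mem hzw (relBoundaries_mono hA subset_rfl n (h2 hw))

theorem exists_boundary_eq_of_mem_chainsIn [ContractibleSpace A] {c : SingularChains X n}
    (hc : c ∈ chainsIn A n) (h : boundary X n (n - 1) c = 0)
    (h0 : n = 0 → augmentation X n c = 0) :
    ∃ b ∈ chainsIn A (n + 1), boundary X (n + 1) n b = c := by
  obtain ⟨c, rfl⟩ := hc
  obtain ⟨b, rfl⟩ := exists_boundary_eq_of_contractible (c := c) (by
    rw [boundary_singularMap] at h
    exact singularMap_injective Subtype.val_injective _ (h.trans (map_zero _).symm))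
    (fun hn => by simpa using h0 hn)
  exact ⟨_, ⟨b, rfl⟩, boundary_singularMap _ _ _ _⟩

variable {S : ℕ → Set X} (hS : Monotone S)
  (hacyc : ∀ n m, m ≠ n → relCycles (S (n + 1)) (S n) m ≤ relBoundaries (S (n + 1)) (S n) m)
include hS hacyc

/-- If `H(S (n + 1), S n)` is concentrated in degree `n` for all `n`, then `H(S k, S l)` is
concentrated in the degrees from `l` to `k - 1`. -/
theorem relCycles_filtration_le {k l m : ℕ} (hlk : l ≤ k) (hm : k ≤ m ∨ m < l) :
    relCycles (S k) (S l) m ≤ relBoundaries (S k) (S l) m := by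
  induction k, hlk using Nat.le_induction with
  | base => exact fun z hz => mem_relBoundaries_of_mem_chainsIn hz.1
  | succ k hlk ih =>
    exact relCycles_le_of_triple (hS hlk) (hS k.le_succ)
      (hacyc k m (by omega)) (ih (by omega))

variable {C : Set X} [ContractibleSpace C] {D : ℕ} (hC : ∀ k, D ≤ k → S k = C)
  (h0 : S 0 = ∅)
include hC

/-- A cycle in `S (n + 1)` of degree `n` bounds in the contractible space `C`, and the bounding
chain can be moved into `S (n + 2)`, because `H_{n+1}(C, S (n + 2)) = 0`. -/
theorem exists_relCycles_boundary_eq {z : SingularChains X n} (hz : z ∈ chainsIn (S (n + 1)) n)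
    (hbd : boundary X n (n - 1) z = 0) (haug : n = 0 → augmentation X n z = 0) :
    ∃ y ∈ relCycles (S (n + 2)) (S (n + 1)) (n + 1), boundary X (n + 1) n y = z := by
  have hSC : ∀ k, S k ⊆ C := fun k =>
    (hS (le_max_right D k)).trans (hC _ (le_max_left D k)).le
  obtain ⟨y, hy, rfl⟩ := exists_boundary_eq_of_mem_chainsIn
    (chainsIn_mono (hSC _) n hz) hbd haug
  rw [← hC _ (le_max_left D (n + 2))] at hy
  obtain ⟨b, hb, a, -, rfl⟩ := mem_relBoundaries.1 (relCycles_filtration_le hS hacyc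
    (le_max_right D (n + 2)) (Or.inr (by omega : n + 1 < n + 2))
    (mem_relCycles_succ.2 ⟨hy, chainsIn_mono (hS (Nat.le_succ _)) n hz⟩))
  rw [map_add, boundary_boundary, add_zero] at hz ⊢
  exact ⟨b, mem_relCycles_succ.2 ⟨hb, hz⟩, rfl⟩

include h0

/-- Exactness of the complex of the groups `H_n(S (n + 1), S n)` in positive degrees. A relative
cycle with trivial boundary class is corrected first by `S n`, then by `S 0 = ∅`, to become an
absolute cycle, which bounds by contractibility. -/
theorem exists_boundary_sub_mem {z : SingularChains X (n + 1)}
    (hz : z ∈ relCycles (S (n + 2)) (S (n + 1)) (n + 1))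
    (hbd : boundary X (n + 1) n z ∈ relBoundaries (S (n + 1)) (S n) n) :
    ∃ y ∈ relCycles (S (n + 3)) (S (n + 2)) (n + 2),
      z - boundary X (n + 2) (n + 1) y ∈ relBoundaries (S (n + 2)) (S (n + 1)) (n + 1) := by
  -- make the boundary of the cycle lie in `S n`
  obtain ⟨z', hz', hzz'⟩ := exists_relCycles_of_boundary_mem (hS (Nat.le_succ _)) hz hbd
  have hle : n ≤ n + 2 := by omega
  -- make the boundary of the cycle lie in `S 0 = ∅`, using that `H_n(S n, S 0) = 0`
  obtain ⟨z'', hz'', hzz''⟩ := exists_relCycles_of_boundary_mem (hS hle) hz'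
    (relCycles_filtration_le hS hacyc (Nat.zero_le n) (Or.inl le_rfl)
      (boundary_mem_relCycles (C := S 0) hz'))
  have hz0 : boundary X (n + 1) n z'' = 0 := eq_zero_of_mem_chainsIn_empty
    (h0 ▸ (mem_relCycles_succ.1 hz'').2)
  obtain ⟨y, hy, rfl⟩ := exists_relCycles_boundary_eq hS hacyc hC hz''.1 hz0
    (fun h => absurd h n.succ_ne_zero)
  refine ⟨y, hy, ?_⟩
  rw [← sub_add_sub_cancel z z']
  exact add_mem hzz' (relBoundaries_mono subset_rfl (hS n.le_succ) _ hzz'')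

end Filtration

/-! ### The cellular chain complex in terms of the cells -/

section Cells

open RelCWComplex

variable [T2Space X] {C : Set X} [CWComplex C]

/-- `f` is a characteristic map of the cell `e`. -/
structure IsCharMap (e : cell C n) (f : C(Disk.{u} n, X)) : Prop where
  mem_openCell : ∀ x, x ∉ diskSphere n → f x ∈ openCell n e
  mem_cellFrontier : ∀ x, x ∈ diskSphere n → f x ∈ cellFrontier n e
  inj : ∀ x y, x ∉ diskSphere n → y ∉ diskSphere n → f x = f y → x = y
  surj : openCell n e ⊆ Set.range f

theorem isCharMap_charMap (e : cell C n) : IsCharMap e (charMap C n e) := by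
  have mem_ball : ∀ x : Disk.{u} n, x ∉ diskSphere n →
      (x.down : Fin n → ℝ) ∈ Metric.ball (0 : Fin n → ℝ) 1 := fun x hx =>
    mem_ball_zero_iff.2 ((diskNorm_le x).lt_of_ne fun h => hx (mem_diskSphere.2 h))
  refine ⟨fun x hx => ⟨_, mem_ball x hx, rfl⟩, fun x hx => ⟨_, hx, rfl⟩,
    fun x y hx hy hxy => ?_, ?_⟩
  · refine ULift.ext _ _ (Subtype.ext ((map n e).injOn ?_ ?_ hxy))
    · rw [source_eq]
      exact mem_ball x hx
    · rw [source_eq]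
      exact mem_ball y hy
  · rintro _ ⟨x, hx, rfl⟩
    exact ⟨⟨⟨x, Metric.ball_subset_closedBall hx⟩⟩, rfl⟩

/-- The union of the closed cells of dimension less than `n`. -/
abbrev skel (C : Set X) [CWComplex C] (n : ℕ) : Set X := (skeletonLT C (n : ℕ∞) : Set X)

theorem skel_mono : Monotone (skel C) := fun _ _ h =>
  skeletonLT_mono (Nat.cast_le.2 h)

theorem skel_zero : skel C 0 = ∅ := CWComplex.skeletonLT_zero_eq_empty

theorem mem_skel {x : X} : x ∈ skel C n ↔ ∃ m < n, ∃ j : cell C m, x ∈ openCell m j := by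
  simp [skel, ← CWComplex.iUnion_openCell_eq_skeletonLT]

theorem notMem_skel_of_mem_openCell {e : cell C n} {x : X} (hx : x ∈ openCell n e) :
    x ∉ skel C n := fun h =>
  Set.disjoint_left.1 (disjoint_skeletonLT_openCell (m := n) (n := (n : ℕ∞)) (j := e) le_rfl) h hx

theorem skel_eq_of_isEmpty {D : ℕ} (hD : ∀ m, D ≤ m → IsEmpty (cell C m)) {k : ℕ} (hk : D ≤ k) :
    skel C k = C := by
  refine Set.Subset.antisymm (skeletonLT C _).subset_complex fun x hx => ?_
  rw [← CWComplex.iUnion_openCell_eq_complex (C := C)] at hx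
  obtain ⟨m, j, hxj⟩ : ∃ m, ∃ j : cell C m, x ∈ openCell m j := by simpa using hx
  refine mem_skel.2 ⟨m, ?_, j, hxj⟩
  by_contra hm
  exact (hD m (by omega)).false j

namespace IsCharMap
variable {e : cell C n} {f : C(Disk.{u} n, X)} (h : IsCharMap e f)
include h

theorem mem_closedCell (x : Disk.{u} n) : f x ∈ closedCell n e := by
  by_cases hx : x ∈ diskSphere n
  · exact cellFrontier_subset_closedCell n e (h.mem_cellFrontier x hx)
  · exact openCell_subset_closedCell n e (h.mem_openCell x hx)

theorem mem_skel_iff (x : Disk.{u} n) : f x ∈ skel C n ↔ x ∈ diskSphere n := by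
  refine ⟨fun hs => ?_, fun hx => cellFrontier_subset_skeletonLT n e (h.mem_cellFrontier x hx)⟩
  by_contra hx
  exact notMem_skel_of_mem_openCell (h.mem_openCell x hx) hs

/-- Attaching a single cell to the skeleton. -/
theorem isAttaching_single : IsAttaching (skel C n ∪ closedCell n e) (skel C n)
    (fun _ : Unit => f) where
  isClosed := (skeletonLT C _).closed
  subset := Set.subset_union_left
  mem _ x := Or.inr (h.mem_closedCell x)
  mem_iff _ x := h.mem_skel_iff x
  eq_of_eq _ _ x y hx hxy := by
    refine ⟨rfl, h.inj x y hx (fun hy => hx ?_) hxy⟩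
    rw [← h.mem_skel_iff] at hy ⊢
    rwa [hxy]
  cover a ha hB := by
    rcases ha with ha | ha
    · exact absurd ha hB
    · rw [← cellFrontier_union_openCell_eq_closedCell] at ha
      rcases ha with ha | ha
      · exact absurd (cellFrontier_subset_skeletonLT n e ha) hB
      · obtain ⟨x, hx⟩ := h.surj ha
        exact ⟨(), x, hx⟩
  coherent Z hZ h1 h2 := by
    have : Z = Z ∩ skel C n ∪ f '' (f ⁻¹' Z) := by
      refine Set.Subset.antisymm (fun a ha => ?_)
        (Set.union_subset Set.inter_subset_left (Set.image_preimage_subset _ _))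
      by_cases hB : a ∈ skel C n
      · exact Or.inl ⟨ha, hB⟩
      · rcases hZ ha with h' | h'
        · exact absurd h' hB
        · rw [← cellFrontier_union_openCell_eq_closedCell] at h'
          rcases h' with h' | h'
          · exact absurd (cellFrontier_subset_skeletonLT n e h') hB
          · obtain ⟨x, rfl⟩ := h.surj h'
            exact Or.inr ⟨x, ha, rfl⟩
    rw [this]
    exact h1.union ((h2 ()).isCompact.image f.continuous).isClosed

end IsCharMap

/-- Each skeleton arises from the previous one by attaching all cells of one dimension. -/
theorem isAttaching_skeleton {Ψ : cell C n → C(Disk.{u} n, X)} (h : ∀ e, IsCharMap e (Ψ e)) :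
    IsAttaching (skel C (n + 1)) (skel C n) Ψ where
  isClosed := (skeletonLT C _).closed
  subset := skel_mono n.le_succ
  mem e x := closedCell_subset_skeletonLT n e ((h e).mem_closedCell x)
  mem_iff e x := (h e).mem_skel_iff x
  eq_of_eq i j x y hx hxy := by
    have hy : y ∉ diskSphere n := by
      rw [← (h i).mem_skel_iff, hxy, (h j).mem_skel_iff] at hx
      exact hx
    obtain rfl : i = j := by
      have := eq_of_not_disjoint_openCell (Set.not_disjoint_iff.2
        ⟨_, (h i).mem_openCell x hx, hxy ▸ (h j).mem_openCell y hy⟩)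
      simpa using this
    exact ⟨rfl, (h i).inj x y hx hy hxy⟩
  cover a ha hB := by
    obtain ⟨m, hm, e, he⟩ := mem_skel.1 ha
    rcases Nat.lt_succ_iff_lt_or_eq.1 hm with h' | rfl
    · exact absurd (mem_skel.2 ⟨m, h', e, he⟩) hB
    · exact ⟨e, (h e).surj he⟩
  coherent Z hZ h1 h2 := by
    refine CWComplex.isClosed_of_disjoint_openCell_or_isClosed_inter_closedCell
      (hZ.trans (skeletonLT C _).subset_complex) fun m _ j => ?_
    rcases lt_trichotomy m n with hm | rfl | hm
    · right
      have : Z ∩ closedCell m j = Z ∩ skel C n ∩ closedCell m j := by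
        rw [Set.inter_assoc, Set.inter_eq_right.2
          ((closedCell_subset_skeletonLT m j).trans (skel_mono hm))]
      rw [this]
      exact h1.inter isClosed_closedCell
    · right
      have : Z ∩ closedCell m j = (Z ∩ skel C m ∩ closedCell m j) ∪ Ψ j '' (Ψ j ⁻¹' Z) := by
        refine Set.Subset.antisymm (fun a ha => ?_) (Set.union_subset
          (Set.inter_subset_inter_left _ Set.inter_subset_left) ?_)
        · have h' := ha.2
          rw [← cellFrontier_union_openCell_eq_closedCell] at h'
          rcases h' with h' | h'
          · exact Or.inl ⟨⟨ha.1, cellFrontier_subset_skeletonLT m j h'⟩, ha.2⟩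
          · obtain ⟨x, rfl⟩ := (h j).surj h'
            exact Or.inr ⟨x, ha.1, rfl⟩
        · rintro _ ⟨x, hx, rfl⟩
          exact ⟨hx, (h j).mem_closedCell x⟩
      rw [this]
      exact (h1.inter isClosed_closedCell).union ((h2 j).isCompact.image (Ψ j).continuous).isClosed
    · left
      refine Set.disjoint_left.2 fun a ha haj => ?_
      exact notMem_skel_of_mem_openCell haj (skel_mono hm (hZ ha))

end Cells
end

section
open RelCWComplex

variable {X : Type u} [TopologicalSpace X] [T2Space X] {n : ℕ}
variable {C : Set X} [CWComplex C] {Ψ : ∀ n, cell C n → C(Disk.{u} n, X)}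
  (hΨ : ∀ n e, IsCharMap e (Ψ n e))

/-- The cellular chain group is free on the cells. -/
def cellEquiv (n : ℕ) : (cell C n →₀ ℤ) ≃+ CellularChains C n :=
  (isAttaching_skeleton (hΨ n)).basisEquiv

include hΨ in
theorem cellSum_mem_relCycles (k : cell C n →₀ ℤ) :
    cellSum (Ψ n) k ∈ relCycles (skel C (n + 1)) (skel C n) n :=
  (isAttaching_skeleton (hΨ n)).cellSum_mem k

theorem cellEquiv_apply (k : cell C n →₀ ℤ) :
    cellEquiv hΨ n k = relClass _ _ n ⟨cellSum (Ψ n) k, cellSum_mem_relCycles hΨ k⟩ := rfl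

/-- Equality of a combination of cells and a relative homology class, on the level of cycles. -/
theorem cellEquiv_eq_iff {k : cell C n →₀ ℤ}
    {z : relCycles (skel C (n + 1)) (skel C n) n} :
    cellEquiv hΨ n k = relClass _ _ n z ↔
      cellSum (Ψ n) k - z ∈ relBoundaries (skel C (n + 1)) (skel C n) n := by
  rw [cellEquiv_apply, relClass_eq_iff]

/-- The cellular boundary operator in terms of the bases given by the cells. -/
def cellBoundary (n : ℕ) : (cell C (n + 1) →₀ ℤ) →+ (cell C n →₀ ℤ) :=
  (cellEquiv hΨ n).symm.toAddMonoidHom.comp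
    ((cellularBoundary C n).comp (cellEquiv hΨ (n + 1)).toAddMonoidHom)

theorem cellEquiv_cellBoundary (k : cell C (n + 1) →₀ ℤ) :
    cellEquiv hΨ n (cellBoundary hΨ n k) = cellularBoundary C n (cellEquiv hΨ (n + 1) k) :=
  (cellEquiv hΨ n).apply_symm_apply _

/-- The boundary of a combination of cells, on the level of cycles. -/
theorem cellBoundary_eq_iff {k : cell C (n + 1) →₀ ℤ} {l : cell C n →₀ ℤ} :
    cellBoundary hΨ n k = l ↔ cellSum (Ψ n) l - boundary X (n + 1) n (cellSum (Ψ (n + 1)) k) ∈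
      relBoundaries (skel C (n + 1)) (skel C n) n := by
  rw [← (cellEquiv hΨ n).injective.eq_iff, cellEquiv_cellBoundary, eq_comm]
  exact cellEquiv_eq_iff hΨ (z := relCyclesBoundary _ _ _ n
    ⟨cellSum (Ψ (n + 1)) k, cellSum_mem_relCycles hΨ k⟩)

theorem cellBoundary_cellBoundary (k : cell C (n + 2) →₀ ℤ) :
    cellBoundary hΨ n (cellBoundary hΨ (n + 1) k) = 0 := by
  rw [cellBoundary_eq_iff, map_zero, zero_sub, neg_mem_iff]
  obtain ⟨b, hb, a, -, e⟩ := mem_relBoundaries.1 ((cellBoundary_eq_iff hΨ (k := k)).1 rfl)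
  rw [sub_eq_iff_eq_add.1 e, map_add, map_add, boundary_boundary, boundary_boundary, add_zero,
    add_zero]
  exact boundary_mem_relBoundaries hb

theorem sum_cellBoundary (k : cell C 1 →₀ ℤ) :
    (cellBoundary hΨ 0 k).sum (fun _ a => a) = 0 := by
  have aug : ∀ k : cell C 0 →₀ ℤ, augmentation X 0 (cellSum (Ψ 0) k) = k.sum (fun _ a => a) := by
    intro k
    rw [cellSum_apply, map_sum]
    simp [augmentation_fundamentalCycle, Finsupp.sum]
  have h := (cellBoundary_eq_iff hΨ (k := k)).1 rfl
  rw [skel_zero] at h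
  have := augmentation_eq_zero_of_mem_relBoundaries h
  rwa [map_sub, augmentation_boundary, sub_zero, aug] at this

section Exactness

variable [ContractibleSpace C] {D : ℕ} (hD : ∀ m, D ≤ m → IsEmpty (cell C m))
include hD

theorem exists_cellBoundary_eq_of_cycle {k : cell C n →₀ ℤ}
    {y : SingularChains X (n + 1)} (hy : y ∈ relCycles (skel C (n + 2)) (skel C (n + 1)) (n + 1))
    (h : cellSum (Ψ n) k - boundary X (n + 1) n y ∈ relBoundaries (skel C (n + 1)) (skel C n) n) :
    ∃ l, cellBoundary hΨ n l = k := by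
  obtain ⟨l, hl⟩ := (isAttaching_skeleton (hΨ (n + 1))).exists_sub_cellSum_mem hy
  refine ⟨l, (cellBoundary_eq_iff hΨ).2 ?_⟩
  obtain ⟨b, hb, a, -, e⟩ := mem_relBoundaries.1 hl
  have : cellSum (Ψ n) k - boundary X (n + 1) n (cellSum (Ψ (n + 1)) l) =
      (cellSum (Ψ n) k - boundary X (n + 1) n y) + boundary X (n + 1) n b := by
    rw [← sub_add_cancel y (cellSum (Ψ (n + 1)) l), e, map_add, map_add, boundary_boundary]
    abel
  rw [this]
  exact add_mem h (boundary_mem_relBoundaries hb)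

/-- The cellular chain complex of a finite-dimensional contractible complex is exact. -/
theorem exists_cellBoundary_eq {k : cell C (n + 1) →₀ ℤ} (hk : cellBoundary hΨ n k = 0) :
    ∃ l, cellBoundary hΨ (n + 1) l = k := by
  have h := (cellBoundary_eq_iff hΨ).1 hk
  rw [map_zero, zero_sub, neg_mem_iff] at h
  obtain ⟨y, hy, hky⟩ := exists_boundary_sub_mem skel_mono
    (fun n m hm => (isAttaching_skeleton (hΨ n)).relCycles_le hm)
    (fun k hk => skel_eq_of_isEmpty hD hk) skel_zero (cellSum_mem_relCycles hΨ k) h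
  exact exists_cellBoundary_eq_of_cycle hΨ hD hy hky

/-- Exactness of the augmented cellular chain complex of a finite-dimensional contractible complex
in degree zero. -/
theorem exists_cellBoundary_eq_zero {k : cell C 0 →₀ ℤ} (hk : k.sum (fun _ a => a) = 0) :
    ∃ l, cellBoundary hΨ 0 l = k := by
  have aug : augmentation X 0 (cellSum (Ψ 0) k) = 0 := by
    rw [cellSum_apply, map_sum, ← hk]
    simp [augmentation_fundamentalCycle, Finsupp.sum]
  obtain ⟨y, hy, e⟩ := exists_relCycles_boundary_eq skel_mono
    (fun n m hm => (isAttaching_skeleton (hΨ n)).relCycles_le hm)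
    (fun k hk => skel_eq_of_isEmpty hD hk) (cellSum_mem_relCycles hΨ k).1
    (boundary_zero_zero _) (fun _ => aug)
  refine exists_cellBoundary_eq_of_cycle hΨ hD hy ?_
  rw [e, sub_self]
  exact AddSubgroup.zero_mem _

end Exactness

section Naturality

variable {C' : Set X} [CWComplex C'] {Ψ' : ∀ n, cell C' n → C(Disk.{u} n, X)}
  (hΨ' : ∀ n e, IsCharMap e (Ψ' n e)) (f : C(X, X)) (φ : ∀ n, cell C n → cell C' n)
  (hf : ∀ n e, f.comp (Ψ n e) = Ψ' n (φ n e)) (hsk : ∀ n, Set.MapsTo f (skel C n) (skel C' n))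

include hf in
theorem singularMap_cellSum (k : cell C n →₀ ℤ) :
    singularMap f n (cellSum (Ψ n) k) = cellSum (Ψ' n) (k.mapDomain (φ n)) := by
  have : (singularMap f n).comp (cellSum (Ψ n)) =
      (cellSum (Ψ' n)).comp (Finsupp.mapDomain.addMonoidHom (φ n)) := by
    refine Finsupp.addHom_ext fun e a => ?_
    simp [cellSum_single, ← hf, singularMap_comp]
  exact DFunLike.congr_fun this k

include hf hsk in
/-- A cellular map that is compatible with chosen characteristic maps acts on the cellular chain
complex by permuting the basis elements. -/
theorem cellBoundary_mapDomain (k : cell C (n + 1) →₀ ℤ) :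
    cellBoundary hΨ' n (k.mapDomain (φ (n + 1))) = (cellBoundary hΨ n k).mapDomain (φ n) := by
  rw [cellBoundary_eq_iff, ← singularMap_cellSum f φ hf, ← singularMap_cellSum f φ hf,
    boundary_singularMap, ← map_sub]
  exact singularMap_mem_relBoundaries (hsk _) (hsk _) ((cellBoundary_eq_iff hΨ).1 rfl)

end Naturality

/-! ### Cellular cochains in terms of the cells -/

/-- Two characteristic maps of the same cell give proportional classes in cellular homology. -/
theorem exists_singularMap_sub_mem {e : cell C n} {f f' : C(Disk.{u} n, X)} (hf : IsCharMap e f)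
    (hf' : IsCharMap e f') {z : SingularChains (Disk.{u} n) n}
    (hz : z ∈ relCycles Set.univ (diskSphere n) n) :
    ∃ k : ℤ, singularMap f n z - k • singularMap f' n (fundamentalCycle n) ∈
      relBoundaries (skel C (n + 1)) (skel C n) n := by
  obtain ⟨k, hk⟩ := hf'.isAttaching_single.exists_sub_cellSum_mem
    (hf.isAttaching_single.singularMap_mem () hz)
  refine ⟨k (), relBoundaries_mono (Set.union_subset (skel_mono n.le_succ)
    (closedCell_subset_skeletonLT n e)) subset_rfl n ?_⟩
  rw [Finsupp.unique_single k, cellSum_single] at hk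
  exact hk

/-- A cochain vanishes on a cell if and only if it vanishes on the basis element of this cell, for
any choice of characteristic maps. -/
theorem vanishesOnCell_iff {f : CellularCochains C n} {e : cell C n} :
    VanishesOnCell f e ↔ f (cellEquiv hΨ n (Finsupp.single e 1)) = 0 := by
  have hcyc : ∀ {g : C(Disk.{u} n, X)}, IsCharMap e g → ∀ {z},
      z ∈ relCycles Set.univ (diskSphere n) n →
      singularMap g n z ∈ relCycles (skel C (n + 1)) (skel C n) n := fun hg z hz =>
    relCycles_mono (Set.union_subset (skel_mono n.le_succ) (closedCell_subset_skeletonLT n e))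
      subset_rfl n (hg.isAttaching_single.singularMap_mem () hz)
  -- `VanishesOnCell` refers to a particular characteristic map and to all relative cycles of the
  -- ball
  have hι := fundamentalCycle_mem.{u} n
  have hΨe : cellEquiv hΨ n (Finsupp.single e 1) =
      relClass _ _ n ⟨singularMap (Ψ n e) n (fundamentalCycle n), hcyc (hΨ n e) hι⟩ := by
    rw [cellEquiv_eq_iff, cellSum_single, one_smul, sub_self]
    exact AddSubgroup.zero_mem _
  rw [hΨe]
  constructor
  · intro h
    obtain ⟨k, hk⟩ := exists_singularMap_sub_mem (hΨ n e) (isCharMap_charMap e) hι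
    have h0 := h (k • fundamentalCycle n) (zsmul_mem hι k)
      ⟨_, hcyc (isCharMap_charMap e) (zsmul_mem hι k)⟩ rfl
    rw [← h0]
    congr 1
    rw [relClass_eq_iff]
    simpa only [map_zsmul] using hk
  · intro h z hz c hc
    obtain ⟨k, hk⟩ := exists_singularMap_sub_mem (isCharMap_charMap e) (hΨ n e) hz
    rw [hc] at hk
    have : relClass _ _ n c = k • relClass _ _ n
        ⟨singularMap (Ψ n e) n (fundamentalCycle n), hcyc (hΨ n e) hι⟩ := by
      rw [← map_zsmul]
      exact relClass_eq_iff.2 hk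
    rw [this, map_zsmul, h, smul_zero]

/-- A cellular cochain as a function on linear combinations of cells. -/
def cochainEquiv (n : ℕ) : CellularCochains C n ≃+ ((cell C n →₀ ℤ) →+ ℤ) :=
  AddEquiv.addMonoidHomCongrLeft (cellEquiv hΨ n).symm

theorem cochainEquiv_apply (f : CellularCochains C n) (k : cell C n →₀ ℤ) :
    cochainEquiv hΨ n f k = f (cellEquiv hΨ n k) := rfl

/-- The coboundary is dual to the boundary operator on combinations of cells. -/
theorem cochainEquiv_cellularCoboundary (f : CellularCochains C n) :
    cochainEquiv hΨ (n + 1) (cellularCoboundary C n f) =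
      (cochainEquiv hΨ n f).comp (cellBoundary hΨ n) := by
  refine AddMonoidHom.ext fun k => ?_
  rw [AddMonoidHom.comp_apply, cochainEquiv_apply, cochainEquiv_apply, cellEquiv_cellBoundary]
  rfl

/-- A cochain has compact support if it vanishes on all but finitely many basis elements. -/
theorem mem_compactCochains_iff {f : CellularCochains C n} : f ∈ compactCochains C n ↔
    {e | cochainEquiv hΨ n f (Finsupp.single e 1) ≠ 0}.Finite := by
  have : {e | cochainEquiv hΨ n f (Finsupp.single e 1) ≠ 0} = {e | ¬ VanishesOnCell f e} := by
    ext e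
    exact (not_congr (vanishesOnCell_iff hΨ)).symm
  rw [this]
  rfl

section Subcomplex

variable (E F : CWComplex.Subcomplex C)

/-- The characteristic maps of the cells of a subcomplex. -/
abbrev subcomplexCharMap (Ψ : ∀ n, cell C n → C(Disk.{u} n, X)) (n : ℕ) :
    cell (E : Set X) n → C(Disk.{u} n, X) := fun e => Ψ n e.1

include hΨ in
theorem isCharMap_subcomplex (n : ℕ) (e : cell (E : Set X) n) :
    IsCharMap e (subcomplexCharMap E Ψ n e) where
  mem_openCell := (hΨ n e.1).mem_openCell
  mem_cellFrontier := (hΨ n e.1).mem_cellFrontier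
  inj := (hΨ n e.1).inj
  surj := (hΨ n e.1).surj

theorem skel_subcomplex_subset : skel (E : Set X) n ⊆ skel C n := fun x hx => by
  obtain ⟨m, hm, e, he⟩ := mem_skel.1 hx
  exact mem_skel.2 ⟨m, hm, e.1, he⟩

/-- The boundary operator of a subcomplex is the restriction of the boundary operator. -/
theorem cellBoundary_subcomplex (k : cell (E : Set X) (n + 1) →₀ ℤ) :
    cellBoundary hΨ n (k.mapDomain Subtype.val) =
      (cellBoundary (isCharMap_subcomplex hΨ E) n k).mapDomain Subtype.val :=
  cellBoundary_mapDomain (isCharMap_subcomplex hΨ E) hΨ (ContinuousMap.id X)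
    (fun _ => Subtype.val) (fun _ _ => ContinuousMap.id_comp _)
    (fun _ => skel_subcomplex_subset E) k

variable {E F}

theorem skel_subcomplex_mono (hFE : ∀ n, F.I n ⊆ E.I n) :
    skel (F : Set X) n ⊆ skel (E : Set X) n := fun x hx => by
  obtain ⟨m, hm, e, he⟩ := mem_skel.1 hx
  exact mem_skel.2 ⟨m, hm, ⟨e.1, hFE m e.2⟩, he⟩

/-- The inclusion of the cells of a subcomplex into those of a larger subcomplex. -/
def cellInclusion (hFE : ∀ n, F.I n ⊆ E.I n) (n : ℕ) (e : cell (F : Set X) n) :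
    cell (E : Set X) n := (⟨e.1, hFE n e.2⟩ : E.I n)

/-- The restriction of a cochain to a subcomplex is zero if and only if the cochain vanishes on the
basis elements given by the cells of the subcomplex. -/
theorem mem_relCochains_iff (hFE : ∀ n, F.I n ⊆ E.I n) {f : CellularCochains (E : Set X) n} :
    f ∈ relCochains (E : Set X) (F : Set X) n ↔ ∀ e : cell (E : Set X) n, e.1 ∈ F.I n →
      cochainEquiv (isCharMap_subcomplex hΨ E) n f (Finsupp.single e 1) = 0 := by
  have hE := isCharMap_subcomplex hΨ E
  have hF := isCharMap_subcomplex hΨ F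
  constructor
  · intro h e he
    refine h ⟨cellSum (subcomplexCharMap E Ψ n) (Finsupp.single e 1),
      cellSum_mem_relCycles hE _⟩ ?_
    have := cellSum_mem_relCycles hF (Finsupp.single (⟨e.1, he⟩ : F.I n) 1)
    rw [cellSum_single] at this
    change cellSum (subcomplexCharMap E Ψ n) (Finsupp.single e 1) ∈ _
    rw [cellSum_single]
    exact this
  · intro h c hc
    obtain ⟨k, hk⟩ := (isAttaching_skeleton (hF n)).exists_sub_cellSum_mem hc
    have hs : cellSum (subcomplexCharMap F Ψ n) k =
        cellSum (subcomplexCharMap E Ψ n) (k.mapDomain (cellInclusion hFE n)) := by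
      have := singularMap_cellSum (Ψ := subcomplexCharMap F Ψ) (Ψ' := subcomplexCharMap E Ψ)
        (ContinuousMap.id X) (cellInclusion hFE) (fun _ _ => ContinuousMap.id_comp _) k
      rwa [singularMap_id] at this
    have hc' : relClass _ _ n c = cellEquiv hE n (k.mapDomain (cellInclusion hFE n)) := by
      rw [eq_comm, cellEquiv_eq_iff, ← hs, ← neg_mem_iff, neg_sub]
      exact relBoundaries_mono (skel_subcomplex_mono hFE) (skel_subcomplex_mono hFE) n hk
    have h0 : (cochainEquiv hE n f).comp (Finsupp.mapDomain.addMonoidHom (cellInclusion hFE n)) =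
        0 := by
      refine Finsupp.addHom_ext fun e a => ?_
      have ha : (Finsupp.single (cellInclusion hFE n e) a : cell (E : Set X) n →₀ ℤ) =
          a • Finsupp.single (cellInclusion hFE n e) 1 := by simp
      rw [AddMonoidHom.comp_apply, Finsupp.mapDomain.addMonoidHom_apply, Finsupp.mapDomain_single,
        ha, map_zsmul, h _ e.2, smul_zero, AddMonoidHom.zero_apply]
    rw [hc', ← cochainEquiv_apply]
    exact DFunLike.congr_fun h0 k

end Subcomplex
end

section

open MulAction

/-! ### Equivariant maps between permutation modules -/

/-- The basis element of a permutation module given by a point. -/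
abbrev gen {E : Type*} (e : E) : E →₀ ℤ := Finsupp.single e 1

variable {G : Type*} [Group G]
variable {E : Type*} [MulAction G E] {E' : Type*} [MulAction G E'] {E'' : Type*} [MulAction G E'']

theorem apply_eq_sum (T : (E →₀ ℤ) →ₗ[ℤ] (E' →₀ ℤ)) (k : E →₀ ℤ) (z : E') :
    T k z = k.sum fun y a => a * T (gen y) z := by
  have : (Finsupp.lapply z).comp T = Finsupp.linearCombination ℤ fun y => T (gen y) z := by
    ext y
    simp
  exact (LinearMap.congr_fun this k).trans (Finsupp.linearCombination_apply _ _)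

theorem exists_of_apply_ne_zero {T : (E →₀ ℤ) →ₗ[ℤ] (E' →₀ ℤ)} {k : E →₀ ℤ} {z : E'}
    (h : T k z ≠ 0) : ∃ y, k y ≠ 0 ∧ T (gen y) z ≠ 0 := by
  rw [apply_eq_sum] at h
  obtain ⟨y, -, hy⟩ := Finset.exists_ne_zero_of_sum_ne_zero h
  exact ⟨y, left_ne_zero_of_mul hy, right_ne_zero_of_mul hy⟩

theorem mapDomain_smul_apply (g : G) (k : E →₀ ℤ) (x : E) :
    k.mapDomain (g • ·) x = k (g⁻¹ • x) := by
  conv_lhs => rw [← smul_inv_smul g x]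
  exact Finsupp.mapDomain_apply (MulAction.injective g) _ _

theorem stabilizer_smul_le_iff {g : G} {x : E} {y : E'} :
    stabilizer G (g • x) ≤ stabilizer G (g • y) ↔ stabilizer G x ≤ stabilizer G y := by
  simp only [stabilizer_smul_eq_stabilizer_map_conj]
  exact Subgroup.map_le_map_iff_of_injective (MulAut.conj g).injective

theorem stabilizer_smul_eq_iff {g : G} {x : E} {y : E'} :
    stabilizer G (g • x) = stabilizer G (g • y) ↔ stabilizer G x = stabilizer G y := by
  simp only [le_antisymm_iff, stabilizer_smul_le_iff]

variable (G) in
/-- Equivariant maps of permutation modules. -/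
def IsEquivariant (T : (E →₀ ℤ) →ₗ[ℤ] (E' →₀ ℤ)) : Prop :=
  ∀ (g : G) e x, T (gen (g • e)) (g • x) = T (gen e) x

variable (G) in
/-- Equivariant maps `T` of permutation modules such that the stabilizers of the points that occur
in `T e` contain the stabilizer of `e`. -/
structure IsStabMap (T : (E →₀ ℤ) →ₗ[ℤ] (E' →₀ ℤ)) : Prop where
  equivariant : IsEquivariant G T
  le : ∀ e x, T (gen e) x ≠ 0 → stabilizer G e ≤ stabilizer G x

theorem IsEquivariant.map_mapDomain {T : (E →₀ ℤ) →ₗ[ℤ] (E' →₀ ℤ)} (hT : IsEquivariant G T)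
    (g : G) (k : E →₀ ℤ) : T (k.mapDomain (g • ·)) = (T k).mapDomain (g • ·) := by
  have : T.comp (Finsupp.lmapDomain ℤ ℤ (g • ·)) = (Finsupp.lmapDomain ℤ ℤ (g • ·)).comp T := by
    ext e x
    simp only [LinearMap.comp_apply, Finsupp.lsingle_apply, Finsupp.lmapDomain_apply,
      Finsupp.mapDomain_single]
    rw [mapDomain_smul_apply, ← hT g e, smul_inv_smul]
  exact LinearMap.congr_fun this k

theorem IsEquivariant.comp {T : (E' →₀ ℤ) →ₗ[ℤ] (E'' →₀ ℤ)} {S : (E →₀ ℤ) →ₗ[ℤ] (E' →₀ ℤ)}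
    (hT : IsEquivariant G T) (hS : IsEquivariant G S) : IsEquivariant G (T.comp S) := by
  intro g e x
  have : S (gen (g • e)) = (S (gen e)).mapDomain (g • ·) := by
    rw [← hS.map_mapDomain, Finsupp.mapDomain_single]
  rw [LinearMap.comp_apply, this, hT.map_mapDomain, mapDomain_smul_apply, inv_smul_smul]
  rfl

namespace IsStabMap

theorem comp {T : (E' →₀ ℤ) →ₗ[ℤ] (E'' →₀ ℤ)} {S : (E →₀ ℤ) →ₗ[ℤ] (E' →₀ ℤ)}
    (hT : IsStabMap G T) (hS : IsStabMap G S) : IsStabMap G (T.comp S) where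
  equivariant := hT.equivariant.comp hS.equivariant
  le e x hx := by
    obtain ⟨y, hy, hyx⟩ := exists_of_apply_ne_zero (T := T) hx
    exact (hS.le e y hy).trans (hT.le y x hyx)

theorem add {T S : (E →₀ ℤ) →ₗ[ℤ] (E' →₀ ℤ)} (hT : IsStabMap G T) (hS : IsStabMap G S) :
    IsStabMap G (T + S) where
  equivariant g e x := by
    simp only [LinearMap.add_apply, Finsupp.add_apply, hT.equivariant g, hS.equivariant g]
  le e x hx := by
    by_cases h : T (gen e) x = 0
    · exact hS.le e x fun h' => hx (by simp [h, h'])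
    · exact hT.le e x h

theorem neg {T : (E →₀ ℤ) →ₗ[ℤ] (E' →₀ ℤ)} (hT : IsStabMap G T) : IsStabMap G (-T) where
  equivariant g e x := by
    simp only [LinearMap.neg_apply, Finsupp.neg_apply, hT.equivariant g]
  le e x hx := hT.le e x fun h => hx (by simp [h])

theorem sub {T S : (E →₀ ℤ) →ₗ[ℤ] (E' →₀ ℤ)} (hT : IsStabMap G T) (hS : IsStabMap G S) :
    IsStabMap G (T - S) := sub_eq_add_neg T S ▸ hT.add hS.neg

theorem zero : IsStabMap G (0 : (E →₀ ℤ) →ₗ[ℤ] (E' →₀ ℤ)) :=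
  ⟨fun _ _ _ => rfl, fun _ _ h => absurd rfl h⟩

theorem one : IsStabMap G (1 : Module.End ℤ (E →₀ ℤ)) where
  equivariant g e x := by
    classical
    simp [Finsupp.single_apply, smul_left_cancel_iff]
  le e x hx := by
    obtain rfl : e = x := by
      by_contra h
      exact hx (Finsupp.single_eq_of_ne' h)
    exact le_rfl

theorem sum {ι : Type*} (s : Finset ι) {T : ι → (E →₀ ℤ) →ₗ[ℤ] (E' →₀ ℤ)}
    (h : ∀ i, IsStabMap G (T i)) : IsStabMap G (∑ i ∈ s, T i) := by
  classical
  induction s using Finset.induction_on with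
  | empty => exact zero
  | insert i s hi ih => rw [Finset.sum_insert hi]; exact (h i).add ih

theorem pow {T : Module.End ℤ (E →₀ ℤ)} (h : IsStabMap G T) (n : ℕ) : IsStabMap G (T ^ n) := by
  induction n with
  | zero => exact one
  | succ n ih => rw [pow_succ]; exact ih.comp h

end IsStabMap

variable (G E) in
/-- The chains whose points are all fixed by `H`. -/
def fixedChains (H : Subgroup G) : Submodule ℤ (E →₀ ℤ) :=
  Finsupp.supported ℤ ℤ {e | H ≤ stabilizer G e}

theorem mem_fixedChains {H : Subgroup G} {k : E →₀ ℤ} :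
    k ∈ fixedChains G E H ↔ ∀ e, k e ≠ 0 → H ≤ stabilizer G e := by
  rw [fixedChains, Finsupp.mem_supported]
  exact ⟨fun h e he => h (Finsupp.mem_support_iff.2 he),
    fun h e he => h e (Finsupp.mem_support_iff.1 he)⟩

/-- This is why `IsStabMap` is the right condition: such maps induce maps on the chains fixed by `H`
for every `H`, as required of a morphism of functors on the orbit category. -/
theorem IsStabMap.map_mem_fixedChains {T : (E →₀ ℤ) →ₗ[ℤ] (E' →₀ ℤ)} (hT : IsStabMap G T)
    {H : Subgroup G} {k : E →₀ ℤ} (hk : k ∈ fixedChains G E H) : T k ∈ fixedChains G E' H := by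
  refine mem_fixedChains.2 fun x hx => ?_
  obtain ⟨y, hy, hyx⟩ := exists_of_apply_ne_zero hx
  exact (mem_fixedChains.1 hk y hy).trans (hT.le y x hyx)

variable (G) in
/-- A `G`-set with finite stabilizers and finitely many orbits. -/
class IsProperCofinite (E : Type*) [MulAction G E] : Prop where
  finite_stabilizer : ∀ e : E, Finite (stabilizer G e)
  finite_orbits : Finite (orbitRel.Quotient G E)

theorem exists_finite_representatives [h : IsProperCofinite G E] :
    ∃ R : Set E, R.Finite ∧ ∀ e : E, ∃ g : G, ∃ r ∈ R, g • r = e := by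
  have := h.finite_orbits
  refine ⟨Set.range fun q : orbitRel.Quotient G E => q.out, Set.finite_range _, fun e => ?_⟩
  let q : orbitRel.Quotient G E := Quotient.mk _ e
  obtain ⟨g, hg⟩ : ∃ g : G, g • e = q.out := orbitRel_apply.1 (Quotient.exact q.out_eq)
  exact ⟨g⁻¹, _, ⟨q, rfl⟩, inv_smul_eq_iff.2 hg.symm⟩

theorem finite_setOf_smul_eq [h : IsProperCofinite G E] (x y : E) :
    {g : G | g • x = y}.Finite := by
  by_cases hne : ∃ g : G, g • x = y
  · obtain ⟨g, rfl⟩ := hne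
    have := h.finite_stabilizer x
    refine (Set.finite_range fun s : stabilizer G x => g * s).subset fun k hk => ?_
    refine ⟨⟨g⁻¹ * k, ?_⟩, mul_inv_cancel_left g k⟩
    rw [mem_stabilizer_iff, mul_smul, inv_smul_eq_iff]
    exact hk
  · convert Set.finite_empty
    exact Set.eq_empty_iff_forall_notMem.2 fun g hg => hne ⟨g, hg⟩

/-- A given point `x` occurs in `T e` for finitely many `e` only: there are finitely many orbits of
such `e`, and stabilizers are finite. Therefore the transposed matrix defines a map on finite
chains. -/
theorem finite_setOf_apply_ne_zero [IsProperCofinite G E] [IsProperCofinite G E']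
    {T : (E →₀ ℤ) →ₗ[ℤ] (E' →₀ ℤ)} (hT : IsEquivariant G T) (x : E') :
    {e | T (gen e) x ≠ 0}.Finite := by
  obtain ⟨R, hR, hR'⟩ := exists_finite_representatives (G := G) (E := E)
  refine (hR.biUnion fun r _ => (T (gen r)).support.finite_toSet.biUnion fun y _ =>
    (finite_setOf_smul_eq y x (G := G)).image (· • r)).subset fun e he => ?_
  obtain ⟨g, r, hr, rfl⟩ := hR' e
  refine Set.mem_biUnion hr (Set.mem_biUnion (x := g⁻¹ • x) ?_ ⟨g, smul_inv_smul g x, rfl⟩)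
  rw [Finset.mem_coe, Finsupp.mem_support_iff, ← hT g, smul_inv_smul]
  exact he

theorem linearCombination_comm (f k : E →₀ ℤ) :
    Finsupp.linearCombination ℤ f k = Finsupp.linearCombination ℤ k f := by
  classical
  rw [Finsupp.linearCombination_apply, Finsupp.linearCombination_apply,
    Finsupp.sum_of_support_subset k (Finset.subset_union_right (s₁ := f.support)) _ (by simp),
    Finsupp.sum_of_support_subset f (Finset.subset_union_left (s₂ := k.support)) _ (by simp)]
  exact Finset.sum_congr rfl fun e _ => mul_comm _ _

section Transpose

variable [IsProperCofinite G E] [IsProperCofinite G E'] {T : (E →₀ ℤ) →ₗ[ℤ] (E' →₀ ℤ)}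
  (hT : IsEquivariant G T)

/-- The map given by the transposed matrix of an equivariant map. -/
def transpose : (E' →₀ ℤ) →ₗ[ℤ] (E →₀ ℤ) :=
  Finsupp.linearCombination ℤ fun x =>
    Finsupp.ofSupportFinite (fun e => T (gen e) x) (finite_setOf_apply_ne_zero hT x)

theorem transpose_gen_apply (x : E') (e : E) : transpose hT (gen x) e = T (gen e) x := by
  rw [transpose, Finsupp.linearCombination_single, one_smul]
  rfl

theorem transpose_apply (f : E' →₀ ℤ) (e : E) :
    transpose hT f e = Finsupp.linearCombination ℤ f (T (gen e)) := by
  have : (Finsupp.lapply e).comp (transpose hT) =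
      (Finsupp.linearCombination ℤ (T (gen e)) : (E' →₀ ℤ) →ₗ[ℤ] ℤ) := by
    ext x
    simp [transpose_gen_apply]
  exact (LinearMap.congr_fun this f).trans (linearCombination_comm _ _)

theorem isEquivariant_transpose : IsEquivariant G (transpose hT) := fun g x e => by
  rw [transpose_gen_apply, transpose_gen_apply, hT]

end Transpose

open Classical in
variable (G) in
/-- The part of the map `T` that preserves stabilizers. -/
def grade (T : (E →₀ ℤ) →ₗ[ℤ] (E' →₀ ℤ)) : (E →₀ ℤ) →ₗ[ℤ] (E' →₀ ℤ) :=
  Finsupp.linearCombination ℤ fun e =>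
    (T (gen e)).filter fun x => stabilizer G x = stabilizer G e

open Classical in
theorem grade_gen_apply (T : (E →₀ ℤ) →ₗ[ℤ] (E' →₀ ℤ)) (e : E) (x : E') :
    grade G T (gen e) x = if stabilizer G x = stabilizer G e then T (gen e) x else 0 := by
  rw [grade, Finsupp.linearCombination_single, one_smul, Finsupp.filter_apply]

variable (G) in
/-- The map `T` preserves stabilizers. -/
def IsPure (T : (E →₀ ℤ) →ₗ[ℤ] (E' →₀ ℤ)) : Prop :=
  ∀ e x, T (gen e) x ≠ 0 → stabilizer G x = stabilizer G e

theorem isPure_grade (T : (E →₀ ℤ) →ₗ[ℤ] (E' →₀ ℤ)) : IsPure G (grade G T) := fun e x hx => by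
  classical
  rw [grade_gen_apply] at hx
  exact (ite_ne_right_iff.1 hx).1

/-- A map that preserves stabilizers is its own stabilizer-preserving part. -/
theorem IsPure.grade_eq {T : (E →₀ ℤ) →ₗ[ℤ] (E' →₀ ℤ)} (hT : IsPure G T) : grade G T = T := by
  classical
  ext e x
  simp only [LinearMap.comp_apply, Finsupp.lsingle_apply]
  rw [grade_gen_apply, ite_eq_left_iff]
  intro h
  by_contra hne
  exact h (hT e x (Ne.symm hne))

theorem grade_add (T S : (E →₀ ℤ) →ₗ[ℤ] (E' →₀ ℤ)) : grade G (T + S) = grade G T + grade G S := by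
  classical
  ext e x
  simp only [LinearMap.comp_apply, Finsupp.lsingle_apply, LinearMap.add_apply, Finsupp.add_apply,
    grade_gen_apply]
  split_ifs <;> simp

theorem grade_sub (T S : (E →₀ ℤ) →ₗ[ℤ] (E' →₀ ℤ)) : grade G (T - S) = grade G T - grade G S := by
  classical
  ext e x
  simp only [LinearMap.comp_apply, Finsupp.lsingle_apply, LinearMap.sub_apply, Finsupp.sub_apply,
    grade_gen_apply]
  split_ifs <;> simp

theorem grade_zero : grade G (0 : (E →₀ ℤ) →ₗ[ℤ] (E' →₀ ℤ)) = 0 :=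
  IsPure.grade_eq fun _ _ h => absurd rfl h

theorem isPure_one : IsPure G (1 : Module.End ℤ (E →₀ ℤ)) := fun e x hx => by
  by_contra h
  exact hx (Finsupp.single_eq_of_ne' fun h' => h (h' ▸ rfl))

/-- Passing to the stabilizer-preserving part is multiplicative: stabilizers can only increase along
the map, so a composite that preserves a stabilizer preserves it in both steps. -/
theorem grade_comp {T : (E' →₀ ℤ) →ₗ[ℤ] (E'' →₀ ℤ)} {S : (E →₀ ℤ) →ₗ[ℤ] (E' →₀ ℤ)}
    (hT : IsStabMap G T) (hS : IsStabMap G S) :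
    grade G (T.comp S) = (grade G T).comp (grade G S) := by
  classical
  ext e z
  simp only [LinearMap.comp_apply, Finsupp.lsingle_apply]
  have hsupp : (grade G S (gen e)).support ⊆ (S (gen e)).support := fun x hx => by
    rw [Finsupp.mem_support_iff, grade_gen_apply] at hx
    exact Finsupp.mem_support_iff.2 (ite_ne_right_iff.1 hx).2
  rw [grade_gen_apply, LinearMap.comp_apply, apply_eq_sum T, apply_eq_sum (grade G T),
    Finsupp.sum_of_support_subset _ hsupp _ (by simp), Finsupp.sum]
  by_cases hz : stabilizer G z = stabilizer G e
  · rw [if_pos hz]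
    refine Finset.sum_congr rfl fun y hy => ?_
    rw [grade_gen_apply, grade_gen_apply]
    by_cases h : T (gen y) z = 0
    · simp [h]
    · have hy' : stabilizer G y = stabilizer G e :=
        le_antisymm ((hT.le y z h).trans hz.le) (hS.le e y (Finsupp.mem_support_iff.1 hy))
      rw [if_pos hy', if_pos (hz.trans hy'.symm)]
  · rw [if_neg hz]
    refine (Finset.sum_eq_zero fun y _ => ?_).symm
    rw [grade_gen_apply, grade_gen_apply]
    by_cases hy : stabilizer G y = stabilizer G e
    · rw [if_pos hy, if_neg (fun h => hz (h.trans hy) : ¬ stabilizer G z = stabilizer G y),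
        mul_zero]
    · rw [if_neg hy, zero_mul]

theorem isStabMap_grade {T : (E →₀ ℤ) →ₗ[ℤ] (E' →₀ ℤ)} (hT : IsEquivariant G T) :
    IsStabMap G (grade G T) where
  equivariant g e x := by
    classical
    rw [grade_gen_apply, grade_gen_apply, hT]
    simp only [stabilizer_smul_eq_iff]
  le e x hx := (isPure_grade T e x hx).ge

end

section

open MulAction

variable {G : Type*} [Group G]

theorem IsPure.comp {E E' E'' : Type*} [MulAction G E] [MulAction G E'] [MulAction G E'']
    {T : (E' →₀ ℤ) →ₗ[ℤ] (E'' →₀ ℤ)} {S : (E →₀ ℤ) →ₗ[ℤ] (E' →₀ ℤ)}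
    (hT : IsPure G T) (hS : IsPure G S) : IsPure G (T.comp S) := fun e x hx => by
  obtain ⟨y, hy, hyx⟩ := exists_of_apply_ne_zero (T := T) hx
  exact (hT y x hyx).trans (hS e y hy)

theorem IsPure.sub {E E' : Type*} [MulAction G E] [MulAction G E']
    {T S : (E →₀ ℤ) →ₗ[ℤ] (E' →₀ ℤ)} (hT : IsPure G T) (hS : IsPure G S) : IsPure G (T - S) :=
  fun e x hx => by
    by_cases h : T (gen e) x = 0
    · exact hS e x fun h' => hx (by simp [h, h'])
    · exact hT e x h

/-- A choice that is compatible with group actions. -/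
theorem exists_equivariant_choice {Ω W : Type*} [MulAction G Ω] [MulAction G W] (R : Ω → W → Prop)
    (hR : ∀ (g : G) x w, R x w → R (g • x) (g • w))
    (ex : ∀ x, ∃ w, R x w ∧ ∀ g : G, g • x = x → g • w = w) :
    ∃ F : Ω → W, (∀ x, R x (F x)) ∧ ∀ (g : G) x, F (g • x) = g • F x := by
  choose f hf hf' using ex
  let rep : Ω → Ω := fun x => (Quotient.mk (orbitRel G Ω) x).out
  have hrep : ∀ x, ∃ g : G, g • rep x = x := fun x =>
    orbitRel_apply.1 (Setoid.symm' _ (Quotient.exact (Quotient.mk (orbitRel G Ω) x).out_eq))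
  have hrep' : ∀ (g : G) x, rep (g • x) = rep x := fun g x =>
    congrArg Quotient.out (Quotient.sound (orbitRel_apply.2 ⟨g, rfl⟩))
  choose g hg using hrep
  refine ⟨fun x => g x • f (rep x), fun x => ?_, fun h x => ?_⟩
  · have := hR (g x) _ _ (hf (rep x))
    rwa [hg] at this
  · change g (h • x) • f (rep (h • x)) = h • g x • f (rep x)
    rw [← inv_smul_eq_iff, ← inv_smul_eq_iff, hrep', ← mul_smul, ← mul_smul]
    refine hf' _ _ ?_
    rw [mul_smul, mul_smul, inv_smul_eq_iff, inv_smul_eq_iff, hg]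
    have := hg (h • x)
    rwa [hrep'] at this

/-! ### The combinatorial chain complex of a cocompact model -/

/-- The combinatorial structure carried by the cells of a cocompact model for the classifying
space for proper actions: `G`-sets `E n` of `n`-cells and an equivariant boundary operator. -/
structure CellModel (G : Type*) [Group G] (E : ℕ → Type w) [∀ n, MulAction G (E n)]
    [∀ n, IsProperCofinite G (E n)] where
  /-- the boundary operator -/
  d : ∀ n, (E (n + 1) →₀ ℤ) →ₗ[ℤ] (E n →₀ ℤ)
  isStabMap : ∀ n, IsStabMap G (d n)
  d_comp_d : ∀ n, (d n).comp (d (n + 1)) = 0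
  sum_d : ∀ k, (d 0 k).sum (fun _ a => a) = 0
  exact : ∀ H : Subgroup G, Finite H → ∀ n, ∀ k ∈ fixedChains G (E (n + 1)) H, d n k = 0 →
    ∃ l ∈ fixedChains G (E (n + 2)) H, d (n + 1) l = k
  exact_zero : ∀ H : Subgroup G, Finite H → ∀ k ∈ fixedChains G (E 0) H,
    k.sum (fun _ a => a) = 0 → ∃ l ∈ fixedChains G (E 1) H, d 0 l = k
  exists_vertex : ∀ H : Subgroup G, Finite H → ∃ e : E 0, H ≤ stabilizer G e
  finite_dimensional : ∃ D, ∀ n, D ≤ n → IsEmpty (E n)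

namespace CellModel

variable {E : ℕ → Type w} [∀ n, MulAction G (E n)] [∀ n, IsProperCofinite G (E n)]
  (M : CellModel G E)

/-- A compactly supported cocycle of the cells fixed by `K` relative to the cells with larger
stabilizer. -/
def IsRelCocycle (K : Subgroup G) (n : ℕ) (f : E n →₀ ℤ) : Prop :=
  (∀ e, f e ≠ 0 → stabilizer G e = K) ∧
    ∀ e : E (n + 1), K ≤ stabilizer G e → Finsupp.linearCombination ℤ f (M.d n (gen e)) = 0

/-- A coboundary of a compactly supported relative cochain. -/
def IsRelCoboundary (K : Subgroup G) : (n : ℕ) → (E n →₀ ℤ) → Prop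
  | 0, f => f = 0
  | n + 1, f => ∃ g : E n →₀ ℤ, (∀ e, g e ≠ 0 → stabilizer G e = K) ∧
    ∀ e : E (n + 1), K ≤ stabilizer G e → f e = Finsupp.linearCombination ℤ g (M.d n (gen e))

/-- The relative cohomology with compact supports does not vanish. -/
def HasCohomology (K : Subgroup G) (n : ℕ) : Prop :=
  ∃ f, M.IsRelCocycle K n f ∧ ¬ M.IsRelCoboundary K n f

/-- If a stabilizer-preserving endomorphism `ψ` vanishes on boundaries of the graded complex, then
each row `e ↦ ψ(e)ₓ` of its matrix is a relative cocycle with compact support for the stabilizer of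
`x`. -/
theorem isRelCocycle_transpose {n : ℕ} {ψ : Module.End ℤ (E n →₀ ℤ)} (hψ : IsEquivariant G ψ)
    (hp : IsPure G ψ) (h0 : ψ.comp (grade G (M.d n)) = 0) (x : E n) :
    M.IsRelCocycle (stabilizer G x) n (transpose hψ (gen x)) := by
  classical
  refine ⟨fun e he => ?_, fun e he => ?_⟩
  · rw [transpose_gen_apply] at he
    exact (hp e x he).symm
  · have h1 : (M.d n (gen e)).sum (fun y a => a * ψ (gen y) x) =
        Finsupp.linearCombination ℤ (transpose hψ (gen x)) (M.d n (gen e)) := by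
      rw [Finsupp.linearCombination_apply]
      simp only [transpose_gen_apply, smul_eq_mul]
    rw [← h1]
    by_cases hex : stabilizer G e = stabilizer G x
    · have h2 := DFunLike.congr_fun (LinearMap.congr_fun h0 (gen e)) x
      rw [LinearMap.comp_apply, apply_eq_sum,
        Finsupp.sum_of_support_subset (s := (M.d n (gen e)).support) _ (fun y hy => by
          rw [Finsupp.mem_support_iff, grade_gen_apply] at hy
          exact Finsupp.mem_support_iff.2 (ite_ne_right_iff.1 hy).2) _ (by simp)] at h2
      refine (Finset.sum_congr rfl fun y _ => ?_).trans h2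
      beta_reduce
      by_cases hy : ψ (gen y) x = 0
      · rw [hy, mul_zero, mul_zero]
      · rw [grade_gen_apply, if_pos ((hp y x hy).symm.trans hex.symm)]
    · refine Finset.sum_eq_zero fun y hy => ?_
      by_contra hne
      have hyx := hp y x (right_ne_zero_of_mul hne)
      exact hex (le_antisymm (((M.isStabMap n).le e y (Finsupp.mem_support_iff.1 hy)).trans hyx.ge)
        he)

section Factor

attribute [local instance] Finsupp.comapSMul Finsupp.comapMulAction

/-- If the relative cohomology vanishes in degree `n + 1`, then a stabilizer-preserving endomorphism
that is zero on boundaries of the graded complex factors through the differential: by vanishing,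
each row of its matrix is a coboundary of some `γ x`, with `γ` chosen equivariantly, and the `γ x`
are the rows of the factor. -/
theorem exists_pure_factor {n : ℕ} {ψ : Module.End ℤ (E (n + 1) →₀ ℤ)} (hψ : IsEquivariant G ψ)
    (hp : IsPure G ψ) (h0 : ψ.comp (grade G (M.d (n + 1))) = 0)
    (hH : ∀ K : Subgroup G, Finite K → ¬ M.HasCohomology K (n + 1)) :
    ∃ s : (E n →₀ ℤ) →ₗ[ℤ] (E (n + 1) →₀ ℤ), IsStabMap G s ∧ IsPure G s ∧
      s.comp (grade G (M.d n)) = ψ := by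
  classical
  -- `R x g`: the row of `ψ` at `x` is the coboundary of `g`, as a relative cochain for the
  -- stabilizer
  let R : E (n + 1) → (E n →₀ ℤ) → Prop := fun x g =>
    (∀ e, g e ≠ 0 → stabilizer G e = stabilizer G x) ∧
      ∀ e : E (n + 1), stabilizer G x ≤ stabilizer G e →
        ψ (gen e) x = Finsupp.linearCombination ℤ g (M.d n (gen e))
  have hR : ∀ (h : G) x g, R x g → R (h • x) (h • g) := by
    intro h x g hg
    refine ⟨fun e he => ?_, fun e he => ?_⟩
    · rw [Finsupp.comapSMul_apply] at he
      rw [← stabilizer_smul_eq_iff (g := h⁻¹), inv_smul_smul]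
      exact hg.1 _ he
    · rw [← smul_inv_smul h e, hψ, hg.2 (h⁻¹ • e) (by
          rwa [← stabilizer_smul_le_iff (g := h), smul_inv_smul]),
        show gen (h • h⁻¹ • e) = Finsupp.mapDomain (h • ·) (gen (h⁻¹ • e)) from
          Finsupp.mapDomain_single.symm, (M.isStabMap n).equivariant.map_mapDomain,
            Finsupp.linearCombination_mapDomain]
      congr 2
      ext y
      rw [Function.comp_apply, Finsupp.comapSMul_apply, inv_smul_smul]
  have ex : ∀ x, ∃ g, R x g ∧ ∀ h : G, h • x = x → h • g = g := by
    intro x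
    have hK : Finite (stabilizer G x) := IsProperCofinite.finite_stabilizer x
    obtain ⟨g, hg, hg'⟩ := not_not.1 fun hc => hH (stabilizer G x) hK
      ⟨_, M.isRelCocycle_transpose hψ hp h0 x, hc⟩
    refine ⟨g, ⟨hg, fun e he => ?_⟩, fun h hx => ?_⟩
    · rw [← hg' e he, transpose_gen_apply]
    -- `g` is supported on cells with the same stabilizer as `x`, hence it is fixed by this group
    · have hh : h ∈ stabilizer G x := hx
      ext e
      rw [Finsupp.comapSMul_apply]
      by_cases he : g e = 0
      · rw [he]
        by_contra hne
        have := hg _ hne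
        rw [← this, mem_stabilizer_iff, smul_inv_smul, eq_inv_smul_iff] at hh
        rw [inv_smul_eq_iff.2 hh.symm] at hne
        exact hne he
      · rw [← hg e he, mem_stabilizer_iff] at hh
        rw [inv_smul_eq_iff.2 hh.symm]
  obtain ⟨γ, hγ, hγ'⟩ := exists_equivariant_choice R hR ex
  have hT : IsEquivariant G (Finsupp.linearCombination ℤ γ) := fun g e x => by
    rw [Finsupp.linearCombination_single, one_smul, Finsupp.linearCombination_single, one_smul,
      hγ', Finsupp.comapSMul_apply, inv_smul_smul]
  have hs : ∀ e x, transpose hT (gen e) x = γ x e := fun e x => by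
    rw [transpose_gen_apply, Finsupp.linearCombination_single, one_smul]
  have hpure : IsPure G (transpose hT) := fun e x hx => by
    rw [hs] at hx
    exact ((hγ x).1 e hx).symm
  refine ⟨transpose hT, ⟨isEquivariant_transpose hT, fun e x hx => (hpure e x hx).ge⟩, hpure, ?_⟩
  ext e x
  simp only [LinearMap.comp_apply, Finsupp.lsingle_apply]
  have hpp := hpure.comp (isPure_grade (M.d n))
  by_cases hex : stabilizer G x = stabilizer G e
  · rw [(hγ x).2 e hex.le, apply_eq_sum, Finsupp.linearCombination_apply,
      Finsupp.sum_of_support_subset (s := (M.d n (gen e)).support) _ (fun y hy => by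
        rw [Finsupp.mem_support_iff, grade_gen_apply] at hy
        exact Finsupp.mem_support_iff.2 (ite_ne_right_iff.1 hy).2) _ (by simp)]
    refine Finset.sum_congr rfl fun y _ => ?_
    beta_reduce
    rw [hs, smul_eq_mul]
    by_cases hy : γ x y = 0
    · rw [hy, mul_zero, mul_zero]
    · rw [grade_gen_apply, if_pos (((hγ x).1 y hy).trans hex)]
  · have h1 : transpose hT (grade G (M.d n) (gen e)) x = 0 := by
      by_contra h
      exact hex (hpp e x h)
    have h2 : ψ (gen e) x = 0 := by
      by_contra h
      exact hex (hp e x h)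
    rw [h1, h2]

end Factor

/-- A partial contraction of the graded complex, by stabilizer-preserving maps, in the degrees `n +
1` and `n + 2`. -/
def HasPureContraction (n : ℕ) : Prop :=
  ∃ (s : (E n →₀ ℤ) →ₗ[ℤ] (E (n + 1) →₀ ℤ)) (s' : (E (n + 1) →₀ ℤ) →ₗ[ℤ] (E (n + 2) →₀ ℤ))
    (s'' : (E (n + 2) →₀ ℤ) →ₗ[ℤ] (E (n + 3) →₀ ℤ)),
    (IsStabMap G s ∧ IsPure G s) ∧ (IsStabMap G s' ∧ IsPure G s') ∧
    (IsStabMap G s'' ∧ IsPure G s'') ∧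
    (grade G (M.d (n + 1))).comp s' + s.comp (grade G (M.d n)) = 1 ∧
    (grade G (M.d (n + 2))).comp s'' + s'.comp (grade G (M.d (n + 1))) = 1

theorem grade_d_comp (n : ℕ) : (grade G (M.d n)).comp (grade G (M.d (n + 1))) = 0 := by
  rw [← grade_comp (M.isStabMap n) (M.isStabMap (n + 1)), M.d_comp_d, grade_zero]

theorem isPure_one_sub {n : ℕ} {s : (E n →₀ ℤ) →ₗ[ℤ] (E (n + 1) →₀ ℤ)} (hs : IsStabMap G s)
    (hp : IsPure G s) : IsStabMap G (1 - (grade G (M.d n)).comp s) ∧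
      IsPure G (1 - (grade G (M.d n)).comp s) :=
  ⟨IsStabMap.one.sub ((isStabMap_grade (M.isStabMap n).equivariant).comp hs),
    isPure_one.sub ((isPure_grade _).comp hp)⟩

/-- The defect of a partial contraction is a cocycle, to which `exists_pure_factor` applies in the
next lower degree. -/
theorem one_sub_comp_grade {n : ℕ} {s : (E n →₀ ℤ) →ₗ[ℤ] (E (n + 1) →₀ ℤ)}
    {s' : (E (n + 1) →₀ ℤ) →ₗ[ℤ] (E (n + 2) →₀ ℤ)}
    (h : (grade G (M.d (n + 1))).comp s' + s.comp (grade G (M.d n)) = 1) :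
    (1 - (grade G (M.d n)).comp s).comp (grade G (M.d n)) = 0 := by
  rw [LinearMap.sub_comp, LinearMap.comp_assoc, eq_sub_of_add_eq' h, LinearMap.comp_sub,
    ← LinearMap.comp_assoc, M.grade_d_comp, LinearMap.zero_comp, sub_zero]
  exact sub_self _

/-- If the relative cohomology vanishes above degree `m`, then the graded complex is contractible
above degree `m`. The contraction is constructed by descending induction, from the dimension
downwards. -/
theorem hasPureContraction {m : ℕ}
    (hH : ∀ n, m < n → ∀ K : Subgroup G, Finite K → ¬ M.HasCohomology K n) {n : ℕ} (hn : m ≤ n) :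
    M.HasPureContraction n := by
  obtain ⟨D, hD⟩ := M.finite_dimensional
  obtain ⟨j, hj⟩ : ∃ j, D ≤ n + j := ⟨D, Nat.le_add_left D n⟩
  induction j generalizing n with
  | zero =>
    -- above the dimension all chain groups vanish
    have h1 := hD (n + 1) (by omega)
    have h2 := hD (n + 2) (by omega)
    refine ⟨0, 0, 0, ⟨.zero, fun _ _ h => absurd rfl h⟩, ⟨.zero, fun _ _ h => absurd rfl h⟩,
      ⟨.zero, fun _ _ h => absurd rfl h⟩, ?_, ?_⟩
    · exact Finsupp.lhom_ext' fun e => h1.elim e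
    · exact Finsupp.lhom_ext' fun e => h2.elim e
  | succ j ih =>
    obtain ⟨s', s'', s₃, hs', hs'', hs₃, e1, e2⟩ := ih (n := n + 1) (by omega) (by omega)
    have hψ := M.isPure_one_sub hs'.1 hs'.2
    obtain ⟨s, hs1, hs2, hs3⟩ := M.exists_pure_factor hψ.1.equivariant hψ.2
      (M.one_sub_comp_grade e1) (hH (n + 1) (by omega))
    exact ⟨s, s', s'', ⟨hs1, hs2⟩, hs', hs'', by rw [hs3, add_sub_cancel], e1⟩

end CellModel

/-- Endomorphisms that differ from the identity by a strictly stabilizer-increasing map `ν` are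
invertible: the orders of the stabilizers are bounded, so `ν` is nilpotent. -/
theorem exists_inverse_of_grade_eq_one {E : Type*} [MulAction G E] [IsProperCofinite G E]
    {u : Module.End ℤ (E →₀ ℤ)} (hu : IsStabMap G u) (h1 : grade G u = 1) :
    ∃ v : Module.End ℤ (E →₀ ℤ), IsStabMap G v ∧ u * v = 1 ∧ v * u = 1 := by
  classical
  set ν : Module.End ℤ (E →₀ ℤ) := 1 - u with hν
  have hνs : IsStabMap G ν := IsStabMap.one.sub hu
  have hν0 : grade G ν = 0 := by
    rw [hν, grade_sub, h1, isPure_one.grade_eq, sub_self]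
  have hfin : ∀ e : E, Finite (stabilizer G e) := IsProperCofinite.finite_stabilizer
  -- `ν` strictly increases the orders of stabilizers, so its `i`-th power increases them by `i`
  have hlt : ∀ e x, ν (gen e) x ≠ 0 →
      Nat.card (stabilizer G e) < Nat.card (stabilizer G x) := by
    intro e x hx
    have hle := hνs.le e x hx
    have hne : stabilizer G e ≠ stabilizer G x := fun h => by
      have h0 := DFunLike.congr_fun (LinearMap.congr_fun hν0 (gen e)) x
      rw [grade_gen_apply, if_pos h.symm] at h0
      exact hx h0
    have := hfin x
    exact Set.ncard_lt_ncard (s := (stabilizer G e : Set G)) (t := stabilizer G x)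
      (lt_of_le_of_ne hle fun h => hne (SetLike.coe_injective h)) (Set.toFinite _)
  have hpow : ∀ i e x, (ν ^ i) (gen e) x ≠ 0 →
      Nat.card (stabilizer G e) + i ≤ Nat.card (stabilizer G x) := by
    intro i
    induction i with
    | zero =>
      intro e x hx
      obtain rfl : e = x := by
        by_contra h
        exact hx (Finsupp.single_eq_of_ne' h)
      exact le_rfl
    | succ i ih =>
      intro e x hx
      rw [pow_succ'] at hx
      obtain ⟨y, hy, hyx⟩ := exists_of_apply_ne_zero (T := ν) hx
      have := ih e y hy
      have := hlt y x hyx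
      omega
  -- there are finitely many orbits, and stabilizers in one orbit are conjugate
  obtain ⟨N, hN⟩ : ∃ N, ∀ e : E, Nat.card (stabilizer G e) < N := by
    obtain ⟨R, hR, hR'⟩ := exists_finite_representatives (G := G) (E := E)
    obtain ⟨N, hN⟩ := (hR.image fun r => Nat.card (stabilizer G r)).bddAbove
    refine ⟨N + 1, fun e => Nat.lt_succ_of_le ?_⟩
    obtain ⟨g, r, hr, rfl⟩ := hR' e
    rw [Nat.card_congr (stabilizerEquivStabilizer (rfl : g • r = g • r)).symm.toEquiv]
    exact hN ⟨r, hr, rfl⟩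
  have hnil : ν ^ N = 0 := by
    ext e x
    by_contra hx
    have := hpow N e x hx
    have := hN x
    omega
  have huν : u = 1 - ν := by rw [hν, sub_sub_cancel]
  refine ⟨∑ i ∈ Finset.range N, ν ^ i, IsStabMap.sum _ fun i => hνs.pow i, ?_, ?_⟩
  · rw [huν, mul_neg_geom_sum, hnil, sub_zero]
  · rw [huν, geom_sum_mul_neg, hnil, sub_zero]

namespace CellModel

variable {E : ℕ → Type w} [∀ n, MulAction G (E n)] [∀ n, IsProperCofinite G (E n)]
  (M : CellModel G E)

/-- A contraction of the graded complex gives, with the full differential in place of the graded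
one, an endomorphism whose graded part is the identity. -/
theorem grade_perturbed {n : ℕ} {s : (E n →₀ ℤ) →ₗ[ℤ] (E (n + 1) →₀ ℤ)}
    {s' : (E (n + 1) →₀ ℤ) →ₗ[ℤ] (E (n + 2) →₀ ℤ)} (hs : IsStabMap G s ∧ IsPure G s)
    (hs' : IsStabMap G s' ∧ IsPure G s')
    (h : (grade G (M.d (n + 1))).comp s' + s.comp (grade G (M.d n)) = 1) :
    IsStabMap G ((M.d (n + 1)).comp s' + s.comp (M.d n)) ∧
      grade G ((M.d (n + 1)).comp s' + s.comp (M.d n)) = 1 := by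
  refine ⟨((M.isStabMap (n + 1)).comp hs'.1).add (hs.1.comp (M.isStabMap n)), ?_⟩
  rw [grade_add, grade_comp (M.isStabMap _) hs'.1, grade_comp hs.1 (M.isStabMap _),
    hs.2.grade_eq, hs'.2.grade_eq, h]

/-- If the relative cohomology vanishes above degree `m`, then the full complex has a contraction by
stabilizer-increasing equivariant maps in degree `m + 1`. It arises from a contraction of the graded
complex by the inverse of the unipotent chain map `d s + s d`. -/
theorem exists_contraction {m : ℕ}
    (hH : ∀ n, m < n → ∀ K : Subgroup G, Finite K → ¬ M.HasCohomology K n) :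
    ∃ (s : (E m →₀ ℤ) →ₗ[ℤ] (E (m + 1) →₀ ℤ)) (s' : (E (m + 1) →₀ ℤ) →ₗ[ℤ] (E (m + 2) →₀ ℤ)),
      IsStabMap G s ∧ IsStabMap G s' ∧ (M.d (m + 1)).comp s' + s.comp (M.d m) = 1 := by
  obtain ⟨s, s', s'', hs, hs', hs'', e1, e2⟩ := M.hasPureContraction hH le_rfl
  obtain ⟨hu, hu1⟩ := M.grade_perturbed hs hs' e1
  obtain ⟨hu', hu1'⟩ := M.grade_perturbed hs' hs'' e2
  obtain ⟨v, hv, huv, hvu⟩ := exists_inverse_of_grade_eq_one hu hu1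
  obtain ⟨v', hv', huv', hvu'⟩ := exists_inverse_of_grade_eq_one hu' hu1'
  have hcomm : (M.d (m + 1)).comp ((M.d (m + 2)).comp s'' + s'.comp (M.d (m + 1))) =
      ((M.d (m + 1)).comp s' + s.comp (M.d m)).comp (M.d (m + 1)) := by
    have h1 : (M.d (m + 1)).comp ((M.d (m + 2)).comp s'') = 0 := by
      rw [← LinearMap.comp_assoc, M.d_comp_d, LinearMap.zero_comp]
    have h2 : (s.comp (M.d m)).comp (M.d (m + 1)) = 0 := by
      rw [LinearMap.comp_assoc, M.d_comp_d, LinearMap.comp_zero]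
    rw [LinearMap.comp_add, LinearMap.add_comp, h1, h2, zero_add, add_zero, LinearMap.comp_assoc]
  -- `d s + s d` is a chain map, hence so is its inverse
  have hdv : (M.d (m + 1)).comp v' = v.comp (M.d (m + 1)) := by
    calc (M.d (m + 1)).comp v' =
          (v * ((M.d (m + 1)).comp s' + s.comp (M.d m))).comp ((M.d (m + 1)).comp v') := by
            rw [hvu]; rfl
      _ = v.comp ((((M.d (m + 1)).comp s' + s.comp (M.d m)).comp (M.d (m + 1))).comp v') := rfl
      _ = v.comp ((M.d (m + 1)).comp
            (((M.d (m + 2)).comp s'' + s'.comp (M.d (m + 1))) * v')) := by rw [← hcomm]; rfl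
      _ = _ := by rw [huv']; rfl
  refine ⟨v.comp s, v'.comp s', hv.comp hs.1, hv'.comp hs'.1, ?_⟩
  rw [← LinearMap.comp_assoc, hdv, LinearMap.comp_assoc, LinearMap.comp_assoc,
    ← LinearMap.comp_add]
  exact hvu

/-- The cohomology does not vanish in all degrees: otherwise `d : C₁ → C₀` would be surjective,
which is excluded by the augmentation, since there are vertices. -/
theorem exists_hasCohomology : ∃ (K : Subgroup G) (n : ℕ), Finite K ∧ M.HasCohomology K n := by
  by_contra hcon
  push Not at hcon
  obtain ⟨s, s', -, hs, hs', -, e1, -⟩ :=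
    M.hasPureContraction (m := 0) (fun n _ K hK => hcon K n hK) le_rfl
  obtain ⟨hψ, hp⟩ := M.isPure_one_sub hs.1 hs.2
  have h0 : 1 - (grade G (M.d 0)).comp s = 0 := by
    ext e x
    have hK : Finite (stabilizer G x) := IsProperCofinite.finite_stabilizer x
    have : transpose hψ.equivariant (gen x) = 0 := not_not.1 fun hc => hcon (stabilizer G x) 0 hK
      ⟨_, M.isRelCocycle_transpose hψ.equivariant hp (M.one_sub_comp_grade e1) x, hc⟩
    have h := transpose_gen_apply hψ.equivariant x e
    rw [this] at h
    exact h.symm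
  have h1 : grade G ((M.d 0).comp s) = 1 := by
    rw [grade_comp (M.isStabMap 0) hs.1, hs.2.grade_eq, ← sub_eq_zero.1 h0]
  obtain ⟨v, -, huv, -⟩ := exists_inverse_of_grade_eq_one ((M.isStabMap 0).comp hs.1) h1
  obtain ⟨e, -⟩ := M.exists_vertex ⊥ inferInstance
  have he : M.d 0 (s (v (gen e))) = gen e := LinearMap.congr_fun huv (gen e)
  have := M.sum_d (s (v (gen e)))
  rw [he] at this
  simp at this

/-- A contraction in degree `n + 1` kills the cohomology in this degree: the transpose of `s` maps a
cocycle to a cochain with the given coboundary, which still has to be cut off to the cells with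
stabilizer `K`. -/
theorem not_hasCohomology {n : ℕ} {s : (E n →₀ ℤ) →ₗ[ℤ] (E (n + 1) →₀ ℤ)}
    {s' : (E (n + 1) →₀ ℤ) →ₗ[ℤ] (E (n + 2) →₀ ℤ)} (hs : IsStabMap G s) (hs' : IsStabMap G s')
    (h : (M.d (n + 1)).comp s' + s.comp (M.d n) = 1) (K : Subgroup G) :
    ¬ M.HasCohomology K (n + 1) := by
  classical
  rintro ⟨f, ⟨hfK, hf⟩, hcob⟩
  -- the cocycle condition extends from cells to chains fixed by `K`
  have hvan : ∀ k ∈ fixedChains G (E (n + 2)) K,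
      Finsupp.linearCombination ℤ f (M.d (n + 1) k) = 0 := by
    intro k hk
    rw [← Finsupp.sum_single k, Finsupp.sum, map_sum, map_sum]
    refine Finset.sum_eq_zero fun e he => ?_
    have : Finsupp.single e (k e) = k e • gen e := by simp
    rw [this, map_smul, map_smul, hf e (mem_fixedChains.1 hk e (Finsupp.mem_support_iff.1 he)),
      smul_zero]
  refine hcob ⟨(transpose hs.equivariant f).filter fun e => stabilizer G e = K, fun e he => ?_,
    fun e he => ?_⟩
  · rw [Finsupp.filter_apply] at he
    exact (ite_ne_right_iff.1 he).1
  · have he' : gen e ∈ fixedChains G (E (n + 1)) K := by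
      refine mem_fixedChains.2 fun y hy => ?_
      obtain rfl : e = y := by
        by_contra h
        exact hy (Finsupp.single_eq_of_ne' h)
      exact he
    have h1 : gen e = M.d (n + 1) (s' (gen e)) + s (M.d n (gen e)) :=
      (LinearMap.congr_fun h (gen e)).symm
    have h2 : f e = Finsupp.linearCombination ℤ f (s (M.d n (gen e))) := by
      have := congrArg (Finsupp.linearCombination ℤ f) h1
      rwa [map_add, hvan _ (hs'.map_mem_fixedChains he'), zero_add,
        Finsupp.linearCombination_single, one_smul] at this
    have h3 : ∀ k, Finsupp.linearCombination ℤ f (s k) =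
        Finsupp.linearCombination ℤ (transpose hs.equivariant f) k := by
      intro k
      have : (Finsupp.linearCombination ℤ f).comp s =
          Finsupp.linearCombination ℤ (transpose hs.equivariant f) := by
        ext y
        simp [transpose_apply]
      exact LinearMap.congr_fun this k
    rw [h2, h3, Finsupp.linearCombination_apply, Finsupp.linearCombination_apply]
    refine Finset.sum_congr rfl fun y hy => ?_
    beta_reduce
    rw [Finsupp.filter_apply]
    split_ifs with hyK
    · rfl
    -- if the stabilizer of `y` is larger than `K`, then it is not contained in a stabilizer equal
    -- to `K`
    · have hKy : K ≤ stabilizer G y := he.trans ((M.isStabMap n).le e y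
      (Finsupp.mem_support_iff.1 hy))
      have : transpose hs.equivariant f y = 0 := by
        rw [transpose_apply, Finsupp.linearCombination_apply]
        refine Finset.sum_eq_zero fun x hx => ?_
        by_contra hne
        have hfx : f x ≠ 0 := fun h0 => hne (by simp [h0])
        have hyx := hs.le y x (Finsupp.mem_support_iff.1 hx)
        exact hyK (le_antisymm (hyx.trans (hfK x hfx).le) hKy)
      rw [this]

end CellModel
end

section Resolutions

open Limits

variable {C : Type*} [Category* C] [Abelian C]

/-! ### Shortening projective resolutions -/

/-- An exact sequence `⋯ → K₁ → K₀ → Z → 0` with projective `Kᵢ` as a projective resolution. -/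
def resolutionOfExact {Z : C} (K : ChainComplex C ℕ) (hK : ∀ n, Projective (K.X n))
    (ε : K.X 0 ⟶ Z) (w : K.d 1 0 ≫ ε = 0)
    (h : ∀ n, (ShortComplex.mk _ _ (K.d_comp_d (n + 2) (n + 1) n)).Exact)
    (h0 : (ShortComplex.mk _ _ w).Exact) (hε : Epi ε) : ProjectiveResolution Z where
  complex := K
  projective := hK
  π := (ChainComplex.toSingle₀Equiv _ _).symm ⟨ε, w⟩
  quasiIso := ⟨fun n => by
    cases n with
    | zero =>
      rw [ChainComplex.quasiIsoAt₀_iff, ShortComplex.quasiIso_iff_of_zeros']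
      · refine (ShortComplex.exact_and_epi_g_iff_of_iso ?_).2 ⟨h0, hε⟩
        exact ShortComplex.isoMk (Iso.refl _) (Iso.refl _) (Iso.refl _)
          ((Category.id_comp _).trans (Category.comp_id _).symm)
          ((Category.id_comp _).trans
            ((ChainComplex.toSingle₀Equiv_symm_apply_f_zero ε w).symm.trans
              (Category.comp_id _).symm))
      · exact K.shape _ _ (by simp)
      · rfl
      · rfl
    | succ n =>
      rw [quasiIsoAt_iff_exactAt']
      · rw [HomologicalComplex.exactAt_iff' _ (n + 1 + 1) (n + 1) n (by simp) (by simp)]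
        exact h n
      · apply ChainComplex.exactAt_succ_single_obj⟩

/-- The augmentation of a projective resolution as a single morphism. -/
theorem exists_augmentation {Z : C} (P : ProjectiveResolution Z) :
    ∃ (ε : P.complex.X 0 ⟶ Z) (w : P.complex.d 1 0 ≫ ε = 0),
      (ShortComplex.mk _ _ w).Exact ∧ Epi ε :=
  ⟨P.π.f 0, P.complex_d_comp_π_f_zero, P.exact₀, inferInstanceAs (Epi (P.π.f 0))⟩

theorem exact_comp_mono {X₁ X₂ X₃ X₄ : C} {f : X₁ ⟶ X₂} {g : X₂ ⟶ X₃} (w : f ≫ g = 0)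
    (i : X₃ ⟶ X₄) [Mono i] (w' : f ≫ g ≫ i = 0) :
    (ShortComplex.mk f (g ≫ i) w').Exact ↔ (ShortComplex.mk f g w).Exact := by
  let φ : ShortComplex.mk f g w ⟶ ShortComplex.mk f (g ≫ i) w' :=
    { τ₁ := 𝟙 _, τ₂ := 𝟙 _, τ₃ := i }
  have : Epi φ.τ₁ := inferInstanceAs (Epi (𝟙 X₁))
  have : IsIso φ.τ₂ := inferInstanceAs (IsIso (𝟙 X₂))
  have : Mono φ.τ₃ := inferInstanceAs (Mono i)
  exact (ShortComplex.exact_iff_of_epi_of_isIso_of_mono φ).symm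

theorem exact_epi_comp_kernel {X₁ X₂ X₃ : C} (g : X₂ ⟶ X₃) (p : X₁ ⟶ kernel g) [Epi p]
    (w : (p ≫ kernel.ι g) ≫ g = 0) : (ShortComplex.mk (p ≫ kernel.ι g) g w).Exact := by
  let φ : ShortComplex.mk (p ≫ kernel.ι g) g w ⟶
      ShortComplex.mk (kernel.ι g) g (kernel.condition g) :=
    { τ₁ := p, τ₂ := 𝟙 _, τ₃ := 𝟙 _ }
  have : Epi φ.τ₁ := inferInstanceAs (Epi p)
  have : IsIso φ.τ₂ := inferInstanceAs (IsIso (𝟙 X₂))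
  have : Mono φ.τ₃ := inferInstanceAs (Mono (𝟙 X₃))
  exact (ShortComplex.exact_iff_of_epi_of_isIso_of_mono φ).2
    (ShortComplex.exact_of_f_is_kernel _ (kernelIsKernel g))

/-- A partial contraction of a resolution in degree `m + 1`. -/
def HasContraction (K : ChainComplex C ℕ) (m : ℕ) : Prop :=
  ∃ (s : K.X m ⟶ K.X (m + 1)) (s' : K.X (m + 1) ⟶ K.X (m + 2)),
    K.d (m + 1) m ≫ s + s' ≫ K.d (m + 2) (m + 1) = 𝟙 _

/-- A resolution is contractible above the length of any other one. -/
theorem hasContraction_of_isZero {Z : C} (P Q : ProjectiveResolution Z) {m : ℕ}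
    (hQ : ∀ i, m < i → IsZero (Q.complex.X i)) {n : ℕ} (hn : m ≤ n) :
    HasContraction P.complex n := by
  let H := (ProjectiveResolution.homotopyEquiv P Q).homotopyHomInvId
  have h := H.comm (n + 1)
  rw [dNext_eq _ (show (ComplexShape.down ℕ).Rel (n + 1) n from rfl),
    prevD_eq _ (show (ComplexShape.down ℕ).Rel (n + 2) (n + 1) from rfl),
    HomologicalComplex.comp_f, (hQ (n + 1) (by omega)).eq_of_tgt
      ((ProjectiveResolution.homotopyEquiv P Q).hom.f (n + 1)) 0, zero_comp,
    HomologicalComplex.id_f] at h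
  refine ⟨-H.hom n (n + 1), -H.hom (n + 1) (n + 2), ?_⟩
  rw [Preadditive.comp_neg, Preadditive.neg_comp, ← neg_add, neg_eq_iff_add_eq_zero]
  exact h.symm

/-- A resolution that is contractible in degree `m + 1` can be replaced by one of length `m`:
the cokernel of the differential to degree `m` is projective. -/
theorem exists_resolution_of_hasContraction {m : ℕ} : ∀ {Z : C} (P : ProjectiveResolution Z),
    HasContraction P.complex m →
      ∃ Q : ProjectiveResolution Z, ∀ i, m < i → IsZero (Q.complex.X i) := by
  induction m with
  | zero =>
    rintro Z P ⟨s, s', h⟩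
    obtain ⟨ε, w, hex, hε⟩ := exists_augmentation P
    -- `𝟙 - s ≫ d` vanishes on boundaries, and splits the augmentation
    have hd : P.complex.d 1 0 ≫ (𝟙 _ - s ≫ P.complex.d 1 0) = 0 := by
      rw [Preadditive.comp_sub, Category.comp_id, ← Category.assoc, eq_sub_of_add_eq h,
        Preadditive.sub_comp, Category.assoc, P.complex.d_comp_d, comp_zero, sub_zero,
        Category.id_comp, sub_self]
    let σ : Z ⟶ P.complex.X 0 := hex.desc _ hd
    have hσ : ε ≫ σ = 𝟙 _ - s ≫ P.complex.d 1 0 := hex.g_desc _ hd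
    have hZ : Projective Z := by
      refine (Retract.mk σ ε ?_ : Retract Z (P.complex.X 0)).projective
      rw [← cancel_epi ε, reassoc_of% hσ, Preadditive.sub_comp, Category.assoc,
        w, comp_zero, sub_zero, Category.id_comp, Category.comp_id]
    refine ⟨ProjectiveResolution.self Z, fun i hi => ?_⟩
    exact HomologicalComplex.isZero_single_obj_X _ _ _ _ hi.ne'
  | succ m ih =>
    rintro Z P ⟨s, s', h⟩
    obtain ⟨ε, w, hex, hε⟩ := exists_augmentation P
    -- the truncated complex resolves the kernel of the augmentation; shorten this resolution
    have hw : P.complex.d 2 1 ≫ kernel.lift ε _ w = 0 := by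
      rw [← cancel_mono (kernel.ι ε), Category.assoc, kernel.lift_ι, P.complex.d_comp_d, zero_comp]
    have hex' : (ShortComplex.mk _ _ hw).Exact := by
      rw [← exact_comp_mono hw (kernel.ι ε) (by rw [kernel.lift_ι, P.complex.d_comp_d])]
      simpa only [kernel.lift_ι] using P.exact_succ 0
    obtain ⟨Q, hQ⟩ := ih (resolutionOfExact (ChainComplex.truncate.obj P.complex)
      (fun n => P.projective (n + 1)) (kernel.lift ε _ w) hw (fun n => P.exact_succ (n + 1)) hex'
      hex.epi_kernelLift) ⟨s, s', h⟩
    obtain ⟨η, v, hexη, hη⟩ := exists_augmentation Q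
    have hv : Q.complex.d 1 0 ≫ η ≫ kernel.ι ε = 0 := by rw [reassoc_of% v, zero_comp]
    have hv' : (η ≫ kernel.ι ε) ≫ ε = 0 := by rw [Category.assoc, kernel.condition, comp_zero]
    refine ⟨resolutionOfExact (ChainComplex.augment Q.complex (η ≫ kernel.ι ε) hv)
      (fun n => ?_) ε hv' (fun n => ?_) (exact_epi_comp_kernel ε η hv') hε, fun i hi => ?_⟩
    · cases n with
      | zero => exact P.projective 0
      | succ n => exact Q.projective n
    · cases n with
      | zero => exact (exact_comp_mono v (kernel.ι ε) hv).2 hexη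
      | succ n => exact Q.exact_succ n
    · cases i with
      | zero => omega
      | succ i => exact hQ i (by omega)

end Resolutions

section FixedModule

open MulAction Opposite

/-! ### The Bredon module of a `G`-set -/

variable {G : Type v} [Group G]

/-- The `G`-map from `G ⧸ H` to a `G`-set that is given by a point fixed by `H`. -/
def orbitMap {H : Subgroup G} {Y : Type*} [MulAction G Y] (y : Y) (h : H ≤ stabilizer G y) :
    (G ⧸ H) →[G] Y where
  toFun q := Quotient.liftOn' q (fun g => g • y) fun a b hab => by
    have := h (QuotientGroup.leftRel_apply.1 hab)
    rw [mem_stabilizer_iff, mul_smul, inv_smul_eq_iff] at this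
    exact this.symm
  map_smul' g q := by
    induction q using QuotientGroup.induction_on with
    | H a => exact mul_smul g a y

theorem orbitMap_mk {H : Subgroup G} {Y : Type*} [MulAction G Y] (y : Y)
    (h : H ≤ stabilizer G y) (g : G) : orbitMap y h (g : G ⧸ H) = g • y := rfl

theorem orbitMap_one {H : Subgroup G} {Y : Type*} [MulAction G Y] (y : Y)
    (h : H ≤ stabilizer G y) : orbitMap y h ((1 : G) : G ⧸ H) = y := one_smul _ _

theorem apply_mk {H : Subgroup G} {Y : Type*} [MulAction G Y] (σ : (G ⧸ H) →[G] Y) (g : G) :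
    σ (g : G ⧸ H) = g • σ ((1 : G) : G ⧸ H) := by
  rw [← map_smul, MulAction.Quotient.smul_coe, smul_eq_mul, mul_one]

theorem hom_ext_one {H : Subgroup G} {Y : Type*} [MulAction G Y] {σ τ : (G ⧸ H) →[G] Y}
    (h : σ ((1 : G) : G ⧸ H) = τ ((1 : G) : G ⧸ H)) : σ = τ := by
  ext q
  induction q using QuotientGroup.induction_on with
  | H a => rw [apply_mk, h, ← apply_mk]

theorem le_stabilizer_apply_one {H : Subgroup G} {Y : Type*} [MulAction G Y]
    (σ : (G ⧸ H) →[G] Y) : H ≤ stabilizer G (σ ((1 : G) : G ⧸ H)) := fun g hg => by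
  rw [mem_stabilizer_iff, ← apply_mk]
  exact congrArg σ (QuotientGroup.eq.2 (by simpa using hg))

variable {E : Type w} [MulAction G E] [IsProperCofinite G E]
  {E' : Type w'} [MulAction G E'] [IsProperCofinite G E']

instance (H : Subgroup G) : Small.{v} ((G ⧸ H) →[G] E) := by
  obtain ⟨R, hR, hR'⟩ := exists_finite_representatives (G := G) (E := E)
  have := hR.to_subtype
  have : Small.{v} E := small_of_surjective (f := fun p : G × R => p.1 • (p.2 : E)) fun e => by
    obtain ⟨g, r, hr, h⟩ := hR' e
    exact ⟨(g, ⟨r, hr⟩), h⟩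
  exact small_of_injective (f := fun σ : (G ⧸ H) →[G] E => σ ((1 : G) : G ⧸ H))
    fun _ _ h => hom_ext_one h

variable (G E) in
/-- The free Bredon module of a `G`-set `E`: its value at `G ⧸ H` is the free abelian group on the
set of `G`-maps `G ⧸ H → E`, that is, on the set of points fixed by `H`. -/
def fixedModule : OrbitModule G where
  obj A := ModuleCat.of ℤ (Shrink.{v} ((G ⧸ A.unop.sub) →[G] E) →₀ ℤ)
  map α := ModuleCat.ofHom (Finsupp.lmapDomain ℤ ℤ fun σ =>
    equivShrink _ (((equivShrink _).symm σ).comp α.unop))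
  map_id A := ModuleCat.hom_ext <| Finsupp.lhom_ext' fun σ => LinearMap.ext_ring <|
    Finsupp.mapDomain_single.trans <|
      congrArg (fun x => Finsupp.single x (1 : ℤ)) ((equivShrink _).apply_symm_apply σ)
  map_comp α β := ModuleCat.hom_ext <| Finsupp.lhom_ext' fun σ => LinearMap.ext_ring <| by
    refine Finsupp.mapDomain_single.trans (Eq.symm ?_)
    refine (congrArg (Finsupp.mapDomain _) Finsupp.mapDomain_single).trans
      (Finsupp.mapDomain_single.trans ?_)
    rw [Equiv.symm_apply_apply]
    rfl

/-- The chain in `E` that is given by an element of the Bredon module of `E`. -/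
def toChains (A : (OrbitCat G)ᵒᵖ) : (fixedModule G E).obj A →ₗ[ℤ] (E →₀ ℤ) :=
  Finsupp.lmapDomain ℤ ℤ fun σ : Shrink.{v} ((G ⧸ A.unop.sub) →[G] E) =>
    (equivShrink _).symm σ ((1 : G) : G ⧸ A.unop.sub)

/-- The basis element of the Bredon module given by a fixed point. -/
def basisElement (A : (OrbitCat G)ᵒᵖ) (e : E) (h : A.unop.sub ≤ stabilizer G e) :
    (fixedModule G E).obj A :=
  Finsupp.single (equivShrink ((G ⧸ A.unop.sub) →[G] E) (orbitMap e h)) (1 : ℤ)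

theorem toChains_basisElement (A : (OrbitCat G)ᵒᵖ) (e : E) (h : A.unop.sub ≤ stabilizer G e) :
    toChains A (basisElement A e h) = gen e := by
  refine Finsupp.mapDomain_single.trans ?_
  rw [Equiv.symm_apply_apply, orbitMap_one]

theorem fixedModule_hom_ext {A : (OrbitCat G)ᵒᵖ} {N : Type*} [AddCommGroup N] [Module ℤ N]
    {f g : (fixedModule G E).obj A →ₗ[ℤ] N}
    (h : ∀ e he, f (basisElement A e he) = g (basisElement A e he)) : f = g := by
  refine Finsupp.lhom_ext' fun σ => LinearMap.ext_ring ?_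
  have := h _ (le_stabilizer_apply_one ((equivShrink _).symm σ))
  have h1 : basisElement A _ (le_stabilizer_apply_one ((equivShrink _).symm σ)) =
      (Finsupp.single σ (1 : ℤ) : _ →₀ ℤ) := by
    rw [basisElement]
    congr 1
    rw [← Equiv.eq_symm_apply]
    exact hom_ext_one (orbitMap_one _ _)
  rw [h1] at this
  exact this

theorem toChains_injective (A : (OrbitCat G)ᵒᵖ) :
    Function.Injective (toChains (E := E) A) :=
  Finsupp.mapDomain_injective fun _ _ h => (equivShrink _).symm.injective (hom_ext_one h)

/-- The chain given by an element of the value at `G ⧸ H` is fixed by `H`. -/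
theorem toChains_mem (A : (OrbitCat G)ᵒᵖ) (x : (fixedModule G E).obj A) :
    toChains A x ∈ fixedChains G E A.unop.sub := by
  have : (fixedChains G E A.unop.sub).mkQ.comp (toChains A) = 0 := fixedModule_hom_ext fun e h => by
    rw [LinearMap.comp_apply, toChains_basisElement]
    refine (Submodule.Quotient.mk_eq_zero _).2 (Finsupp.single_mem_supported _ _ ?_)
    exact h
  exact (Submodule.Quotient.mk_eq_zero _).1 (LinearMap.congr_fun this x)

theorem exists_toChains_eq {A : (OrbitCat G)ᵒᵖ} {k : E →₀ ℤ}
    (hk : k ∈ fixedChains G E A.unop.sub) : ∃ x, toChains A x = k := by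
  suffices fixedChains G E A.unop.sub ≤ LinearMap.range (toChains (E := E) A) from this hk
  rw [fixedChains, Finsupp.supported_eq_span_single, Submodule.span_le]
  rintro _ ⟨e, he, rfl⟩
  exact ⟨basisElement A e he, toChains_basisElement A e he⟩

theorem map_basisElement {A B : (OrbitCat G)ᵒᵖ} (α : A ⟶ B) (g : G)
    (hg : (show (G ⧸ B.unop.sub) →[G] (G ⧸ A.unop.sub) from α.unop) ((1 : G) : G ⧸ B.unop.sub) = g)
    (e : E) (he : A.unop.sub ≤ stabilizer G e) :
    ∃ h, (fixedModule G E).map α (basisElement A e he) = basisElement B (g • e) h := by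
  have h1 : (orbitMap e he).comp
      (show (G ⧸ B.unop.sub) →[G] (G ⧸ A.unop.sub) from α.unop) ((1 : G) : G ⧸ B.unop.sub) =
      g • e := by
    rw [MulActionHom.comp_apply, hg, orbitMap_mk]
  have h2 : B.unop.sub ≤ stabilizer G (g • e) := h1 ▸ le_stabilizer_apply_one _
  refine ⟨h2, Finsupp.mapDomain_single.trans (congrArg (fun x => Finsupp.single x (1 : ℤ)) ?_)⟩
  rw [Equiv.symm_apply_apply]
  exact congrArg _ (hom_ext_one (h1.trans (orbitMap_one _ _).symm))

/-- In terms of chains, the morphism given by a group element `g` acts by translation with `g`. -/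
theorem toChains_map {A B : (OrbitCat G)ᵒᵖ} (α : A ⟶ B) (g : G)
    (hg : (show (G ⧸ B.unop.sub) →[G] (G ⧸ A.unop.sub) from α.unop) ((1 : G) : G ⧸ B.unop.sub) = g)
    (x : (fixedModule G E).obj A) :
    toChains B ((fixedModule G E).map α x) = (toChains A x).mapDomain (g • ·) := by
  have : (toChains B).comp ((fixedModule G E).map α).hom =
      (Finsupp.lmapDomain ℤ ℤ (g • ·)).comp (toChains (E := E) A) :=
    fixedModule_hom_ext fun e he => by
      obtain ⟨h, h'⟩ := map_basisElement α g hg e he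
      simp only [LinearMap.comp_apply]
      rw [h', toChains_basisElement, toChains_basisElement, Finsupp.lmapDomain_apply,
        Finsupp.mapDomain_single]
  exact LinearMap.congr_fun this x

/-- A morphism `G ⧸ H → G ⧸ K` of the orbit category is given by a group element, the image of the
identity coset. -/
theorem exists_rep {A B : (OrbitCat G)ᵒᵖ} (α : A ⟶ B) :
    ∃ g : G, (show (G ⧸ B.unop.sub) →[G] (G ⧸ A.unop.sub) from α.unop)
      ((1 : G) : G ⧸ B.unop.sub) = g :=
  ⟨_, (Quotient.out_eq' _).symm⟩

/-- The value of the Bredon module at `G ⧸ H` is the group of chains fixed by `H`. -/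
def toFixedChains (A : (OrbitCat G)ᵒᵖ) :
    (fixedModule G E).obj A ≃ₗ[ℤ] fixedChains G E A.unop.sub :=
  LinearEquiv.ofBijective ((toChains A).codRestrict _ (toChains_mem A))
    ⟨fun _ _ h => toChains_injective A (congrArg Subtype.val h), fun k => by
      obtain ⟨x, hx⟩ := exists_toChains_eq k.2
      exact ⟨x, Subtype.ext hx⟩⟩

theorem toChains_toFixedChains_symm (A : (OrbitCat G)ᵒᵖ) (k : fixedChains G E A.unop.sub) :
    toChains A ((toFixedChains A).symm k) = k :=
  congrArg Subtype.val ((toFixedChains A).apply_symm_apply k)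

/-- The morphism of Bredon modules induced by a map of permutation modules. -/
def homOfStabMap (T : (E →₀ ℤ) →ₗ[ℤ] (E' →₀ ℤ)) (hT : IsStabMap G T) :
    fixedModule G E ⟶ fixedModule G E' where
  app A := ModuleCat.ofHom ((toFixedChains A).symm.toLinearMap.comp
    ((T.restrict fun _ => hT.map_mem_fixedChains).comp (toFixedChains A).toLinearMap))
  naturality A B α := by
    ext x
    obtain ⟨g, hg⟩ := exists_rep α
    refine toChains_injective B ?_
    refine (toChains_toFixedChains_symm _ _).trans ?_
    refine Eq.trans ?_ (toChains_map α g hg _).symm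
    refine Eq.trans ?_ (congrArg (Finsupp.mapDomain (g • ·))
      (toChains_toFixedChains_symm _ _)).symm
    refine (congrArg T (toChains_map α g hg x)).trans ?_
    exact hT.equivariant.map_mapDomain g _

theorem toChains_homOfStabMap {T : (E →₀ ℤ) →ₗ[ℤ] (E' →₀ ℤ)} (hT : IsStabMap G T)
    (A : (OrbitCat G)ᵒᵖ) (x : (fixedModule G E).obj A) :
    toChains A ((homOfStabMap T hT).app A x) = T (toChains A x) :=
  toChains_toFixedChains_symm _ _

theorem hom_ext_toChains {M : OrbitModule G} {f g : M ⟶ fixedModule G E}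
    (h : ∀ A x, toChains A (f.app A x) = toChains A (g.app A x)) : f = g := by
  ext A x
  exact toChains_injective A (h A x)

/-- The stabilizer of a point as an object of the orbit category. -/
def stabilizerObj (e : E) : (OrbitCat G)ᵒᵖ :=
  op ⟨stabilizer G e, IsProperCofinite.finite_stabilizer e⟩

/-- The map of permutation modules given by a morphism of Bredon modules. -/
def stabMapOfHom (f : fixedModule G E ⟶ fixedModule G E') : (E →₀ ℤ) →ₗ[ℤ] (E' →₀ ℤ) :=
  Finsupp.linearCombination ℤ fun e =>
    toChains (stabilizerObj (G := G) e) (f.app _ (basisElement (stabilizerObj (G := G) e) e le_rfl))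

/-- The morphism `G ⧸ A → G ⧸ Gₑ` of the orbit category given by `g` such that `A` fixes `g • e`. -/
def homToStabilizer (A : (OrbitCat G)ᵒᵖ) (g : G) (e : E) (h : A.unop.sub ≤ stabilizer G (g • e)) :
    stabilizerObj (G := G) e ⟶ A :=
  Quiver.Hom.op (X := A.unop) (Y := (stabilizerObj (G := G) e).unop)
    (orbitMap (g : G ⧸ stabilizer G e) fun a ha => by
      have := h ha
      rw [mem_stabilizer_iff] at this ⊢
      rw [Quotient.smul_coe, eq_comm, QuotientGroup.eq, mem_stabilizer_iff, smul_eq_mul, mul_smul,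
        mul_smul, this, inv_smul_smul] :
      (G ⧸ A.unop.sub) →[G] (G ⧸ stabilizer G e))

theorem homToStabilizer_one (A : (OrbitCat G)ᵒᵖ) (g : G) (e : E)
    (h : A.unop.sub ≤ stabilizer G (g • e)) :
    (show (G ⧸ A.unop.sub) →[G] (G ⧸ stabilizer G e) from (homToStabilizer A g e h).unop)
      ((1 : G) : G ⧸ A.unop.sub) = g :=
  one_smul G (g : G ⧸ stabilizer G e)

theorem map_homToStabilizer (A : (OrbitCat G)ᵒᵖ) (g : G) (e : E)
    (h : A.unop.sub ≤ stabilizer G (g • e)) :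
    (fixedModule G E).map (homToStabilizer A g e h) (basisElement _ e le_rfl) =
      basisElement A (g • e) h :=
  (map_basisElement (homToStabilizer A g e h) g (homToStabilizer_one A g e h) e le_rfl).2

/-- A morphism of free Bredon modules acts on all values by one and the same map of chains. -/
theorem toChains_app (f : fixedModule G E ⟶ fixedModule G E') (A : (OrbitCat G)ᵒᵖ)
    (x : (fixedModule G E).obj A) : toChains A (f.app A x) = stabMapOfHom f (toChains A x) := by
  have : (toChains A).comp (f.app A).hom = (stabMapOfHom f).comp (toChains A) :=
    fixedModule_hom_ext fun e he => by
      have he' : A.unop.sub ≤ stabilizer G ((1 : G) • e) := by rwa [one_smul]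
      have h1 := map_homToStabilizer A 1 e he'
      simp only [one_smul] at h1
      have h2 := NatTrans.naturality_apply f (homToStabilizer A 1 e he') (basisElement _ e le_rfl)
      simp only [LinearMap.comp_apply]
      rw [← h1]
      refine (congrArg (toChains A) h2).trans ?_
      rw [toChains_map _ 1 (homToStabilizer_one A 1 e he'), h1, toChains_basisElement, stabMapOfHom,
        Finsupp.linearCombination_single, one_smul]
      simp only [one_smul]
      exact Finsupp.mapDomain_id
  exact LinearMap.congr_fun this x

theorem isStabMap_stabMapOfHom (f : fixedModule G E ⟶ fixedModule G E') :
    IsStabMap G (stabMapOfHom f) where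
  equivariant g e x := by
    have h1 := map_homToStabilizer (stabilizerObj (G := G) (g • e)) g e le_rfl
    have h2 := NatTrans.naturality_apply f (homToStabilizer (stabilizerObj (G := G) (g • e)) g e
      le_rfl) (basisElement _ e le_rfl)
    rw [stabMapOfHom, Finsupp.linearCombination_single, one_smul,
      Finsupp.linearCombination_single, one_smul, ← h1]
    refine (DFunLike.congr_fun (congrArg (toChains _) h2) (g • x)).trans ?_
    rw [toChains_map _ g (homToStabilizer_one _ g e le_rfl), mapDomain_smul_apply, inv_smul_smul]
  le e x hx := by
    rw [stabMapOfHom, Finsupp.linearCombination_single, one_smul] at hx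
    exact mem_fixedChains.1 (toChains_mem _ _) x hx

end FixedModule

section BredonResolution

open MulAction Opposite Limits

variable {G : Type v} [Group G]
variable {E : Type w} [MulAction G E] [IsProperCofinite G E]
  {E' : Type w'} [MulAction G E'] [IsProperCofinite G E']

/-! ### The projective resolution given by a cocompact model -/

/-- The maps to `G ⧸ Gₑ` are compatible with composition in the orbit category. -/
theorem homToStabilizer_comp {A B : (OrbitCat G)ᵒᵖ} (α : A ⟶ B) (a g : G)
    (ha : (show (G ⧸ B.unop.sub) →[G] (G ⧸ A.unop.sub) from α.unop) ((1 : G) : G ⧸ B.unop.sub) = a)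
    (e : E) (h : A.unop.sub ≤ stabilizer G (g • e)) (b : G) (h' : B.unop.sub ≤ stabilizer G (b • e))
    (hb : (a * g) • e = b • e) :
    homToStabilizer A g e h ≫ α = homToStabilizer B b e h' := by
  refine Quiver.Hom.unop_inj (hom_ext_one (Y := G ⧸ stabilizer G e) ?_)
  refine Eq.trans ?_ (homToStabilizer_one B b e h').symm
  change (show (G ⧸ A.unop.sub) →[G] (G ⧸ stabilizer G e) from (homToStabilizer A g e h).unop)
    ((show (G ⧸ B.unop.sub) →[G] (G ⧸ A.unop.sub) from α.unop) ((1 : G) : G ⧸ B.unop.sub)) = _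
  rw [ha, apply_mk, homToStabilizer_one, Quotient.smul_coe, QuotientGroup.eq, mem_stabilizer_iff,
    mul_smul, ← hb, inv_smul_eq_iff, smul_eq_mul]

theorem basisElement_congr {A : (OrbitCat G)ᵒᵖ} {e e' : E} (h : e = e')
    (he : A.unop.sub ≤ stabilizer G e) (he' : A.unop.sub ≤ stabilizer G e') :
    basisElement A e he = basisElement A e' he' := by
  subst h
  rfl

/-- Free Bredon modules are projective: morphisms from the free module of `E` to `M` correspond to
the choice of an element of `M (G ⧸ Gₑ)` for each representative `e` of an orbit. -/
instance : Projective (fixedModule G E) where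
  factors {M N} η f hf := by
    let r : E → E := fun e => (Quotient.mk (orbitRel G E) e).out
    have hr : ∀ e, ∃ g : G, g • r e = e := fun e =>
      orbitRel_apply.1 (Setoid.symm' _ (Quotient.exact (Quotient.mk (orbitRel G E) e).out_eq))
    have hr' : ∀ (g : G) e, r (g • e) = r e := fun g e =>
      congrArg Quotient.out (Quotient.sound (orbitRel_apply.2 ⟨g, rfl⟩))
    choose c hc using hr
    have hsurj : ∀ A, Function.Surjective (f.app A) := fun A =>
      (ModuleCat.epi_iff_surjective _).1 inferInstance
    choose m hm using fun e : E =>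
      hsurj (stabilizerObj (G := G) e) (η.app _ (basisElement _ e le_rfl))
    -- the image of the basis element given by `e`
    let val : ∀ (A : (OrbitCat G)ᵒᵖ) (e : E), A.unop.sub ≤ stabilizer G e → M.obj A :=
      fun A e h => M.map (homToStabilizer A (c e) (r e) (by rwa [hc])) (m (r e))
    let φ : ∀ A, (fixedModule G E).obj A →ₗ[ℤ] M.obj A := fun A =>
      Finsupp.linearCombination ℤ fun σ : Shrink.{v} ((G ⧸ A.unop.sub) →[G] E) =>
        val A _ (le_stabilizer_apply_one ((equivShrink _).symm σ))
    have hval : ∀ {A e e'} h h', e = e' → val A e h = val A e' h' := by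
      rintro A e _ h h' rfl
      rfl
    have hval' : ∀ {A e} h {r₀} (g : G) h', r₀ = r e → g • r₀ = e →
        val A e h = M.map (homToStabilizer A g r₀ h') (m r₀) := by
      rintro A e h _ g h' rfl hg
      have := homToStabilizer_comp (𝟙 A) 1 (c e) rfl (r e) (by rwa [hc]) g h'
        (by rw [one_mul, hc, hg])
      rw [Category.comp_id] at this
      rw [← this]
    have hφ : ∀ A e h, φ A (basisElement A e h) = val A e h := by
      intro A e h
      refine (Finsupp.linearCombination_single ℤ _ _).trans ((@one_smul ℤ (M.obj A) _
        (M.obj A).isModule.toMulAction _).trans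
        (hval (le_stabilizer_apply_one _) h ?_))
      rw [Equiv.symm_apply_apply, orbitMap_one]
    refine ⟨{ app := fun A => ModuleCat.ofHom (φ A), naturality := fun A B α => ?_ }, ?_⟩
    · refine ModuleCat.hom_ext (fixedModule_hom_ext fun e he => ?_)
      obtain ⟨a, ha⟩ := exists_rep α
      obtain ⟨h, h'⟩ := map_basisElement α a ha e he
      change φ B ((fixedModule G E).map α (basisElement A e he)) = M.map α (φ A
        (basisElement A e he))
      rw [h', hφ, hφ]
      have h1 : a • c e • r e = a • e := by rw [hc]
      rw [hval' h (a * c e) (by rw [mul_smul, h1]; exact h) (hr' a e).symm (by rw [mul_smul, h1])]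
      change _ = M.map α (M.map _ _)
      rw [← ConcreteCategory.comp_apply, ← M.map_comp,
        homToStabilizer_comp α a (c e) ha (r e) (by rwa [hc]) (a * c e)
          (by rw [mul_smul, h1]; exact h) rfl]
    · ext A : 2
      refine ModuleCat.hom_ext (fixedModule_hom_ext fun e he => ?_)
      change f.app A (φ A (basisElement A e he)) = η.app A (basisElement A e he)
      rw [hφ]
      change f.app A (M.map _ _) = _
      rw [NatTrans.naturality_apply, hm, ← NatTrans.naturality_apply, map_homToStabilizer,
        basisElement_congr (hc e) _ he]

/-- Exactness of Bredon modules can be checked on the values. -/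
theorem exact_of_forall_apply {S : ShortComplex (OrbitModule G)}
    (h : ∀ A x, S.g.app A x = 0 → ∃ y, S.f.app A y = x) : S.Exact := by
  rw [ShortComplex.exact_iff_isZero_homology, Functor.isZero_iff]
  intro A
  have : (S.map ((evaluation _ _).obj A)).Exact :=
    (ShortComplex.moduleCat_exact_iff _).2 (h A)
  exact ((ShortComplex.exact_iff_isZero_homology _).1 this).of_iso
    (S.mapHomologyIso ((evaluation (OrbitCat G)ᵒᵖ (ModuleCat.{v} ℤ)).obj A)).symm

variable (G E) in
/-- The augmentation of the free Bredon module: the sum of the coefficients. -/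
def bredonAugmentation : fixedModule G E ⟶ trivialModule G where
  app A := ModuleCat.ofHom ((ULift.moduleEquiv (R := ℤ) (M := ℤ)).symm.toLinearMap.comp
    ((Finsupp.linearCombination ℤ fun _ : E => (1 : ℤ)).comp (toChains A)))
  naturality A B α := by
    ext x
    obtain ⟨g, hg⟩ := exists_rep α
    refine congrArg ULift.up ?_
    change Finsupp.linearCombination ℤ (fun _ : E => (1 : ℤ)) (toChains B
      ((fixedModule G E).map α x))
      = Finsupp.linearCombination ℤ (fun _ : E => (1 : ℤ)) (toChains A x)
    rw [toChains_map α g hg, Finsupp.linearCombination_mapDomain]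
    rfl

theorem bredonAugmentation_apply (A : (OrbitCat G)ᵒᵖ) (x : (fixedModule G E).obj A) :
    (bredonAugmentation G E).app A x = ULift.up ((toChains A x).sum fun _ a => a) := by
  refine congrArg ULift.up ?_
  refine (Finsupp.linearCombination_apply _ _).trans ?_
  simp only [smul_eq_mul, mul_one]
  rfl

namespace CellModel

variable {E : ℕ → Type w} [∀ n, MulAction G (E n)] [∀ n, IsProperCofinite G (E n)]
  (M : CellModel G E)

/-- The Bredon chain complex. -/
def complex : ChainComplex (OrbitModule G) ℕ :=
  ChainComplex.of (fun n => fixedModule G (E n)) (fun n => homOfStabMap (M.d n) (M.isStabMap n))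
    fun n => hom_ext_toChains fun A x => by
      refine (toChains_homOfStabMap (M.isStabMap n) A _).trans ?_
      refine (congrArg (M.d n) (toChains_homOfStabMap (M.isStabMap (n + 1)) A x)).trans ?_
      exact (LinearMap.congr_fun (M.d_comp_d n) _).trans (map_zero (toChains A)).symm

theorem complex_d (n : ℕ) :
    M.complex.d (n + 1) n = homOfStabMap (M.d n) (M.isStabMap n) :=
  ChainComplex.of_d (fun n => fixedModule G (E n))
    (fun n => homOfStabMap (M.d n) (M.isStabMap n)) n

theorem homOfStabMap_d_augmentation :
    homOfStabMap (M.d 0) (M.isStabMap 0) ≫ bredonAugmentation G (E 0) = 0 := by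
  have h : ∀ A (x : (fixedModule G (E 1)).obj A), (bredonAugmentation G (E 0)).app A
      ((homOfStabMap (M.d 0) (M.isStabMap 0)).app A x) = ULift.up (0 : ℤ) := fun A x => by
    rw [bredonAugmentation_apply, toChains_homOfStabMap, M.sum_d]
  refine NatTrans.ext (funext fun A => ModuleCat.hom_ext (LinearMap.ext fun x => ?_))
  exact h A x

theorem complex_d_augmentation : M.complex.d 1 0 ≫ bredonAugmentation G (E 0) = 0 :=
  (congrArg (· ≫ bredonAugmentation G (E 0)) (M.complex_d 0)).trans M.homOfStabMap_d_augmentation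

/-- The Bredon chain complex of a cocompact model is a projective resolution. -/
def resolution : ProjectiveResolution (trivialModule G) :=
  resolutionOfExact M.complex (fun n => inferInstanceAs (Projective (fixedModule G (E n))))
    (bredonAugmentation G (E 0)) M.complex_d_augmentation
    (fun n => exact_of_forall_apply fun A x hx => by
      have hx' : M.d n (toChains A x) = 0 := by
        rw [← toChains_homOfStabMap (M.isStabMap n) A x, ← complex_d]
        exact (congrArg (toChains A) hx).trans (map_zero _)
      obtain ⟨l, hl, hl'⟩ := M.exact A.unop.sub A.unop.finite n _ (toChains_mem A x) hx'
      obtain ⟨y, rfl⟩ := exists_toChains_eq hl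
      refine ⟨y, toChains_injective A ?_⟩
      change toChains A ((M.complex.d (n + 2) (n + 1)).app A y) = _
      rw [M.complex_d (n + 1)]
      exact (toChains_homOfStabMap (M.isStabMap (n + 1)) A y).trans hl')
    (exact_of_forall_apply fun A x hx => by
      have hx' := congrArg ULift.down ((bredonAugmentation_apply A x).symm.trans hx)
      obtain ⟨l, hl, hl'⟩ := M.exact_zero A.unop.sub A.unop.finite _ (toChains_mem A x) hx'
      obtain ⟨y, rfl⟩ := exists_toChains_eq hl
      refine ⟨y, toChains_injective A ?_⟩
      change toChains A ((M.complex.d 1 0).app A y) = _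
      rw [M.complex_d 0]
      exact (toChains_homOfStabMap (M.isStabMap 0) A y).trans hl')
    (by
      refine (NatTrans.epi_iff_epi_app _).2 fun A => (ModuleCat.epi_iff_surjective _).2 ?_
      rintro ⟨a⟩
      obtain ⟨e, he⟩ := M.exists_vertex A.unop.sub A.unop.finite
      refine ⟨a • basisElement A e he, ?_⟩
      refine (bredonAugmentation_apply A _).trans (congrArg ULift.up ?_)
      rw [map_smul, toChains_basisElement]
      simp)

theorem stabMapOfHom_contraction {m : ℕ} {s : fixedModule G (E m) ⟶ fixedModule G (E (m + 1))}
    {s' : fixedModule G (E (m + 1)) ⟶ fixedModule G (E (m + 2))}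
    (h : homOfStabMap _ (M.isStabMap m) ≫ s + s' ≫ homOfStabMap _ (M.isStabMap (m + 1)) = 𝟙 _) :
    (M.d (m + 1)).comp (stabMapOfHom s') + (stabMapOfHom s).comp (M.d m) = 1 := by
  refine Finsupp.lhom_ext' fun e => LinearMap.ext_ring ?_
  change M.d (m + 1) (stabMapOfHom s' (gen e)) + stabMapOfHom s (M.d m (gen e)) = gen e
  let b := basisElement (stabilizerObj (G := G) e) e le_rfl
  have hb : toChains _ b = gen e := toChains_basisElement _ _ _
  have h1 : toChains _ (s.app _ ((homOfStabMap _ (M.isStabMap m)).app _ b)) +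
      toChains _ ((homOfStabMap _ (M.isStabMap (m + 1))).app _ (s'.app _ b)) = toChains _ b :=
    (map_add (toChains _) _ _).symm.trans (congrArg (toChains _)
      (congrArg (fun φ : fixedModule G (E (m + 1)) ⟶ fixedModule G (E (m + 1)) => φ.app _ b) h))
  rw [toChains_app, toChains_homOfStabMap, toChains_homOfStabMap, toChains_app, hb] at h1
  exact (add_comm _ _).trans h1

theorem homOfStabMap_contraction {m : ℕ} {s : (E m →₀ ℤ) →ₗ[ℤ] (E (m + 1) →₀ ℤ)}
    {s' : (E (m + 1) →₀ ℤ) →ₗ[ℤ] (E (m + 2) →₀ ℤ)} (hs : IsStabMap G s) (hs' : IsStabMap G s')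
    (h : (M.d (m + 1)).comp s' + s.comp (M.d m) = 1) :
    homOfStabMap _ (M.isStabMap m) ≫ homOfStabMap s hs +
      homOfStabMap s' hs' ≫ homOfStabMap _ (M.isStabMap (m + 1)) = 𝟙 _ := by
  refine hom_ext_toChains fun A x => ?_
  have h1 : toChains A ((homOfStabMap s hs).app A ((homOfStabMap _ (M.isStabMap m)).app A x)) +
      toChains A ((homOfStabMap _ (M.isStabMap (m + 1))).app A ((homOfStabMap s' hs').app A x)) =
      toChains A x := by
    rw [toChains_homOfStabMap, toChains_homOfStabMap, toChains_homOfStabMap,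
      toChains_homOfStabMap]
    exact (add_comm _ _).trans (LinearMap.congr_fun h (toChains A x))
  exact (map_add (toChains A) _ _).trans h1

/-- Contractions of the Bredon chain complex are contractions of the cellular complex by
equivariant, stabilizer-increasing maps. -/
theorem hasContraction_iff (m : ℕ) : HasContraction M.complex m ↔
    ∃ (s : (E m →₀ ℤ) →ₗ[ℤ] (E (m + 1) →₀ ℤ)) (s' : (E (m + 1) →₀ ℤ) →ₗ[ℤ] (E (m + 2) →₀ ℤ)),
      IsStabMap G s ∧ IsStabMap G s' ∧ (M.d (m + 1)).comp s' + s.comp (M.d m) = 1 := by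
  rw [HasContraction, complex_d, complex_d]
  constructor
  · rintro ⟨s, s', h⟩
    exact ⟨_, _, isStabMap_stabMapOfHom (E := E m) (E' := E (m + 1)) s,
      isStabMap_stabMapOfHom (E := E (m + 1)) (E' := E (m + 2)) s', M.stabMapOfHom_contraction h⟩
  · rintro ⟨s, s', hs, hs', h⟩
    exact ⟨homOfStabMap s hs, homOfStabMap s' hs', M.homOfStabMap_contraction hs hs' h⟩

/-- The trivial module has a resolution of length `m` if and only if the relative cohomology with
compact supports vanishes above degree `m`. -/
theorem hasResolutionOfLength_iff (m : ℕ) : HasResolutionOfLength G m ↔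
    ∀ n, m < n → ∀ K : Subgroup G, Finite K → ¬ M.HasCohomology K n := by
  constructor
  · rintro ⟨Q, hQ⟩ n hn K -
    obtain ⟨n, rfl⟩ := Nat.exists_eq_succ_of_ne_zero (Nat.ne_zero_of_lt hn)
    obtain ⟨s, s', hs, hs', h⟩ := (M.hasContraction_iff n).1
      (hasContraction_of_isZero M.resolution Q hQ (Nat.le_of_lt_succ hn))
    exact M.not_hasCohomology hs hs' h K
  · intro h
    exact exists_resolution_of_hasContraction M.resolution
      ((M.hasContraction_iff m).2 (M.exists_contraction h))

/-- The Bredon cohomological dimension is the largest degree with nonvanishing relative cohomology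
of the cell model. -/
theorem exists_bredonCd_eq : ∃ d : ℕ, bredonCd G = d ∧
    IsGreatest {n : ℕ | ∃ K : Subgroup G, Finite K ∧ M.HasCohomology K n} d := by
  classical
  obtain ⟨D, hD⟩ := M.finite_dimensional
  set S := {n : ℕ | ∃ K : Subgroup G, Finite K ∧ M.HasCohomology K n} with hS
  have hne : S.Nonempty := by
    obtain ⟨K, n, h⟩ := M.exists_hasCohomology
    exact ⟨n, K, h⟩
  have hbdd : BddAbove S := by
    refine ⟨D, fun n hn => ?_⟩
    obtain ⟨K, -, f, -, hf⟩ := hn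
    by_contra! hlt
    have := hD n hlt.le
    rw [Subsingleton.elim f 0] at hf
    refine hf ?_
    cases n with
    | zero => rfl
    | succ n => exact ⟨0, fun e he => absurd rfl he, fun e => this.elim e⟩
  have hgr : IsGreatest S (sSup S) := ⟨Nat.sSup_mem hne hbdd, fun n hn => le_csSup hbdd hn⟩
  refine ⟨sSup S, ?_, hgr⟩
  refine le_antisymm (iInf₂_le (sSup S) ?_) (le_iInf₂ fun m hm => ?_)
  · exact (M.hasResolutionOfLength_iff _).2 fun n hn K hK h => hn.not_ge (hgr.2 ⟨K, hK, h⟩)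
  · rw [Nat.cast_le]
    by_contra! hlt
    obtain ⟨K, hK, h⟩ := hgr.1
    exact (M.hasResolutionOfLength_iff m).1 hm _ hlt K hK h

end CellModel

end BredonResolution

section Cells

open RelCWComplex MulAction

/-! ### The action on the cells of a `G`-CW complex -/

variable {G : Type v} [Group G] {X : Type u} [TopologicalSpace X] [T2Space X] [MulAction G X]
  [ContinuousConstSMul G X] [CWComplex (Set.univ : Set X)]

theorem eq_of_mem_openCell {C : Set X} [CWComplex C] {n : ℕ} {e e' : cell C n} {x : X}
    (h : x ∈ openCell n e) (h' : x ∈ openCell n e') : e = e' := by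
  cases eq_of_not_disjoint_openCell (Set.not_disjoint_iff.2 ⟨x, h, h'⟩)
  rfl

theorem cell_eq_of_openCell_eq {C : Set X} [CWComplex C] {n : ℕ} {e e' : cell C n}
    (h : openCell n e = openCell n e') : e = e' :=
  eq_of_mem_openCell (map_zero_mem_openCell n e) (h ▸ map_zero_mem_openCell n e)

variable [hX : IsGCWComplex G X] {n : ℕ}

/-- The cells of a `G`-CW complex form a `G`-set. -/
instance : SMul G (cell (Set.univ : Set X) n) :=
  ⟨fun g e => (hX.smul_openCell g n e).choose⟩

theorem openCell_smul (g : G) (e : cell (Set.univ : Set X) n) :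
    openCell n (g • e) = (fun x => g • x) '' openCell n e :=
  (hX.smul_openCell g n e).choose_spec.symm

instance : MulAction G (cell (Set.univ : Set X) n) where
  one_smul e := cell_eq_of_openCell_eq (by rw [openCell_smul]; simp)
  mul_smul g h e := cell_eq_of_openCell_eq (by
    rw [openCell_smul, openCell_smul, openCell_smul, Set.image_image]
    simp only [mul_smul])

theorem smul_mem_openCell {g : G} {e : cell (Set.univ : Set X) n} {x : X}
    (hx : x ∈ openCell n e) : g • x ∈ openCell n (g • e) := by
  rw [openCell_smul]
  exact ⟨x, hx, rfl⟩

/-- All points of an open cell have the same stabilizer, namely that of the cell, because an element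
that maps a cell to itself fixes it pointwise. -/
theorem stabilizer_eq_of_mem_openCell {e : cell (Set.univ : Set X) n} {x : X}
    (hx : x ∈ openCell n e) : stabilizer G e = stabilizer G x := by
  ext g
  rw [mem_stabilizer_iff, mem_stabilizer_iff]
  constructor
  · intro h
    exact hX.smul_eq g n e (by rw [← openCell_smul, h]) x hx
  · intro h
    exact eq_of_mem_openCell (smul_mem_openCell hx) (by rwa [h])

theorem closedCell_smul (g : G) (e : cell (Set.univ : Set X) n) :
    closedCell n (g • e) = (fun x => g • x) '' closedCell n e := by
  rw [← closure_openCell_eq_closedCell, openCell_smul, ← closure_openCell_eq_closedCell]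
  exact ((Homeomorph.smul g).image_closure _).symm

theorem cellFrontier_eq_diff (e : cell (Set.univ : Set X) n) :
    cellFrontier n e = closedCell n e \ openCell n e := by
  rw [← cellFrontier_union_openCell_eq_closedCell, Set.union_sdiff_right, eq_comm, sdiff_eq_left]
  refine Set.disjoint_left.2 fun x hx hx' => notMem_skel_of_mem_openCell hx' ?_
  exact cellFrontier_subset_skeletonLT n e hx

theorem cellFrontier_smul (g : G) (e : cell (Set.univ : Set X) n) :
    cellFrontier n (g • e) = (fun x => g • x) '' cellFrontier n e := by
  rw [cellFrontier_eq_diff, cellFrontier_eq_diff, closedCell_smul, openCell_smul,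
    Set.image_sdiff (MulAction.injective g)]

theorem smul_eq_of_mem_closedCell {g : G} {e : cell (Set.univ : Set X) n} (hg : g • e = e) {x : X}
    (hx : x ∈ closedCell n e) : g • x = x := by
  rw [← closure_openCell_eq_closedCell] at hx
  have : IsClosed {x : X | g • x = x} := isClosed_eq (continuous_const_smul g) continuous_id
  refine this.closure_subset_iff.2 (fun y hy => ?_) hx
  have h : g ∈ stabilizer G y := stabilizer_eq_of_mem_openCell (G := G) hy ▸ hg
  exact h

theorem IsCharMap.smul {e : cell (Set.univ : Set X) n} {f : C(Disk.{u} n, X)} (h : IsCharMap e f)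
    (g : G) : IsCharMap (g • e) (g • f) where
  mem_openCell x hx := smul_mem_openCell (h.mem_openCell x hx)
  mem_cellFrontier x hx := by
    rw [cellFrontier_smul]
    exact ⟨_, h.mem_cellFrontier x hx, rfl⟩
  inj x y hx hy hxy := h.inj x y hx hy (MulAction.injective g hxy)
  surj := by
    rw [openCell_smul]
    rintro _ ⟨x, hx, rfl⟩
    obtain ⟨y, rfl⟩ := h.surj hx
    exact ⟨y, rfl⟩

variable (G X) in
/-- The characteristic maps of a `G`-CW complex can be chosen equivariantly. -/
theorem exists_equivariant_charMap (n : ℕ) :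
    ∃ Ψ : cell (Set.univ : Set X) n → C(Disk.{u} n, X),
      (∀ e, IsCharMap e (Ψ e)) ∧ ∀ (g : G) e, Ψ (g • e) = g • Ψ e :=
  exists_equivariant_choice (fun e f => IsCharMap e f) (fun g _ _ h => h.smul g) fun e =>
    ⟨charMap _ n e, isCharMap_charMap e, fun _ hg => ContinuousMap.ext fun x =>
      smul_eq_of_mem_closedCell hg ((isCharMap_charMap e).mem_closedCell x)⟩

theorem smul_mem_skel (g : G) : Set.MapsTo (fun x : X => g • x) (skel Set.univ n)
    (skel Set.univ n) := fun x hx => by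
  obtain ⟨m, hm, e, he⟩ := mem_skel.1 hx
  exact mem_skel.2 ⟨m, hm, g • e, smul_mem_openCell he⟩

/-- The cells of `X^K` are those whose stabilizer contains `K`. -/
theorem mem_fixedComplex_I {K : Subgroup G} {e : cell (Set.univ : Set X) n} :
    e ∈ (fixedComplex (X := X) K).I n ↔ K ≤ stabilizer G e := by
  have h0 := map_zero_mem_openCell n e
  rw [stabilizer_eq_of_mem_openCell h0]
  constructor
  · intro h g hg
    exact mem_fixedSet.1 (h h0) g hg
  · intro h
    exact openCell_subset_fixedSet K h0 (mem_fixedSet.2 h)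

/-- The cells of the singular set of `X^K` are those whose stabilizer is strictly larger than `K`.
-/
theorem mem_singComplex_I {K : Subgroup G} {e : cell (Set.univ : Set X) n}
    (he : Finite (stabilizer G e)) : e ∈ (singComplex (X := X) K).I n ↔ K < stabilizer G e := by
  have h0 := map_zero_mem_openCell n e
  constructor
  · intro h
    obtain ⟨L, hL, hx⟩ := Set.mem_iUnion₂.1 (h h0)
    exact hL.2.trans_le (mem_fixedComplex_I.1 (openCell_subset_fixedSet L h0 hx))
  · intro h x hx
    exact Set.mem_iUnion₂.2 ⟨stabilizer G e, ⟨he, h⟩,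
      (mem_fixedComplex_I (K := stabilizer G e)).2 le_rfl hx⟩

/-! ### Finiteness of the set of orbits of cells -/

omit hX [MulAction G X] [ContinuousConstSMul G X] in
/-- A set that meets every open cell in at most one point is closed. -/
theorem isClosed_of_subsingleton_inter {A : Set X}
    (hA : ∀ n (e : cell (Set.univ : Set X) n), (A ∩ openCell n e).Subsingleton) : IsClosed A := by
  rw [CWComplex.closed Set.univ A (Set.subset_univ _)]
  intro n e
  obtain ⟨I, hI⟩ := CWComplex.cellFrontier_subset_finite_openCell n e
  refine Set.Finite.isClosed ?_
  rw [← cellFrontier_union_openCell_eq_closedCell, Set.inter_union_distrib_left]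
  refine Set.Finite.union ?_ (hA n e).finite
  refine Set.Finite.subset (s := ⋃ m ∈ Finset.range n, ⋃ j ∈ I m, A ∩ openCell m j)
    ((Finset.range n).finite_toSet.biUnion fun m _ =>
      (I m).finite_toSet.biUnion fun j _ => (hA m j).finite) ?_
  rintro x ⟨hxA, hx⟩
  obtain ⟨m, hm, j, hj, hxj⟩ : ∃ m < n, ∃ j ∈ I m, x ∈ openCell m j := by simpa using hI hx
  simp only [Set.mem_iUnion]
  exact ⟨m, Finset.mem_range.2 hm, j, hj, hxA, hxj⟩

variable (G X) in
/-- If the orbit space is compact, then there are only finitely many orbits of cells: choose a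
point in every cell, equivariantly; the image of the set of these points in the orbit space is
closed and discrete. -/
theorem exists_finite_cell_invariant [CompactSpace (Quotient (orbitRel G X))] :
    ∃ (T : Set (Quotient (orbitRel G X))) (q : ∀ n, cell (Set.univ : Set X) n → T),
      T.Finite ∧ ∀ n m (e : cell (Set.univ : Set X) n) (e' : cell (Set.univ : Set X) m),
        q n e = q m e' → ∃ h : n = m, ∃ g : G, h ▸ (g • e) = e' := by
  choose Ψ hΨ hΨG using exists_equivariant_charMap G X
  -- the center `p n e` of the cell `e`
  let z : ∀ n, Disk.{u} n := fun n => ⟨⟨0, by simp⟩⟩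
  have hz : ∀ n, z n ∉ diskSphere n := fun n h => by
    have : ‖(0 : Fin n → ℝ)‖ = 1 := mem_sphere_zero_iff_norm.1 h
    simp at this
  let p : ∀ n, cell (Set.univ : Set X) n → X := fun n e => Ψ n e (z n)
  have hp : ∀ n e, p n e ∈ openCell n e := fun n e => (hΨ n e).mem_openCell _ (hz n)
  have hpG : ∀ n (g : G) e, p n (g • e) = g • p n e := fun n g e => by
    simp only [p, hΨG]
    rfl
  have hpc : ∀ n m (e : cell (Set.univ : Set X) n) (e' : cell (Set.univ : Set X) m),
      p n e ∈ openCell m e' → (⟨n, e⟩ : Σ n, cell (Set.univ : Set X) n) = ⟨m, e'⟩ :=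
    fun n m e e' h => eq_of_not_disjoint_openCell (Set.not_disjoint_iff.2 ⟨_, hp n e, h⟩)
  let π : X → Quotient (orbitRel G X) := Quotient.mk _
  let T : Set (Quotient (orbitRel G X)) := Set.range fun s : Σ n, cell (Set.univ : Set X) n =>
    π (p s.1 s.2)
  -- every set of orbits of centers is closed, so `T` is discrete, and compact
  have hclosed : ∀ S ⊆ T, IsClosed S := by
    intro S hS
    rw [← isQuotientMap_quotient_mk'.isClosed_preimage]
    refine isClosed_of_subsingleton_inter fun n e => ?_
    have key : ∀ x, π x ∈ S → x ∈ openCell n e → x = p n e := by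
      intro x hx hxe
      obtain ⟨⟨m, j⟩, hj⟩ := hS hx
      obtain ⟨g, hg⟩ := orbitRel_apply.1 (Quotient.exact hj.symm)
      have hg' : p m (g • j) = x := (hpG m g j).trans hg
      have := hpc m n (g • j) e (hg' ▸ hxe)
      cases this
      exact hg'.symm
    exact fun x hx y hy => (key x hx.1 hx.2).trans (key y hy.1 hy.2).symm
  have hT : T.Finite := by
    refine (hclosed T subset_rfl).isCompact.finite ⟨?_⟩
    refine discreteTopology_iff_forall_isClosed.2 fun S => ?_
    rw [(hclosed T subset_rfl).isClosedEmbedding_subtypeVal.isClosed_iff_image_isClosed]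
    exact hclosed _ (by rintro _ ⟨x, -, rfl⟩; exact x.2)
  refine ⟨T, fun n e => ⟨π (p n e), ⟨n, e⟩, rfl⟩, hT, fun n m e e' h => ?_⟩
  obtain ⟨g, hg⟩ := orbitRel_apply.1 (Quotient.exact (congrArg Subtype.val h).symm)
  have hg' : p n (g • e) = p m e' := (hpG n g e).trans hg
  have := hpc n m (g • e) e' (hg' ▸ hp m e')
  cases this
  exact ⟨rfl, g, rfl⟩

end Cells

section Model

open RelCWComplex MulAction

/-! ### The cell model of a cocompact model -/

variable {G : Type v} [Group G] {X : Type u} [TopologicalSpace X] [T2Space X] [MulAction G X]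
  [ContinuousConstSMul G X] [CWComplex (Set.univ : Set X)]

/-- A nonempty CW complex has a vertex, since the frontier of a cell of positive dimension is
nonempty. -/
theorem exists_cell_zero {C : Set X} [CWComplex C] (hC : C.Nonempty) : Nonempty (cell C 0) := by
  classical
  have h : ∃ n, Nonempty (cell C n) := by
    obtain ⟨x, hx⟩ := hC
    rw [← CWComplex.iUnion_openCell_eq_complex (C := C)] at hx
    obtain ⟨n, e, -⟩ : ∃ n, ∃ e : cell C n, x ∈ openCell n e := by simpa using hx
    exact ⟨n, ⟨e⟩⟩
  -- the frontier of a cell of least dimension is covered by cells of smaller dimension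
  suffices Nat.find h = 0 from this ▸ Nat.find_spec h
  by_contra hne
  obtain ⟨e⟩ := Nat.find_spec h
  obtain ⟨x, hx⟩ := nonempty_cellFrontier hne e
  obtain ⟨m, hm, e', -⟩ := mem_skel.1 (cellFrontier_subset_skeletonLT _ e hx)
  exact Nat.find_min h hm ⟨e'⟩

theorem exists_mapDomain_val_eq {E : Type*} {s : Set E} {k : E →₀ ℤ} (hk : ∀ e, k e ≠ 0 → e ∈ s) :
    ∃ k' : s →₀ ℤ, k'.mapDomain Subtype.val = k :=
  ⟨k.comapDomain Subtype.val Subtype.val_injective.injOn,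
    Finsupp.mapDomain_comapDomain _ Subtype.val_injective _ fun e he =>
      ⟨⟨e, hk e (Finsupp.mem_support_iff.1 he)⟩, rfl⟩⟩

theorem mapDomain_val_apply_ne_zero {E : Type*} {s : Set E} {k : s →₀ ℤ} {e : E}
    (h : k.mapDomain Subtype.val e ≠ 0) : e ∈ s := by
  by_contra he
  exact h (Finsupp.mapDomain_of_notMem_range _ _ (by simpa using he))

theorem mapDomain_val_sum {E : Type*} {s : Set E} (k : s →₀ ℤ) :
    (k.mapDomain Subtype.val).sum (fun _ a => a) = k.sum fun _ a => a :=
  Finsupp.sum_mapDomain_index (fun _ => rfl) fun _ _ _ => rfl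

variable [hX : IsGCWComplex G X]

/-- The `n`-cells form a `G`-set with finite stabilizers and finitely many orbits. -/
theorem isProperCofinite_cell (hM : IsCocompactModel G X) (n : ℕ) :
    IsProperCofinite G (cell (Set.univ : Set X) n) where
  finite_stabilizer e := by
    rw [stabilizer_eq_of_mem_openCell (map_zero_mem_openCell n e)]
    exact hM.finite_stabilizer _
  finite_orbits := by
    have := hM.compactSpace_quotient
    obtain ⟨T, q, hT, hq⟩ := exists_finite_cell_invariant G X
    have := hT.to_subtype
    refine Finite.of_injective (fun o : orbitRel.Quotient G (cell (Set.univ : Set X) n) =>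
      q n o.out) fun o o' h => ?_
    obtain ⟨_, g, hg⟩ := hq n n _ _ h
    rw [← o.out_eq, ← o'.out_eq]
    exact (Quotient.sound (orbitRel_apply.2 ⟨g, hg⟩)).symm

/-- A cocompact model is finite-dimensional. -/
theorem exists_dimension_bound (hM : IsCocompactModel G X) :
    ∃ D, ∀ n, D ≤ n → IsEmpty (cell (Set.univ : Set X) n) := by
  have := hM.compactSpace_quotient
  obtain ⟨T, q, hT, hq⟩ := exists_finite_cell_invariant G X
  have := hT.to_subtype
  let S := {n : ℕ | Nonempty (cell (Set.univ : Set X) n)}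
  have hS : S.Finite := by
    refine Set.finite_coe_iff.1 (Finite.of_injective (fun n : S => q n n.2.some) fun n m h => ?_)
    exact Subtype.ext (hq _ _ _ _ h).1
  obtain ⟨D, hD⟩ := hS.bddAbove
  exact ⟨D + 1, fun n hn => ⟨fun e => by have := hD (show n ∈ S from ⟨e⟩); omega⟩⟩

variable {Ψ : ∀ n, cell (Set.univ : Set X) n → C(Disk.{u} n, X)} (hΨ : ∀ n e, IsCharMap e (Ψ n e))
  (hΨG : ∀ n (g : G) e, Ψ n (g • e) = g • Ψ n e)

/-- The cells fixed by `H` as cells of the fixed point complex. -/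
def fixedCell {H : Subgroup G} {n : ℕ} (e : cell (Set.univ : Set X) n) (he : H ≤ stabilizer G e) :
    cell (fixedComplex (X := X) H : Set X) n :=
  (⟨e, mem_fixedComplex_I.2 he⟩ : (fixedComplex (X := X) H).I n)

include hΨG in
theorem isEquivariant_cellBoundary (n : ℕ) :
    IsEquivariant G (cellBoundary hΨ n).toIntLinearMap := fun g e x => by
  have h := cellBoundary_mapDomain hΨ hΨ ⟨fun x : X => g • x, continuous_const_smul g⟩
    (fun n e => g • e) (fun n e => (hΨG n g e).symm) (fun n => smul_mem_skel g) (n := n) (gen e)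
  rw [Finsupp.mapDomain_single] at h
  change cellBoundary hΨ n (gen (g • e)) (g • x) = cellBoundary hΨ n (gen e) x
  rw [h, mapDomain_smul_apply, inv_smul_smul]

theorem cellBoundary_mapDomain_val (H : Subgroup G) (n : ℕ)
    (k : cell (fixedComplex (X := X) H : Set X) (n + 1) →₀ ℤ) :
    cellBoundary hΨ n (k.mapDomain Subtype.val) =
      (cellBoundary (isCharMap_subcomplex hΨ (fixedComplex (X := X) H)) n k).mapDomain
        Subtype.val :=
  cellBoundary_subcomplex hΨ _ k

include hΨG in
/-- The boundary of a cell only involves cells with larger or equal stabilizer, since the fixed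
point complex of the stabilizer is a subcomplex. -/
theorem isStabMap_cellBoundary (n : ℕ) :
    IsStabMap G (cellBoundary hΨ n).toIntLinearMap where
  equivariant := isEquivariant_cellBoundary hΨ hΨG n
  le e x hx := by
    have h := cellBoundary_mapDomain_val hΨ (stabilizer G e) n
      (Finsupp.single (fixedCell e le_rfl) 1)
    rw [Finsupp.mapDomain_single] at h
    replace hx : cellBoundary hΨ n (gen e) x ≠ 0 := hx
    rw [show gen e = Finsupp.single (fixedCell e (le_refl (stabilizer G e))).1 (1 : ℤ) from rfl, h]
      at hx
    exact mem_fixedComplex_I.1 (mapDomain_val_apply_ne_zero hx)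

theorem contractibleSpace_fixedComplex (hM : IsCocompactModel G X) (H : Subgroup G)
    (hH : Finite H) : ContractibleSpace (fixedComplex (X := X) H : Set X) :=
  hM.contractible H hH

/-- The cell model of a cocompact model with respect to equivariant characteristic maps. -/
def cellModel (hM : IsCocompactModel G X)
    [∀ n, IsProperCofinite G (cell (Set.univ : Set X) n)] :
    CellModel G (fun n => cell (Set.univ : Set X) n) where
  d n := (cellBoundary hΨ n).toIntLinearMap
  isStabMap := isStabMap_cellBoundary hΨ hΨG
  d_comp_d n := LinearMap.ext fun k => cellBoundary_cellBoundary hΨ k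
  sum_d k := sum_cellBoundary hΨ k
  exact H hH n k hk h := by
    have := contractibleSpace_fixedComplex hM H hH
    obtain ⟨D, hD⟩ := exists_dimension_bound hM
    obtain ⟨k', rfl⟩ := exists_mapDomain_val_eq (s := (fixedComplex (X := X) H).I (n + 1))
      fun e he => mem_fixedComplex_I.2 (mem_fixedChains.1 hk e he)
    have h' := (cellBoundary_mapDomain_val hΨ H n k').symm.trans h
    have h0 := Finsupp.mapDomain_injective Subtype.val_injective
      (h'.trans Finsupp.mapDomain_zero.symm)
    obtain ⟨l, hl⟩ := exists_cellBoundary_eq (isCharMap_subcomplex hΨ (fixedComplex (X := X) H))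
      (D := D) (fun m hm => ⟨fun e => (hD m hm).false e.1⟩) h0
    refine ⟨l.mapDomain Subtype.val, mem_fixedChains.2 fun e he =>
      mem_fixedComplex_I.1 (mapDomain_val_apply_ne_zero he), ?_⟩
    exact (cellBoundary_mapDomain_val hΨ H (n + 1) l).trans
      (congrArg (Finsupp.mapDomain Subtype.val) hl)
  exact_zero H hH k hk h := by
    have := contractibleSpace_fixedComplex hM H hH
    obtain ⟨D, hD⟩ := exists_dimension_bound hM
    obtain ⟨k', rfl⟩ := exists_mapDomain_val_eq (s := (fixedComplex (X := X) H).I 0)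
      fun e he => mem_fixedComplex_I.2 (mem_fixedChains.1 hk e he)
    obtain ⟨l, hl⟩ := exists_cellBoundary_eq_zero
      (isCharMap_subcomplex hΨ (fixedComplex (X := X) H))
      (D := D) (fun m hm => ⟨fun e => (hD m hm).false e.1⟩) ((mapDomain_val_sum k').symm.trans h)
    refine ⟨l.mapDomain Subtype.val, mem_fixedChains.2 fun e he =>
      mem_fixedComplex_I.1 (mapDomain_val_apply_ne_zero he), ?_⟩
    exact (cellBoundary_mapDomain_val hΨ H 0 l).trans
      (congrArg (Finsupp.mapDomain Subtype.val) hl)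
  exists_vertex H hH := by
    have := contractibleSpace_fixedComplex hM H hH
    obtain ⟨x⟩ : Nonempty (fixedComplex (X := X) H : Set X) := inferInstance
    obtain ⟨e⟩ := exists_cell_zero (C := (fixedComplex (X := X) H : Set X)) ⟨x, x.2⟩
    exact ⟨e.1, mem_fixedComplex_I.1 e.2⟩
  finite_dimensional := exists_dimension_bound hM

/-! ### Comparison of the relative cohomology groups -/

theorem nontrivial_relCompactCohomology_iff {C A : Set X} [CWComplex C] [CWComplex A] {n : ℕ} :
    Nontrivial (RelCompactCohomology C A n) ↔
      ∃ f ∈ relCompactCocycles C A n, f ∉ relCompactCoboundaries C A n := by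
  rw [QuotientAddGroup.nontrivial_iff, Ne, AddSubgroup.addSubgroupOf_eq_top,
    SetLike.not_le_iff_exists]

/-- A cochain of `X^K` that vanishes on the singular set corresponds to a finitely supported
function on the cells of `X` with stabilizer `K`. -/
structure Represents (K : Subgroup G) {n : ℕ}
    (f : CellularCochains (fixedComplex (X := X) K : Set X) n)
    (F : cell (Set.univ : Set X) n →₀ ℤ) : Prop where
  stabilizer_eq : ∀ e, F e ≠ 0 → stabilizer G e = K
  apply_eq : ∀ k, cochainEquiv (isCharMap_subcomplex hΨ (fixedComplex (X := X) K)) n f k =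
      Finsupp.linearCombination ℤ F (k.mapDomain Subtype.val)

variable {hΨ} {K : Subgroup G} {n : ℕ}

theorem singComplex_I_subset (hM : IsCocompactModel G X) (n : ℕ) :
    (singComplex (X := X) K).I n ⊆ (fixedComplex (X := X) K).I n := fun e he => by
  have hfin := (isProperCofinite_cell hM n).finite_stabilizer e
  exact mem_fixedComplex_I.2 ((mem_singComplex_I hfin).1 he).le

theorem cell_stabilizer_eq_of_notMem (hM : IsCocompactModel G X)
    {e : cell (fixedComplex (X := X) K : Set X) n} (he : e.1 ∉ (singComplex (X := X) K).I n) :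
    stabilizer G e.1 = K := by
  have hfin := (isProperCofinite_cell hM n).finite_stabilizer e.1
  rw [mem_singComplex_I hfin] at he
  exact ((mem_fixedComplex_I.1 e.2).lt_or_eq.resolve_left he).symm

theorem Represents.apply_single {f : CellularCochains (fixedComplex (X := X) K : Set X) n}
    {F : cell (Set.univ : Set X) n →₀ ℤ} (h : Represents hΨ K f F)
    (e : cell (fixedComplex (X := X) K : Set X) n) :
    cochainEquiv (isCharMap_subcomplex hΨ (fixedComplex (X := X) K)) n f (Finsupp.single e 1) =
      F e.1 := by
  rw [h.apply_eq, Finsupp.mapDomain_single, Finsupp.linearCombination_single, one_smul]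

theorem Represents.mem_relCompactCochains (hM : IsCocompactModel G X)
    {f : CellularCochains (fixedComplex (X := X) K : Set X) n}
    {F : cell (Set.univ : Set X) n →₀ ℤ} (h : Represents hΨ K f F) :
    f ∈ relCompactCochains (fixedComplex (X := X) K : Set X)
      (singComplex (X := X) K : Set X) n := by
  refine AddSubgroup.mem_inf.2
    ⟨(mem_compactCochains_iff (isCharMap_subcomplex hΨ (fixedComplex (X := X) K))).2 ?_,
      (mem_relCochains_iff hΨ (singComplex_I_subset hM)).2 fun e he => ?_⟩
  · simp only [h.apply_single]
    exact (Finsupp.hasFiniteSupport F).preimage Subtype.val_injective.injOn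
  · rw [h.apply_single]
    by_contra hne
    have hfin := (isProperCofinite_cell hM n).finite_stabilizer e.1
    exact ((mem_singComplex_I hfin).1 he).ne' (h.stabilizer_eq _ hne)

/-- Every compactly supported relative cochain is represented by a finitely supported function. -/
theorem exists_represents_of_mem (hM : IsCocompactModel G X)
    {f : CellularCochains (fixedComplex (X := X) K : Set X) n}
    (hf : f ∈ relCompactCochains (fixedComplex (X := X) K : Set X)
      (singComplex (X := X) K : Set X) n) : ∃ F, Represents hΨ K f F := by
  classical
  obtain ⟨h1, h2⟩ := AddSubgroup.mem_inf.1 hf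
  rw [mem_compactCochains_iff (isCharMap_subcomplex hΨ (fixedComplex (X := X) K))] at h1
  rw [mem_relCochains_iff hΨ (singComplex_I_subset hM)] at h2
  set φ := cochainEquiv (isCharMap_subcomplex hΨ (fixedComplex (X := X) K)) n f with hφ
  let F' : cell (fixedComplex (X := X) K : Set X) n →₀ ℤ :=
    Finsupp.ofSupportFinite (fun e => φ (Finsupp.single e 1)) h1
  have hF : ∀ e : cell (fixedComplex (X := X) K : Set X) n,
      F'.mapDomain Subtype.val e.1 = φ (Finsupp.single e 1) := fun e =>
    Finsupp.mapDomain_apply Subtype.val_injective F' e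
  refine ⟨F'.mapDomain Subtype.val, fun e he => ?_, fun k => ?_⟩
  · have he' : e ∈ (fixedComplex (X := X) K).I n := mapDomain_val_apply_ne_zero he
    refine cell_stabilizer_eq_of_notMem hM (e := (⟨e, he'⟩ : (fixedComplex (X := X) K).I n))
      fun hs => he ?_
    exact (hF (⟨e, he'⟩ : (fixedComplex (X := X) K).I n)).trans (h2 _ hs)
  · have : φ = (Finsupp.linearCombination ℤ (F'.mapDomain Subtype.val)).toAddMonoidHom.comp
        (Finsupp.mapDomain.addMonoidHom Subtype.val) := by
      refine Finsupp.addHom_ext' fun e => AddMonoidHom.ext_int ?_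
      refine (hF e).symm.trans (Eq.symm ?_)
      change Finsupp.linearCombination ℤ (F'.mapDomain Subtype.val)
        (Finsupp.mapDomain Subtype.val (Finsupp.single e 1)) = _
      rw [Finsupp.mapDomain_single, Finsupp.linearCombination_single, one_smul]
    exact DFunLike.congr_fun this k

variable (hΨ) in
/-- Every finitely supported function on the cells with stabilizer `K` represents a cochain. -/
theorem exists_represents {F : cell (Set.univ : Set X) n →₀ ℤ}
    (hF : ∀ e, F e ≠ 0 → stabilizer G e = K) :
    ∃ f : CellularCochains (fixedComplex (X := X) K : Set X) n, Represents hΨ K f F :=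
  ⟨(cochainEquiv (isCharMap_subcomplex hΨ (fixedComplex (X := X) K)) n).symm
    ((Finsupp.linearCombination ℤ F).toAddMonoidHom.comp
        (Finsupp.mapDomain.addMonoidHom Subtype.val)), hF, fun k => by
    rw [AddEquiv.apply_symm_apply]
    rfl⟩

/-- The coboundary of a represented cochain in terms of the representing function. -/
theorem Represents.coboundary_apply {f : CellularCochains (fixedComplex (X := X) K : Set X) n}
    {F : cell (Set.univ : Set X) n →₀ ℤ} (h : Represents hΨ K f F)
    (e : cell (fixedComplex (X := X) K : Set X) (n + 1)) :
    cochainEquiv (isCharMap_subcomplex hΨ (fixedComplex (X := X) K)) (n + 1)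
        (cellularCoboundary _ n f) (Finsupp.single e 1) =
      Finsupp.linearCombination ℤ F (cellBoundary hΨ n (gen e.1)) := by
  rw [cochainEquiv_cellularCoboundary, AddMonoidHom.comp_apply, h.apply_eq,
    ← cellBoundary_mapDomain_val, Finsupp.mapDomain_single]

theorem cochain_ext {f g : CellularCochains (fixedComplex (X := X) K : Set X) n}
    (h : ∀ e, cochainEquiv (isCharMap_subcomplex hΨ (fixedComplex (X := X) K)) n f
        (Finsupp.single e 1) =
      cochainEquiv (isCharMap_subcomplex hΨ (fixedComplex (X := X) K)) n g (Finsupp.single e 1)) :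
    f = g :=
  (cochainEquiv (isCharMap_subcomplex hΨ (fixedComplex (X := X) K)) n).injective
    (Finsupp.addHom_ext' fun e => AddMonoidHom.ext_int (h e))

variable (hM : IsCocompactModel G X) [∀ n, IsProperCofinite G (cell (Set.univ : Set X) n)]

/-- Cocycles are represented by the cocycles of the cell model. -/
theorem Represents.mem_relCompactCocycles_iff
    {f : CellularCochains (fixedComplex (X := X) K : Set X) n}
    {F : cell (Set.univ : Set X) n →₀ ℤ} (h : Represents hΨ K f F) :
    f ∈ relCompactCocycles (fixedComplex (X := X) K : Set X) (singComplex (X := X) K : Set X) n ↔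
      (cellModel hΨ hΨG hM).IsRelCocycle K n F := by
  rw [relCompactCocycles, AddSubgroup.mem_inf, and_iff_right (h.mem_relCompactCochains hM),
    CellModel.IsRelCocycle, and_iff_right h.stabilizer_eq, AddMonoidHom.mem_ker]
  constructor
  · intro h0 e he
    have := h.coboundary_apply (fixedCell e he)
    rw [h0, map_zero] at this
    exact this.symm
  · intro h0
    refine cochain_ext (hΨ := hΨ) fun e => ?_
    rw [h.coboundary_apply, map_zero]
    exact h0 e.1 (mem_fixedComplex_I.1 e.2)

/-- Coboundaries are represented by the coboundaries of the cell model. -/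
theorem Represents.mem_relCompactCoboundaries_iff
    {f : CellularCochains (fixedComplex (X := X) K : Set X) n}
    {F : cell (Set.univ : Set X) n →₀ ℤ} (h : Represents hΨ K f F) :
    f ∈ relCompactCoboundaries (fixedComplex (X := X) K : Set X)
      (singComplex (X := X) K : Set X) n ↔
      (cellModel hΨ hΨG hM).IsRelCoboundary K n F := by
  cases n with
  | zero =>
    change f = 0 ↔ F = 0
    constructor
    · rintro rfl
      ext e
      by_contra hne
      have he : K ≤ stabilizer G e := (h.stabilizer_eq e hne).ge
      refine hne ((h.apply_single (fixedCell e he)).symm.trans ?_)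
      rw [map_zero]
      rfl
    · rintro rfl
      refine cochain_ext (hΨ := hΨ) fun e => ?_
      rw [h.apply_single, map_zero]
      rfl
  | succ n =>
    constructor
    · rintro ⟨g, hg, rfl⟩
      obtain ⟨γ, hγ⟩ := exists_represents_of_mem (hΨ := hΨ) hM hg
      refine ⟨γ, hγ.stabilizer_eq, fun e he => ?_⟩
      exact (h.apply_single (fixedCell e he)).symm.trans (hγ.coboundary_apply (fixedCell e he))
    · rintro ⟨γ, hγ, hγ'⟩
      obtain ⟨g, hg⟩ := exists_represents hΨ hγ
      refine ⟨g, hg.mem_relCompactCochains hM, cochain_ext (hΨ := hΨ) fun e => ?_⟩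
      rw [hg.coboundary_apply, h.apply_single]
      exact (hγ' e.1 (mem_fixedComplex_I.1 e.2)).symm

/-- The cellular cohomology of the pair `(X^K, X^K_sing)` with compact supports is computed by
the cell model. -/
theorem nontrivial_relCompactCohomology_iff_hasCohomology :
    Nontrivial (RelCompactCohomology (fixedComplex (X := X) K : Set X)
      (singComplex (X := X) K : Set X) n) ↔ (cellModel hΨ hΨG hM).HasCohomology K n := by
  rw [nontrivial_relCompactCohomology_iff]
  constructor
  · rintro ⟨f, hf, hf'⟩
    obtain ⟨F, hF⟩ := exists_represents_of_mem (hΨ := hΨ) hM (AddSubgroup.mem_inf.1 hf).1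
    exact ⟨F, (hF.mem_relCompactCocycles_iff hΨG hM).1 hf,
      fun h => hf' ((hF.mem_relCompactCoboundaries_iff hΨG hM).2 h)⟩
  · rintro ⟨F, hF, hF'⟩
    obtain ⟨f, hf⟩ := exists_represents hΨ hF.1
    exact ⟨f, (hf.mem_relCompactCocycles_iff hΨG hM).2 hF,
      fun h => hF' ((hf.mem_relCompactCoboundaries_iff hΨG hM).1 h)⟩

end Model

end BredonCW

end

theorem mainTheorem1 {G : Type v} [Group G] {X : Type u} [TopologicalSpace X] [T2Space X]
    [MulAction G X] [ContinuousConstSMul G X] [CWComplex (Set.univ : Set X)]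
    (hX : BredonCW.IsCocompactModel G X) :
    ∃ d : ℕ, BredonCW.bredonCd G = d ∧
      IsGreatest {n : ℕ | ∃ K : Subgroup G, Finite K ∧
        letI : BredonCW.IsGCWComplex G X := hX.toIsGCWComplex
        Nontrivial (BredonCW.RelCompactCohomology
          (BredonCW.fixedComplex (X := X) K : Set X)
          (BredonCW.singComplex (X := X) K : Set X) n)} d := by
  have hGCW : BredonCW.IsGCWComplex G X := hX.toIsGCWComplex
  have hfin := BredonCW.isProperCofinite_cell hX
  choose Ψ hΨ hΨG using BredonCW.exists_equivariant_charMap G X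
  obtain ⟨d, hd, hd'⟩ := (BredonCW.cellModel hΨ hΨG hX).exists_bredonCd_eq
  refine ⟨d, hd, ?_⟩
  convert hd' using 5
  exact and_congr_right fun _ =>
    BredonCW.nontrivial_relCompactCohomology_iff_hasCohomology hΨG hX
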